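/- Let $(X,d,\varphi)$ be an irreducible Smale space: $X$ is a compact metric space, $\varphi$ a homeomorphism, there are constants $\varepsilon_X>0$, $\lambda>1$ and a continuous bracket $[x,y]\in X$, defined for $d(x,y)<\varepsilon_X$, with $[x,x]=x$, $[x,[y,z]]=[x,z]$, $[[x,y],z]=[x,z]$, $\varphi[x,y]=[\varphi(x),\varphi(y)]$ whenever both sides are defined, $d(\varphi(x),\varphi(y))\le\lambda^{-1}d(x,y)$ if $[x,y]=y$, and $d(\varphi^{-1}(x),\varphi^{-1}(y))\le\lambda^{-1}d(x,y)$ if $[x,y]=x$; irreducible means that the periodic points are dense and some orbit $\{\varphi^n(x)\mid n\in\mathbb Z\}$ is dense. Put $X^s(x,\delta)=\{y\mid d(x,y)<\delta,\ [y,x]=x\}$ and $X^u(x,\delta)=\{y\mid d(x,y)<\delta,\ [x,y]=x\}$ for $\delta\le\varepsilon_X$; $x\sim_s y$ (resp. $x\sim_u y$) if $d(\varphi^n(x),\varphi^n(y))\to0$ as $n\to+\infty$ (resp. $n\to-\infty$). Let $P,Q$ be nonempty, finite, disjoint, $\varphi$-invariant sets of periodic points, let $X^s(P)$ (resp. $X^u(Q)$)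 be the union of the stable classes of the points of $P$ (resp. the unstable classes of the points of $Q$), with the topology in which the sets $X^s(y,\delta)$ (resp. $X^u(y,\delta)$) are neighbourhood bases, and let $X^h(P,Q)=X^s(P)\cap X^u(Q)$, $X^s(P,\varepsilon)=\bigcup_{p\in P}X^s(p,\varepsilon)$, $\mathcal H=\ell^2(X^h(P,Q))$. Let $G=\{(v,w)\mid v\sim_s w,\ v,w\in X^u(Q)\}$, with the étale topology in which a neighbourhood base at $(v,w)$ is given, for small $\delta>0$, by the sets $\{(h(x),x)\mid x\in X^u(w,\delta),\ h(x)\in X^u(v,\delta)\}$, where $h(x)=\varphi^{-N}[\varphi^N(x),\varphi^N(v)]$ and $\varphi^N(w)\in X^s(\varphi^N(v),\varepsilon_X/2)$. Let $(\pi(f)\xi)(x)=\sum_{(x,y)\in G}f(x,y)\xi(y)$ for $f\in C_c(G)$, let $S$ be the norm closure of $\pi(C_c(G))$ in $\mathcal B(\mathcal H)$, let $u$ be the unitary $u\delta_x=\delta_{\varphi(x)}$, and let $\alpha(f)(x,y)=f(\varphi^{-1}(x),\varphi^{-1}(y))$. The stable Ruelle algebra $S\rtimes_\alpha\mathbb Z$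 acts on $\mathcal H$ through the covariant representation $(\pi,u)$, as the norm closure of $\operatorname{span}\{a u^k\mid a\in S,\ k\in\mathbb Z\}$. Let $0<\varepsilon\le\lambda^{-1}\varepsilon_X/2$ and let $\omega_0:X^s(P)\to[0,1]$ be any continuous function that is $0$ on $\overline{X^s(P,\varepsilon)}$ and $1$ on $X^s(P)\setminus\varphi^{-1}(X^s(P,\varepsilon))$. Put $$\omega_s(x)=\sum_{n=0}^\infty\omega_0(\varphi^n(x))-\sum_{n=1}^\infty\bigl(1-\omega_0(\varphi^{-n}(x))\bigr),\qquad D\delta_x=\omega_s(x)\delta_x,$$ with $\operatorname{Dom}(D)=\{\xi\in\mathcal H\mid\sum_x\omega_s(x)^2|\xi(x)|^2<\infty\}$. Then: 1. each $\pi(f)$, $f\in C_c(G)$, is a bounded operator, $\alpha$ maps $C_c(G)$ to itself, and $u\pi(f)u^{-1}=\pi(\alpha(f))$; 2. $u$ maps $\operatorname{Dom}(D)$ into itself and $[u,D]=uD-Du=u$ on $\operatorname{Dom}(D)$; 3. $(S\rtimes_\alpha\mathbb Z,\mathcal H,D)$ is a spectral triple: $\mathcal H$ is separable, $S\rtimes_\alpha\mathbb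 Z$ is a $*$-algebra of bounded operators, $D$ is unbounded and self-adjoint, the $a\in S\rtimes_\alpha\mathbb Z$ for which $[D,a]$ is bounded (that is, $a$ maps $\operatorname{Dom}(D)$ into itself and $Da-aD$ is bounded there) are norm dense in $S\rtimes_\alpha\mathbb Z$, and $a(1+D^2)^{-1}$ is compact for every $a\in S\rtimes_\alpha\mathbb Z$; 4. $S\rtimes_\alpha\mathbb Z$ has no unit; 5. $C_c(X^u(Q))$, acting on $\mathcal H$ by multiplication, is contained in $S\rtimes_\alpha\mathbb Z$, and the triple is $\theta$-summable: for all $a\in C_c(X^u(Q))$ and all $t>0$ the operator $a\,e^{-t(1+D^2)}$ is trace class. -/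

import Mathlib

open Filter Topology
open scoped CompactlySupported ENNReal

noncomputable section

/-! ## Spectral triples over concrete algebras of operators -/

section SpectralTriples

universe u

variable {H : Type u} [NormedAddCommGroup H] [InnerProductSpace ℂ H] [CompleteSpace H]

/-- The bounded operator `R` is the (two-sided) inverse `(1 + D²)⁻¹` of the possibly unbounded
operator `1 + D²`, whose domain is `{ξ ∈ Dom D | D ξ ∈ Dom D}`. -/
def IsInvOneAddSq (D : H →ₗ.[ℂ] H) (R : H →L[ℂ] H) : Prop :=
  (∀ ξ : H, ∃ h₁ : R ξ ∈ D.domain, ∃ h₂ : D ⟨R ξ, h₁⟩ ∈ D.domain,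
      R ξ + D ⟨D ⟨R ξ, h₁⟩, h₂⟩ = ξ) ∧
    ∀ (ξ : D.domain) (h : D ξ ∈ D.domain), R ((ξ : H) + D ⟨D ξ, h⟩) = ξ

/-- The commutator `[D, a]` is defined on `Dom D` (that is, `a` maps `Dom D` to itself) and extends
to a bounded operator. -/
def HasBoundedCommutator (D : H →ₗ.[ℂ] H) (a : H →L[ℂ] H) : Prop :=
  ∃ ha : ∀ ξ : D.domain, a ξ ∈ D.domain,
    ∃ C : ℝ, ∀ ξ : D.domain, ‖D ⟨a ξ, ha ξ⟩ - a (D ξ)‖ ≤ C * ‖(ξ : H)‖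

/-- `(A, H, D)` is a spectral triple: `H` is a separable Hilbert space, `A` is a `*`-algebra of
bounded operators on `H`, and `D` is an unbounded self-adjoint operator on `H` such that the
elements of `A` having bounded commutator with `D` are norm dense in `A` and `a (1 + D²)⁻¹` is
compact for all `a` in `A`. (Self-adjointness of a partially defined operator includes that its
domain is dense.) -/
structure IsSpectralTriple (A : Submodule ℂ (H →L[ℂ] H)) (D : H →ₗ.[ℂ] H) : Prop where
  separable : TopologicalSpace.SeparableSpace H
  mul_mem : ∀ a ∈ A, ∀ b ∈ A, a * b ∈ A
  star_mem : ∀ a ∈ A, star a ∈ A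
  selfAdjoint : IsSelfAdjoint D
  unbounded : ¬ ∃ C : ℝ, ∀ ξ : D.domain, ‖D ξ‖ ≤ C * ‖(ξ : H)‖
  dense_commutator : (A : Set (H →L[ℂ] H)) ⊆ closure {a | a ∈ A ∧ HasBoundedCommutator D a}
  compact_resolvent : ∃ R : H →L[ℂ] H, IsInvOneAddSq D R ∧ ∀ a ∈ A, IsCompactOperator (a * R)

/-- The algebra of operators `A` has no unit element. -/
def IsNonUnital (A : Submodule ℂ (H →L[ℂ] H)) : Prop :=
  ¬ ∃ e ∈ A, ∀ a ∈ A, e * a = a ∧ a * e = a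

/-- `T` is a trace class operator: `∑ ⟨eᵢ, |T| eᵢ⟩ < ∞` for some (equivalently every) orthonormal
basis `(eᵢ)`, where `|T| = (T* T)^{1/2}`. -/
def IsTraceClass (T : H →L[ℂ] H) : Prop :=
  ∃ (ι : Type u) (b : HilbertBasis ι ℂ H),
    Summable fun i => (inner ℂ (b i) (CFC.abs T (b i))).re

/-- Given `R = (1 + D²)⁻¹`, the operator `exp (-t (1 + D²))` for `t > 0`, as the continuous
functional calculus of the positive operator `R` at the function `r ↦ exp (-t / r)` on `(0, 1]`,
extended continuously by `0` at `r = 0`. -/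
def heatOp (R : H →L[ℂ] H) (t : ℝ) : H →L[ℂ] H :=
  cfc (fun r : ℝ => if 0 < r then Real.exp (-t / r) else 0) R

/-- `θ`-summability, tested on a set `B` of bounded operators: `a exp (-t (1 + D²))` is trace class
for all `a` in `B` and all `t > 0`. -/
def IsThetaSummableOn (B : Set (H →L[ℂ] H)) (D : H →ₗ.[ℂ] H) : Prop :=
  ∃ R : H →L[ℂ] H, IsInvOneAddSq D R ∧ ∀ a ∈ B, ∀ t : ℝ, 0 < t → IsTraceClass (a * heatOp R t)

end SpectralTriples

/-! ## Operators on `ℓ²` of a set -/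

section EllTwo

variable {ι : Type*}

/-- The unitary of `ℓ²(ι)` given by a permutation `e` of `ι`, `δ_x ↦ δ_{e x}`, that is
`(u ξ)(x) = ξ (e⁻¹ x)`. -/
def permUnitary (e : ι ≃ ι) :
    lp (fun _ : ι => ℂ) 2 ≃ₗᵢ[ℂ] lp (fun _ : ι => ℂ) 2 where
  toFun ξ := ⟨fun x => ξ (e.symm x), by
    have h := lp.memℓp ξ
    rw [memℓp_gen_iff (by norm_num)] at h
    exact memℓp_gen ((e.symm.summable_iff (f := fun x => ‖ξ x‖ ^ (2 : ℝ≥0∞).toReal)).2 h)⟩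
  invFun ξ := ⟨fun x => ξ (e x), by
    have h := lp.memℓp ξ
    rw [memℓp_gen_iff (by norm_num)] at h
    exact memℓp_gen ((e.summable_iff (f := fun x => ‖ξ x‖ ^ (2 : ℝ≥0∞).toReal)).2 h)⟩
  map_add' ξ η := by ext x; rfl
  map_smul' c ξ := by ext x; rfl
  left_inv ξ := by ext x; simp
  right_inv ξ := by ext x; simp
  norm_map' ξ := by
    have h2 : 0 < (2 : ℝ≥0∞).toReal := by norm_num
    rw [lp.norm_eq_tsum_rpow h2, lp.norm_eq_tsum_rpow h2]
    congr 1
    exact e.symm.tsum_eq (fun x => ‖ξ x‖ ^ (2 : ℝ≥0∞).toReal)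

/-- The operator `D δ_x = w(x) δ_x` on `ℓ²(ι)`, with domain `{ξ | ∑ w(x)² |ξ(x)|² < ∞}`. -/
def diagOp (w : ι → ℝ) : lp (fun _ : ι => ℂ) 2 →ₗ.[ℂ] lp (fun _ : ι => ℂ) 2 where
  domain :=
    { carrier := {ξ | Memℓp (fun x => (w x : ℂ) * ξ x) 2}
      add_mem' := fun {ξ η} hξ hη => by
        have h := Memℓp.add hξ hη
        have e : (fun x => (w x : ℂ) * (ξ + η) x) =
            (fun x => (w x : ℂ) * ξ x) + fun x => (w x : ℂ) * η x := by
          funext x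
          simp [mul_add]
        simpa only [Set.mem_ofPred_eq, e] using h
      zero_mem' := by
        have e : (fun x => (w x : ℂ) * (0 : lp (fun _ : ι => ℂ) 2) x) = 0 := by
          funext x
          simp
        simpa only [Set.mem_ofPred_eq, e] using (zero_memℓp : Memℓp (0 : ι → ℂ) 2)
      smul_mem' := fun c ξ hξ => by
        have h := Memℓp.const_smul hξ c
        have e : (fun x => (w x : ℂ) * (c • ξ) x) = c • fun x => (w x : ℂ) * ξ x := by
          funext x
          simp [mul_left_comm]
        simpa only [Set.mem_ofPred_eq, e] using h }
  toFun :=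
    { toFun := fun ξ => ⟨fun x => (w x : ℂ) * (ξ : lp (fun _ : ι => ℂ) 2) x, ξ.2⟩
      map_add' := fun ξ η => by
        ext x
        exact mul_add _ _ _
      map_smul' := fun c ξ => by
        ext x
        simp [mul_left_comm] }

end EllTwo

/-! ## Smale spaces -/

/-- The structure of a Smale space on a compact metric space `X`: a homeomorphism `φ`, constants
`εX > 0` and `lam > 1`, and a continuous bracket `[x, y]` defined for `d(x, y) < εX` (its values
on other pairs are irrelevant) satisfying the usual axioms, the algebraic identities being required
whenever both sides are defined. -/
structure SmaleSpace (X : Type*) [MetricSpace X] [CompactSpace X] where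
  φ : X ≃ₜ X
  εX : ℝ
  εX_pos : 0 < εX
  lam : ℝ
  one_lt_lam : 1 < lam
  bracket : X → X → X
  continuousOn_bracket :
    ContinuousOn (fun p : X × X => bracket p.1 p.2) {p | dist p.1 p.2 < εX}
  bracket_self : ∀ x, bracket x x = x
  bracket_right : ∀ x y z, dist y z < εX → dist x (bracket y z) < εX → dist x z < εX →
    bracket x (bracket y z) = bracket x z
  bracket_left : ∀ x y z, dist x y < εX → dist (bracket x y) z < εX → dist x z < εX →
    bracket (bracket x y) z = bracket x z
  map_bracket : ∀ x y, dist x y < εX → dist (φ x) (φ y) < εX →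
    φ (bracket x y) = bracket (φ x) (φ y)
  contract_stable : ∀ x y, dist x y < εX → bracket x y = y →
    dist (φ x) (φ y) ≤ lam⁻¹ * dist x y
  contract_unstable : ∀ x y, dist x y < εX → bracket x y = x →
    dist (φ.symm x) (φ.symm y) ≤ lam⁻¹ * dist x y

namespace SmaleSpace

variable {X : Type*} [MetricSpace X] [CompactSpace X] (S : SmaleSpace X)

/-- Irreducibility: the periodic points are dense and there is a dense `φ`-orbit. -/
def IsIrreducible : Prop :=
  Dense (Function.periodicPts S.φ) ∧ ∃ x, Dense (Set.range fun n : ℤ => (S.φ ^ n) x)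

/-- The local stable set `X^s(x, ε)`, for `ε ≤ εX`. -/
def localStable (x : X) (ε : ℝ) : Set X := {y | dist x y < ε ∧ S.bracket y x = x}

/-- The local unstable set `X^u(x, ε)`, for `ε ≤ εX`. -/
def localUnstable (x : X) (ε : ℝ) : Set X := {y | dist x y < ε ∧ S.bracket x y = x}

/-- Stable equivalence `x ∼_s y`. -/
def StableEquiv (x y : X) : Prop :=
  Tendsto (fun n : ℕ => dist (S.φ^[n] x) (S.φ^[n] y)) atTop (𝓝 0)

/-- Unstable equivalence `x ∼_u y`. -/
def UnstableEquiv (x y : X) : Prop :=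
  Tendsto (fun n : ℕ => dist (S.φ.symm^[n] x) (S.φ.symm^[n] y)) atTop (𝓝 0)

/-- The topology whose neighbourhood base at `y` is `{X^s(y, δ) | 0 < δ ≤ εX}`. All stable classes
are open and closed in it, and it induces on each of them its usual locally compact topology. -/
@[reducible] def stableTopology : TopologicalSpace X where
  IsOpen U := ∀ y ∈ U, ∃ δ, 0 < δ ∧ δ ≤ S.εX ∧ S.localStable y δ ⊆ U
  isOpen_univ := fun _ _ => ⟨S.εX, S.εX_pos, le_rfl, Set.subset_univ _⟩
  isOpen_inter := fun U V hU hV y hy => by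
    obtain ⟨δ, h0, h1, h2⟩ := hU y hy.1
    obtain ⟨δ', h0', -, h2'⟩ := hV y hy.2
    exact ⟨min δ δ', lt_min h0 h0', (min_le_left _ _).trans h1, fun z hz =>
      ⟨h2 ⟨hz.1.trans_le (min_le_left _ _), hz.2⟩,
        h2' ⟨hz.1.trans_le (min_le_right _ _), hz.2⟩⟩⟩
  isOpen_sUnion := fun s hs y ⟨U, hU, hy⟩ => by
    obtain ⟨δ, h0, h1, h2⟩ := hs U hU y hy
    exact ⟨δ, h0, h1, h2.trans (Set.subset_sUnion_of_mem hU)⟩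

/-- The topology whose neighbourhood base at `y` is `{X^u(y, δ) | 0 < δ ≤ εX}`. -/
@[reducible] def unstableTopology : TopologicalSpace X where
  IsOpen U := ∀ y ∈ U, ∃ δ, 0 < δ ∧ δ ≤ S.εX ∧ S.localUnstable y δ ⊆ U
  isOpen_univ := fun _ _ => ⟨S.εX, S.εX_pos, le_rfl, Set.subset_univ _⟩
  isOpen_inter := fun U V hU hV y hy => by
    obtain ⟨δ, h0, h1, h2⟩ := hU y hy.1
    obtain ⟨δ', h0', -, h2'⟩ := hV y hy.2
    exact ⟨min δ δ', lt_min h0 h0', (min_le_left _ _).trans h1, fun z hz =>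
      ⟨h2 ⟨hz.1.trans_le (min_le_left _ _), hz.2⟩,
        h2' ⟨hz.1.trans_le (min_le_right _ _), hz.2⟩⟩⟩
  isOpen_sUnion := fun s hs y ⟨U, hU, hy⟩ => by
    obtain ⟨δ, h0, h1, h2⟩ := hs U hU y hy
    exact ⟨δ, h0, h1, h2.trans (Set.subset_sUnion_of_mem hU)⟩

/-- A finite `φ`-invariant set of periodic points. -/
structure PeriodicSet where
  carrier : Set X
  finite : carrier.Finite
  periodic : carrier ⊆ Function.periodicPts S.φ
  invariant : S.φ '' carrier = carrier

variable {S}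

/-- `X^s(P)`, the union of the stable classes of the points of `P`. -/
def stableSet (P : S.PeriodicSet) : Set X := {x | ∃ p ∈ P.carrier, S.StableEquiv p x}

/-- `X^u(Q)`, the union of the unstable classes of the points of `Q`. -/
def unstableSet (Q : S.PeriodicSet) : Set X := {x | ∃ q ∈ Q.carrier, S.UnstableEquiv q x}

/-- `X^s(P, ε)`, the union of the local stable sets of the points of `P`. -/
def localStableSet (P : S.PeriodicSet) (ε : ℝ) : Set X := ⋃ p ∈ P.carrier, S.localStable p ε

/-- `X^h(P, Q) = X^s(P) ∩ X^u(Q)`. -/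
def heteroclinic (P Q : S.PeriodicSet) : Set X := stableSet P ∩ unstableSet Q

theorem StableEquiv.map {x y : X} (h : S.StableEquiv x y) :
    S.StableEquiv (S.φ x) (S.φ y) := by
  unfold StableEquiv at h ⊢
  simpa only [← Function.iterate_succ_apply] using (tendsto_add_atTop_iff_nat 1).2 h

theorem StableEquiv.map_symm {x y : X} (h : S.StableEquiv x y) :
    S.StableEquiv (S.φ.symm x) (S.φ.symm y) := by
  unfold StableEquiv at h ⊢
  rw [← tendsto_add_atTop_iff_nat 1]
  simpa only [Function.iterate_succ_apply, Homeomorph.apply_symm_apply] using h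

theorem UnstableEquiv.map {x y : X} (h : S.UnstableEquiv x y) :
    S.UnstableEquiv (S.φ x) (S.φ y) := by
  unfold UnstableEquiv at h ⊢
  rw [← tendsto_add_atTop_iff_nat 1]
  simpa only [Function.iterate_succ_apply, Homeomorph.symm_apply_apply] using h

theorem UnstableEquiv.map_symm {x y : X} (h : S.UnstableEquiv x y) :
    S.UnstableEquiv (S.φ.symm x) (S.φ.symm y) := by
  unfold UnstableEquiv at h ⊢
  simpa only [← Function.iterate_succ_apply] using (tendsto_add_atTop_iff_nat 1).2 h

theorem PeriodicSet.map_mem (P : S.PeriodicSet) {x : X} (h : x ∈ P.carrier) :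
    S.φ x ∈ P.carrier := P.invariant ▸ Set.mem_image_of_mem _ h

theorem PeriodicSet.symm_mem (P : S.PeriodicSet) {x : X} (h : x ∈ P.carrier) :
    S.φ.symm x ∈ P.carrier := by
  rw [← P.invariant] at h
  obtain ⟨y, hy, rfl⟩ := h
  simpa using hy

theorem map_mem_unstableSet (Q : S.PeriodicSet) {x : X} (h : x ∈ unstableSet Q) :
    S.φ x ∈ unstableSet Q := by
  obtain ⟨q, hq, hx⟩ := h
  exact ⟨S.φ q, Q.map_mem hq, hx.map⟩

/-- The homeomorphism `φ` as a permutation of `X^h(P, Q)`. -/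
def heteroclinicPerm (P Q : S.PeriodicSet) : heteroclinic P Q ≃ heteroclinic P Q where
  toFun x := ⟨S.φ x, by
    obtain ⟨⟨p, hp, hs⟩, hu⟩ := x.2
    exact ⟨⟨S.φ p, P.map_mem hp, hs.map⟩, map_mem_unstableSet Q hu⟩⟩
  invFun x := ⟨S.φ.symm x, by
    obtain ⟨⟨p, hp, hs⟩, ⟨q, hq, hu⟩⟩ := x.2
    exact ⟨⟨S.φ.symm p, P.symm_mem hp, hs.map_symm⟩, ⟨S.φ.symm q, Q.symm_mem hq, hu.map_symm⟩⟩⟩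
  left_inv x := by simp
  right_inv x := by simp

/-! ### The groupoid of stable equivalence -/

/-- `X^u(Q)` as a topological space, with the topology given by the local unstable sets. -/
def UnstableSpace (Q : S.PeriodicSet) : Type _ := {x : X // x ∈ unstableSet Q}

instance (Q : S.PeriodicSet) : TopologicalSpace (UnstableSpace Q) :=
  TopologicalSpace.induced Subtype.val S.unstableTopology

/-- The groupoid `G^s(X, φ, Q)` of all pairs `(v, w)` of stably equivalent points of `X^u(Q)`. -/
def StableGroupoid (Q : S.PeriodicSet) : Type _ :=
  {g : X × X // S.StableEquiv g.1 g.2 ∧ g.1 ∈ unstableSet Q ∧ g.2 ∈ unstableSet Q}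

/-- The map `h^s(x) = φ^{-N} [φ^N x, φ^N v]` from a neighbourhood of `w` in `X^u(Q)` to a
neighbourhood of `v`, where `φ^N w ∈ X^s(φ^N v, εX / 2)`. -/
def holonomy (S : SmaleSpace X) (v : X) (N : ℕ) (x : X) : X :=
  S.φ.symm^[N] (S.bracket (S.φ^[N] x) (S.φ^[N] v))

/-- The set `V^s(v, w, h^s, δ)` of all `(h^s(x), x)` with `x ∈ X^u(w, δ)`, `h^s(x) ∈ X^u(v, δ)`. -/
def basicSet (Q : S.PeriodicSet) (v w : X) (N : ℕ) (δ : ℝ) : Set (StableGroupoid Q) :=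
  {g | g.1.2 ∈ S.localUnstable w δ ∧ g.1.1 ∈ S.localUnstable v δ ∧
    g.1.1 = S.holonomy v N g.1.2}

/-- The étale topology of `G^s(X, φ, Q)`: a neighbourhood base at `(v, w)` is given by the sets
`V^s(v, w, h^s, δ)` for small `δ > 0`, with `N` any number such that
`φ^N w ∈ X^s(φ^N v, εX / 2)` (two such `N` give the same `h^s` near `w`). -/
instance (Q : S.PeriodicSet) : TopologicalSpace (StableGroupoid Q) where
  IsOpen U := ∀ g ∈ U, ∀ N : ℕ, S.φ^[N] g.1.2 ∈ S.localStable (S.φ^[N] g.1.1) (S.εX / 2) →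
    ∃ δ, 0 < δ ∧ δ ≤ S.εX / 2 ∧ basicSet Q g.1.1 g.1.2 N δ ⊆ U
  isOpen_univ := fun _ _ _ _ => ⟨S.εX / 2, half_pos S.εX_pos, le_rfl, Set.subset_univ _⟩
  isOpen_inter := fun U V hU hV g hg N hN => by
    obtain ⟨δ, h0, h1, h2⟩ := hU g hg.1 N hN
    obtain ⟨δ', h0', -, h2'⟩ := hV g hg.2 N hN
    exact ⟨min δ δ', lt_min h0 h0', (min_le_left _ _).trans h1, fun k hk =>
      ⟨h2 ⟨⟨hk.1.1.trans_le (min_le_left _ _), hk.1.2⟩,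
          ⟨hk.2.1.1.trans_le (min_le_left _ _), hk.2.1.2⟩, hk.2.2⟩,
        h2' ⟨⟨hk.1.1.trans_le (min_le_right _ _), hk.1.2⟩,
          ⟨hk.2.1.1.trans_le (min_le_right _ _), hk.2.1.2⟩, hk.2.2⟩⟩⟩
  isOpen_sUnion := fun s hs g ⟨U, hU, hg⟩ N hN => by
    obtain ⟨δ, h0, h1, h2⟩ := hs U hU g hg N hN
    exact ⟨δ, h0, h1, h2.trans (Set.subset_sUnion_of_mem hU)⟩

/-- The map `φ × φ` on `G^s(X, φ, Q)`. -/
def groupoidShift (Q : S.PeriodicSet) (g : StableGroupoid Q) : StableGroupoid Q :=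
  ⟨(S.φ g.1.1, S.φ g.1.2), g.2.1.map, map_mem_unstableSet Q g.2.2.1,
    map_mem_unstableSet Q g.2.2.2⟩

/-! ### The algebras acting on `ℓ²(X^h(P, Q))` -/

/-- The Hilbert space `ℓ²(X^h(P, Q))`. -/
abbrev HilbertSp (P Q : S.PeriodicSet) : Type _ := lp (fun _ : heteroclinic P Q => ℂ) 2

open Classical in
/-- The matrix entry `f(x, y)`, which is `0` if `(x, y)` is not in the groupoid. -/
def kernel {Q : S.PeriodicSet} (f : StableGroupoid Q → ℂ) (x y : X) : ℂ :=
  if h : S.StableEquiv x y ∧ x ∈ unstableSet Q ∧ y ∈ unstableSet Q then f ⟨(x, y), h⟩ else 0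

/-- `T` is the operator `π(f)`: `(π(f) ξ)(x) = ∑_{(x, y) ∈ G^s(X, φ, Q)} f(x, y) ξ(y)`. (If
`x ∈ X^h(P, Q)` and `(x, y)` is in the groupoid, then `y ∈ X^h(P, Q)`.) -/
def Represents (P : S.PeriodicSet) {Q : S.PeriodicSet} (f : StableGroupoid Q → ℂ)
    (T : HilbertSp P Q →L[ℂ] HilbertSp P Q) : Prop :=
  ∀ (ξ : HilbertSp P Q) (x : heteroclinic P Q),
    HasSum (fun y : heteroclinic P Q => kernel f x y * ξ y) (T ξ x)

/-- `T` is multiplication by the function `a` on `X^u(Q)`, the unit space of the groupoid. -/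
def RepresentsUnitSpace (P : S.PeriodicSet) {Q : S.PeriodicSet} (a : UnstableSpace Q → ℂ)
    (T : HilbertSp P Q →L[ℂ] HilbertSp P Q) : Prop :=
  ∀ (ξ : HilbertSp P Q) (x : heteroclinic P Q), T ξ x = a ⟨x, x.2.2⟩ * ξ x

/-- The stable algebra `S(X, φ, Q)` acting on `ℓ²(X^h(P, Q))`: the norm closure of
`π(C_c(G^s(X, φ, Q)))`. -/
def stableAlgebra (P Q : S.PeriodicSet) :
    Submodule ℂ (HilbertSp P Q →L[ℂ] HilbertSp P Q) :=
  (Submodule.span ℂ {T | ∃ f : C_c(StableGroupoid Q, ℂ), Represents P f T}).topologicalClosure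

/-- The operators in `C_c(X^u(Q))`. -/
def unitSpaceOps (P Q : S.PeriodicSet) : Set (HilbertSp P Q →L[ℂ] HilbertSp P Q) :=
  {T | ∃ a : C_c(UnstableSpace Q, ℂ), RepresentsUnitSpace P a T}

/-- The canonical unitary `u δ_x = δ_{φ(x)}`. -/
def canonicalUnitary (P Q : S.PeriodicSet) : HilbertSp P Q ≃ₗᵢ[ℂ] HilbertSp P Q :=
  permUnitary (heteroclinicPerm P Q)

/-- The integer power `u ^ k` as a bounded operator. -/
def unitaryPow (P Q : S.PeriodicSet) (k : ℤ) : HilbertSp P Q →L[ℂ] HilbertSp P Q :=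
  ((canonicalUnitary P Q ^ k).toContinuousLinearEquiv :
    HilbertSp P Q →L[ℂ] HilbertSp P Q)

/-- The stable Ruelle algebra `S(X, φ, Q) ⋊_α ℤ` acting on `ℓ²(X^h(P, Q))` through the covariant
representation `(π, u)`: the norm closure of the span of the operators `a u^k`, with
`a ∈ S(X, φ, Q)` and `k ∈ ℤ`. -/
def ruelleAlgebra (P Q : S.PeriodicSet) :
    Submodule ℂ (HilbertSp P Q →L[ℂ] HilbertSp P Q) :=
  (Submodule.span ℂ
    {T | ∃ a ∈ stableAlgebra P Q, ∃ k : ℤ, T = a * unitaryPow P Q k}).topologicalClosure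

/-! ### The Dirac operator -/

/-- An admissible function `ω₀ : X^s(P) → [0, 1]` (only its values on `X^s(P)` matter): continuous
for the topology of `X^s(P)`, equal to `0` on the closure of `X^s(P, ε)` and to `1` on
`X^s(P) ∖ φ⁻¹(X^s(P, ε))`. -/
structure IsCutoff (P : S.PeriodicSet) (ε : ℝ) (ω₀ : X → ℝ) : Prop where
  mem_Icc : ∀ x ∈ stableSet P, ω₀ x ∈ Set.Icc (0 : ℝ) 1
  continuousOn : @ContinuousOn X ℝ S.stableTopology _ ω₀ (stableSet P)
  eq_zero : ∀ x ∈ @closure X S.stableTopology (localStableSet P ε), ω₀ x = 0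
  eq_one : ∀ x ∈ stableSet P \ S.φ ⁻¹' localStableSet P ε, ω₀ x = 1

/-- The function `ω_s = ∑_{n ≥ 0} ω₀ ∘ φ^n - ∑_{n ≥ 1} (1 - ω₀) ∘ φ^{-n}` on `X^s(P) ∖ P`, where
both sums have only finitely many nonzero terms. -/
def omegaS (S : SmaleSpace X) (ω₀ : X → ℝ) (x : X) : ℝ :=
  ∑' n : ℕ, ω₀ (S.φ^[n] x) - ∑' n : ℕ, (1 - ω₀ (S.φ.symm^[n + 1] x))

/-- The operator `D δ_x = ω_s(x) δ_x` on `ℓ²(X^h(P, Q))`, with its maximal domain. -/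
def diracOp (P Q : S.PeriodicSet) (ω₀ : X → ℝ) : HilbertSp P Q →ₗ.[ℂ] HilbertSp P Q :=
  diagOp fun x : heteroclinic P Q => S.omegaS ω₀ x

end SmaleSpace

end

/-!
# The spectral triple of a stable Ruelle algebra

Everything is governed by the *entry time* `τ(x)` of a point `x ∈ X^s(P) ∖ P`, the first `n ∈ ℤ`
with `φ^n(x) ∈ X^s(P, ε)`. The local stable sets are contracted by `φ`, so `φ^n(x) ∈ X^s(P, ε)` if
and only if `τ(x) ≤ n` (`SmaleSpace.entryTime_le_iff`), and both sums in `ω_s` telescope: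
`ω_s(x) = τ(x) - 1 + ω₀(φ^{τ(x) - 1}(x))` (`SmaleSpace.omegaS_eq`). Hence `ω_s` stays within
distance `1` of `τ` and `ω_s ∘ φ = ω_s - 1`, which is the relation `[u, D] = u`.

Two estimates on `τ` carry the analysis.

* *Counting* (`SmaleSpace.exists_card_entryTime_le`). Two points of a local unstable set whose
  orbits lie in the same balls of a finite cover up to time `n`, and that lie in the same local
  stable set at time `n`, coincide. So a compact subset of `X^u(Q)` contains at most `C M^n`
  points with `τ ≤ n`. In particular `ω_s → ∞` along such a set, which makes `a (1 + D²)⁻¹`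
  compact, and the Gaussian factor in `exp (-t (1 + D²))` beats the exponential growth, which
  gives `θ`-summability (`summable_exp_neg_one_add_sq`).
* *Comparison* (`SmaleSpace.exists_entryTime_le`). If the orbits of `x` and `y` are locally stably
  close at time `N`, then `τ(y) ≤ max (τ(x)) N + k` with `k` independent of `x` and `y`. On a
  compact subset of the groupoid one `N` serves all pairs and `τ` is bounded below, so
  `ω_s(x) - ω_s(y)` is bounded there, and `[D, π(f)]`, with matrix `(ω_s(x) - ω_s(y)) f(x, y)`,
  has bounded entries.

A bounded matrix supported on a compact subset of the groupoid is a bounded operator because such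
a set is a finite union of pieces on which range and source are injective
(`SmaleSpace.exists_finite_coloring`); this treats `π(f)` and `[D, π(f)]` alike. The
neighbourhoods in the étale topology are described by the pairs that are locally stably close at a
fixed time (`SmaleSpace.nhds_groupoid_hasBasis`), from which `C_c(G)` is seen to be a `*`-algebra
under convolution. The operators `π(f) u^k` therefore span a `*`-algebra, whose closure is the
Ruelle algebra (`SmaleSpace.ruelleAlgebra_eq`), and all density and compactness statements are
checked on them. Finally, `ω_s(φ^n(x)) → -∞` while `ω_s` is bounded below on compact sets, so each
`π(f) u^k` kills `δ_{φ^n(x)}` for large `n` and the identity operator is at distance at least `1`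
from the Ruelle algebra; a unit would have to be the identity, as `C_c(X^u(Q))` acts
nondegenerately. The Hilbert space is nonzero, because irreducibility provides a heteroclinic
point (`SmaleSpace.heteroclinic_nonempty`).
-/

namespace SmaleSpace

variable {X : Type*} [MetricSpace X] [CompactSpace X]

/-! ### Local product structure -/

/-- The Smale space with time reversed: stable and unstable sets are exchanged. -/
def dual (S : SmaleSpace X) : SmaleSpace X where
  φ := S.φ.symm
  εX := S.εX
  εX_pos := S.εX_pos
  lam := S.lam
  one_lt_lam := S.one_lt_lam
  bracket x y := S.bracket y x
  continuousOn_bracket := by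
    refine S.continuousOn_bracket.comp (continuous_swap.continuousOn) ?_
    intro p hp
    simpa [dist_comm] using hp
  bracket_self := S.bracket_self
  bracket_right x y z h1 h2 h3 := by
    rw [dist_comm] at h1 h2 h3
    exact S.bracket_left z y x h1 h2 h3
  bracket_left x y z h1 h2 h3 := by
    rw [dist_comm] at h1 h2 h3
    exact S.bracket_right z y x h1 h2 h3
  map_bracket x y h1 h2 := by
    have := S.map_bracket (S.φ.symm y) (S.φ.symm x) (by rwa [dist_comm])
      (by simpa [dist_comm] using h1)
    apply S.φ.injective
    simpa using this.symm
  contract_stable x y h1 h2 := by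
    rw [dist_comm, dist_comm x y]
    exact S.contract_unstable y x (by rwa [dist_comm]) h2
  contract_unstable x y h1 h2 := by
    rw [dist_comm, dist_comm x y]
    exact S.contract_stable y x (by rwa [dist_comm]) h2

variable {S : SmaleSpace X} {x y z : X} {a b δ : ℝ}

theorem lam_inv_pos (S : SmaleSpace X) : 0 < S.lam⁻¹ :=
  inv_pos.2 (zero_lt_one.trans S.one_lt_lam)

theorem lam_inv_lt_one (S : SmaleSpace X) : S.lam⁻¹ < 1 := inv_lt_one_of_one_lt₀ S.one_lt_lam

theorem tendsto_lam_inv_pow_mul (S : SmaleSpace X) (c : ℝ) :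
    Tendsto (fun n : ℕ => S.lam⁻¹ ^ n * c) atTop (𝓝 0) := by
  simpa using (tendsto_pow_atTop_nhds_zero_of_lt_one S.lam_inv_pos.le S.lam_inv_lt_one).mul_const c

theorem mem_localStable_self (hδ : 0 < δ) : x ∈ S.localStable x δ :=
  ⟨by simpa using hδ, S.bracket_self x⟩

theorem localStable_mono (h : a ≤ b) : S.localStable x a ⊆ S.localStable x b :=
  fun _ hy => ⟨hy.1.trans_le h, hy.2⟩

theorem localUnstable_mono (h : a ≤ b) : S.localUnstable x a ⊆ S.localUnstable x b :=
  localStable_mono (S := S.dual) h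

theorem localStable_symm (hδ : δ ≤ S.εX) (h : y ∈ S.localStable x δ) : x ∈ S.localStable y δ := by
  obtain ⟨h1, h2⟩ := h
  have h1' : dist y x < S.εX := by rw [dist_comm]; exact h1.trans_le hδ
  refine ⟨by rwa [dist_comm], ?_⟩
  have := S.bracket_left y x y h1' (by rw [h2, dist_comm]; exact h1') (by simpa using S.εX_pos)
  rwa [h2, S.bracket_self] at this

/-- Within the bracket radius, local stable sets are the classes of an equivalence relation. -/
theorem localStable_trans (hy : y ∈ S.localStable x S.εX) (hz : z ∈ S.localStable y S.εX)
    (hxz : dist x z < δ) (hδ : δ ≤ S.εX) : z ∈ S.localStable x δ := by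
  refine ⟨hxz, ?_⟩
  have := S.bracket_left z y x (by rw [dist_comm]; exact hz.1)
    (by rw [hz.2, dist_comm]; exact hy.1) (by rw [dist_comm]; exact hxz.trans_le hδ)
  rwa [hz.2, hy.2, eq_comm] at this

theorem localStable_subset (ha : a ≤ S.εX) (hb : b ≤ S.εX) (hy : y ∈ S.localStable x a)
    (hz : z ∈ S.localStable y b) (h : a + b ≤ S.εX) : z ∈ S.localStable x (a + b) :=
  localStable_trans (localStable_mono ha hy) (localStable_mono hb hz)
    ((dist_triangle _ _ _).trans_lt (add_lt_add hy.1 hz.1)) h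

theorem map_mem_localStable (hδ : δ ≤ S.εX) (h : y ∈ S.localStable x δ) :
    S.φ y ∈ S.localStable (S.φ x) (S.lam⁻¹ * δ) := by
  have h' := localStable_symm hδ h
  have hd : dist (S.φ x) (S.φ y) ≤ S.lam⁻¹ * dist x y :=
    S.contract_stable x y (h.1.trans_le hδ) h'.2
  have hd' : dist (S.φ x) (S.φ y) < S.lam⁻¹ * δ :=
    hd.trans_lt (mul_lt_mul_of_pos_left h.1 S.lam_inv_pos)
  refine ⟨hd', ?_⟩
  have hlt : dist (S.φ x) (S.φ y) < S.εX := by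
    refine hd.trans_lt (lt_of_le_of_lt ?_ (h.1.trans_le hδ))
    exact mul_le_of_le_one_left dist_nonneg S.lam_inv_lt_one.le
  rw [← S.map_bracket y x (by rw [dist_comm]; exact h.1.trans_le hδ) (by rwa [dist_comm]), h.2]

theorem pos_of_mem_localStable (h : y ∈ S.localStable x δ) : 0 < δ := dist_nonneg.trans_lt h.1

theorem iterate_mem_localStable (hδ : δ ≤ S.εX) (h : y ∈ S.localStable x δ) (n : ℕ) :
    S.φ^[n] y ∈ S.localStable (S.φ^[n] x) (S.lam⁻¹ ^ n * δ) := by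
  induction n with
  | zero => simpa using h
  | succ n ih =>
    rw [Function.iterate_succ_apply', Function.iterate_succ_apply', pow_succ', mul_assoc]
    refine map_mem_localStable (le_trans ?_ hδ) ih
    exact mul_le_of_le_one_left (pos_of_mem_localStable h).le
      (pow_le_one₀ S.lam_inv_pos.le S.lam_inv_lt_one.le)

theorem iterate_mem_localStable' (hδ : δ ≤ S.εX) (h : y ∈ S.localStable x δ) (n : ℕ) :
    S.φ^[n] y ∈ S.localStable (S.φ^[n] x) δ :=
  localStable_mono (mul_le_of_le_one_left (pos_of_mem_localStable h).le
      (pow_le_one₀ S.lam_inv_pos.le S.lam_inv_lt_one.le)) (iterate_mem_localStable hδ h n)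

/-- Local stability is preserved by `φ⁻¹` as long as the points stay close. -/
theorem symm_mem_localStable (hδ : δ ≤ S.εX) (h : S.φ y ∈ S.localStable (S.φ x) S.εX)
    (hd : dist x y < δ) : y ∈ S.localStable x δ := by
  refine ⟨hd, S.φ.injective ?_⟩
  rw [S.map_bracket y x (by rw [dist_comm]; exact hd.trans_le hδ) (by rw [dist_comm]; exact h.1),
    h.2]

theorem iterate_symm_mem_localStable {n k : ℕ}
    (h : S.φ^[n + k] y ∈ S.localStable (S.φ^[n + k] x) S.εX)
    (hd : ∀ i < k, dist (S.φ^[n + i] x) (S.φ^[n + i] y) < S.εX) :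
    S.φ^[n] y ∈ S.localStable (S.φ^[n] x) S.εX := by
  induction k with
  | zero => simpa using h
  | succ k ih =>
    refine ih ?_ fun i hi => hd i (hi.trans (Nat.lt_succ_self k))
    refine symm_mem_localStable le_rfl ?_ (hd k (Nat.lt_succ_self k))
    rwa [← Function.iterate_succ_apply' (⇑S.φ), ← Function.iterate_succ_apply' (⇑S.φ)]

theorem localUnstable_symm (hδ : δ ≤ S.εX) (h : y ∈ S.localUnstable x δ) :
    x ∈ S.localUnstable y δ := localStable_symm (S := S.dual) hδ h

theorem localUnstable_trans (hy : y ∈ S.localUnstable x S.εX) (hz : z ∈ S.localUnstable y S.εX)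
    (hxz : dist x z < δ) (hδ : δ ≤ S.εX) : z ∈ S.localUnstable x δ :=
  localStable_trans (S := S.dual) hy hz hxz hδ

theorem mem_localUnstable_self (hδ : 0 < δ) : x ∈ S.localUnstable x δ :=
  mem_localStable_self (S := S.dual) hδ

/-- Local unstability is preserved by `φ` as long as the points stay close. -/
theorem iterate_mem_localUnstable {n : ℕ} (h : y ∈ S.localUnstable x S.εX)
    (hd : ∀ i ≤ n, dist (S.φ^[i] x) (S.φ^[i] y) < S.εX) :
    S.φ^[n] y ∈ S.localUnstable (S.φ^[n] x) S.εX := by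
  induction n with
  | zero => simpa using h
  | succ n ih =>
    have h1 := ih fun i hi => hd i (hi.trans (Nat.le_succ n))
    have h2 := hd (n + 1) le_rfl
    rw [Function.iterate_succ_apply', Function.iterate_succ_apply'] at h2 ⊢
    refine symm_mem_localStable (S := S.dual) le_rfl ?_ h2
    change S.φ.symm (S.φ _) ∈ S.localUnstable (S.φ.symm (S.φ _)) S.εX
    simpa using h1

/-- Local stable and unstable sets of a point meet only in this point. -/
theorem eq_of_mem_localStable_of_mem_localUnstable (hs : y ∈ S.localStable x S.εX)
    (hu : y ∈ S.localUnstable x S.εX) : x = y := by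
  have := (localStable_symm le_rfl hs).2
  rw [← hu.2, this]

theorem bracket_mem_localStable (h : dist x y < S.εX) (hd : dist x (S.bracket x y) < δ)
    (hδ : δ ≤ S.εX) : S.bracket x y ∈ S.localStable x δ := by
  refine ⟨hd, ?_⟩
  rw [S.bracket_left x y x h (by rw [dist_comm]; exact hd.trans_le hδ) (by simpa using S.εX_pos),
    S.bracket_self]

theorem bracket_mem_localUnstable (h : dist x y < S.εX) (hd : dist y (S.bracket x y) < δ)
    (hδ : δ ≤ S.εX) : S.bracket x y ∈ S.localUnstable y δ :=
  bracket_mem_localStable (S := S.dual) (x := y) (y := x) (by rwa [dist_comm] at h) hd hδ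

/-- The bracket is the only point of `X^s(x) ∩ X^u(y)`. -/
theorem bracket_eq (hxy : dist x y < S.εX) (hs : z ∈ S.localStable x S.εX)
    (hu : z ∈ S.localUnstable y S.εX) : S.bracket x y = z := by
  have hs' := localStable_symm le_rfl hs
  have hu' := localUnstable_symm le_rfl hu
  have := S.bracket_left x z y hs.1 (by rw [hs'.2, dist_comm]; exact hu.1) hxy
  rw [hs'.2] at this
  rw [← this, hu'.2]

/-- Near the diagonal the bracket is uniformly close to its arguments. -/
theorem exists_dist_bracket_lt (S : SmaleSpace X) {η : ℝ} (hη : 0 < η) :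
    ∃ δ, 0 < δ ∧ δ ≤ S.εX ∧ ∀ x y, dist x y < δ →
      dist x (S.bracket x y) < η ∧ dist y (S.bracket x y) < η := by
  have hc : IsCompact {p : X × X | dist p.1 p.2 ≤ S.εX / 2} :=
    (isClosed_le (by fun_prop) continuous_const).isCompact
  have hu := hc.uniformContinuousOn_of_continuous (S.continuousOn_bracket.mono
    fun p hp => lt_of_le_of_lt hp (half_lt_self S.εX_pos))
  obtain ⟨δ, hδ, h⟩ := Metric.uniformContinuousOn_iff.1 hu η hη
  refine ⟨min δ (S.εX / 2), lt_min hδ (half_pos S.εX_pos),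
    (min_le_right _ _).trans (half_le_self S.εX_pos.le), fun x y hxy => ?_⟩
  have hm : ∀ z : X, (z, z) ∈ {p : X × X | dist p.1 p.2 ≤ S.εX / 2} := fun z => by
    simpa using (half_pos S.εX_pos).le
  have hxy' : (x, y) ∈ {p : X × X | dist p.1 p.2 ≤ S.εX / 2} :=
    (hxy.trans_le (min_le_right _ _)).le
  have hlt := hxy.trans_le (min_le_left _ _)
  have h1 := h (x, x) (hm x) (x, y) hxy' (by simpa [Prod.dist_eq] using hlt)
  have h2 := h (y, y) (hm y) (x, y) hxy' (by simpa [Prod.dist_eq, dist_comm] using hlt)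
  simp only [S.bracket_self] at h1 h2
  exact ⟨h1, h2⟩

theorem stableEquiv_of_mem_localStable (h : y ∈ S.localStable x S.εX) : S.StableEquiv x y :=
  squeeze_zero (fun _ => dist_nonneg) (fun n => (iterate_mem_localStable le_rfl h n).1.le)
    (S.tendsto_lam_inv_pow_mul _)

/-- If two forward orbits stay close from time `N` on, then they are in the same local stable set
at time `N`: the backward contraction of `[φ^n y, φ^n x] ∈ X^u(φ^n x)` forces this bracket to be
`φ^n x`. -/
theorem StableEquiv.eventually_mem_localStable (h : S.StableEquiv x y) (hδ : 0 < δ) :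
    ∀ᶠ n in atTop, S.φ^[n] y ∈ S.localStable (S.φ^[n] x) δ := by
  obtain ⟨η, hη, hηε, hb⟩ := S.exists_dist_bracket_lt S.εX_pos
  have h1 : ∀ᶠ n : ℕ in atTop, dist (S.φ^[n] x) (S.φ^[n] y) < min δ η :=
    (tendsto_order.1 h).2 _ (lt_min hδ hη)
  obtain ⟨N, hN⟩ := eventually_atTop.1 h1
  refine eventually_atTop.2 ⟨N, fun n hn => ⟨(hN n hn).trans_le (min_le_left _ _), ?_⟩⟩
  set w : ℕ → X := fun k => S.bracket (S.φ^[n + k] y) (S.φ^[n + k] x) with hw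
  have hd : ∀ k, dist (S.φ^[n + k] y) (S.φ^[n + k] x) < η := fun k => by
    rw [dist_comm]; exact (hN _ (by omega)).trans_le (min_le_right _ _)
  have hwu : ∀ k, w k ∈ S.localUnstable (S.φ^[n + k] x) S.εX := fun k =>
    bracket_mem_localUnstable ((hd k).trans_le hηε) (hb _ _ (hd k)).2 le_rfl
  have hws : ∀ k, S.φ (w k) = w (k + 1) := fun k => by
    have e : ∀ u : X, S.φ^[n + (k + 1)] u = S.φ (S.φ^[n + k] u) := fun u =>
      Function.iterate_succ_apply' _ _ _
    simp only [hw, e]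
    refine S.map_bracket _ _ ((hd k).trans_le hηε) ?_
    rw [← e, ← e]
    exact (hd (k + 1)).trans_le hηε
  have hc : ∀ k, dist (S.φ^[n] x) (w 0) ≤ S.lam⁻¹ ^ k * dist (S.φ^[n + k] x) (w k) := fun k => by
    induction k with
    | zero => simp
    | succ k ih =>
      refine ih.trans ?_
      rw [pow_succ, mul_assoc]
      refine mul_le_mul_of_nonneg_left ?_ (pow_nonneg S.lam_inv_pos.le _)
      have := S.contract_unstable _ _ (hwu (k + 1)).1 (hwu (k + 1)).2
      rw [← hws k, ← add_assoc, Function.iterate_succ_apply', Homeomorph.symm_apply_apply,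
        Homeomorph.symm_apply_apply] at this
      rwa [← hws k, ← add_assoc, Function.iterate_succ_apply']
  have h0 : dist (S.φ^[n] x) (w 0) ≤ 0 :=
    ge_of_tendsto' (S.tendsto_lam_inv_pow_mul S.εX) fun k => (hc k).trans
      (mul_le_mul_of_nonneg_left (hwu k).1.le (pow_nonneg S.lam_inv_pos.le _))
  exact (dist_le_zero.1 h0).symm

theorem StableEquiv.refl (x : X) : S.StableEquiv x x := by
  simp [StableEquiv]

theorem StableEquiv.symm (h : S.StableEquiv x y) : S.StableEquiv y x := by
  simpa [StableEquiv, dist_comm] using h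

theorem StableEquiv.trans (h : S.StableEquiv x y) (h' : S.StableEquiv y z) :
    S.StableEquiv x z :=
  squeeze_zero (fun _ => dist_nonneg) (fun _ => dist_triangle _ _ _) (by simpa using h.add h')

theorem UnstableEquiv.trans (h : S.UnstableEquiv x y) (h' : S.UnstableEquiv y z) :
    S.UnstableEquiv x z := StableEquiv.trans (S := S.dual) h h'

theorem unstableEquiv_of_mem_localUnstable (h : y ∈ S.localUnstable x S.εX) :
    S.UnstableEquiv x y := stableEquiv_of_mem_localStable (S := S.dual) h

theorem UnstableEquiv.eventually_mem_localUnstable (h : S.UnstableEquiv x y) (hδ : 0 < δ) :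
    ∀ᶠ n in atTop, S.φ.symm^[n] y ∈ S.localUnstable (S.φ.symm^[n] x) δ :=
  StableEquiv.eventually_mem_localStable (S := S.dual) h hδ

theorem mem_unstableSet_of_unstableEquiv {Q : S.PeriodicSet} (h : x ∈ unstableSet Q)
    (h' : S.UnstableEquiv x y) : y ∈ unstableSet Q := by
  obtain ⟨q, hq, hx⟩ := h
  exact ⟨q, hq, hx.trans h'⟩

theorem mem_stableSet_of_stableEquiv {P : S.PeriodicSet} (h : x ∈ stableSet P)
    (h' : S.StableEquiv x y) : y ∈ stableSet P := by
  obtain ⟨q, hq, hx⟩ := h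
  exact ⟨q, hq, hx.trans h'⟩

end SmaleSpace

namespace SmaleSpace

variable {X : Type*} [MetricSpace X] [CompactSpace X] {S : SmaleSpace X} {x y z : X} {ε : ℝ}
  {P Q : S.PeriodicSet} {ω₀ : X → ℝ}

/-! ### The entry time into `X^s(P, ε)` and the function `ω_s` -/

theorem zpow_natCast_apply (S : SmaleSpace X) (n : ℕ) (x : X) :
    (S.φ ^ (n : ℤ)) x = S.φ^[n] x := by
  rw [zpow_natCast]
  induction n with
  | zero => rfl
  | succ n ih => rw [pow_succ', Homeomorph.mul_apply, ih, Function.iterate_succ_apply']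

theorem zpow_neg_natCast_apply (S : SmaleSpace X) (n : ℕ) (x : X) :
    (S.φ ^ (-(n : ℤ))) x = S.φ.symm^[n] x := by
  rw [zpow_neg, zpow_natCast]
  induction n with
  | zero => rfl
  | succ n ih =>
    rw [pow_succ, mul_inv_rev, Homeomorph.mul_apply, ih, Function.iterate_succ_apply',
      Homeomorph.inv_apply]

theorem zpow_add_apply (S : SmaleSpace X) (m n : ℤ) (x : X) :
    (S.φ ^ (m + n)) x = (S.φ ^ m) ((S.φ ^ n) x) := by
  rw [zpow_add, Homeomorph.mul_apply]

theorem PeriodicSet.iterate_mem (P : S.PeriodicSet) (h : x ∈ P.carrier) (n : ℕ) :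
    S.φ^[n] x ∈ P.carrier := by
  induction n with
  | zero => exact h
  | succ n ih => rw [Function.iterate_succ_apply']; exact P.map_mem ih

theorem PeriodicSet.zpow_mem_iff (P : S.PeriodicSet) (n : ℤ) :
    (S.φ ^ n) x ∈ P.carrier ↔ x ∈ P.carrier := by
  have key : ∀ (n : ℤ) (x : X), x ∈ P.carrier → (S.φ ^ n) x ∈ P.carrier := by
    intro n x h
    induction n using Int.induction_on with
    | zero => simpa using h
    | succ i ih => rw [add_comm, zpow_add_apply, zpow_one]; exact P.map_mem ih
    | pred i ih =>
      rw [sub_eq_neg_add, zpow_add_apply, zpow_neg_one]; exact P.symm_mem ih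
  refine ⟨fun h => ?_, key n x⟩
  have := key (-n) _ h
  rwa [← zpow_add_apply, neg_add_cancel, zpow_zero] at this

theorem zpow_mem_stableSet (h : x ∈ stableSet P) (n : ℤ) : (S.φ ^ n) x ∈ stableSet P := by
  induction n using Int.induction_on with
  | zero => simpa using h
  | succ i ih =>
    rw [add_comm, zpow_add_apply, zpow_one]
    obtain ⟨p, hp, hx⟩ := ih
    exact ⟨S.φ p, P.map_mem hp, hx.map⟩
  | pred i ih =>
    rw [sub_eq_neg_add, zpow_add_apply, zpow_neg_one]
    obtain ⟨p, hp, hx⟩ := ih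
    exact ⟨S.φ.symm p, P.symm_mem hp, hx.map_symm⟩

theorem zpow_mem_unstableSet (h : x ∈ unstableSet Q) (n : ℤ) :
    (S.φ ^ n) x ∈ unstableSet Q := by
  induction n using Int.induction_on with
  | zero => simpa using h
  | succ i ih =>
    rw [add_comm, zpow_add_apply, zpow_one]
    exact map_mem_unstableSet Q ih
  | pred i ih =>
    rw [sub_eq_neg_add, zpow_add_apply, zpow_neg_one]
    obtain ⟨p, hp, hx⟩ := ih
    exact ⟨S.φ.symm p, Q.symm_mem hp, hx.map_symm⟩

theorem mem_localStableSet {r : ℝ} :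
    x ∈ localStableSet P r ↔ ∃ p ∈ P.carrier, x ∈ S.localStable p r := by
  simp [localStableSet]

theorem iterate_mem_localStableSet (hε : ε ≤ S.εX) (h : x ∈ localStableSet P ε) (n : ℕ) :
    S.φ^[n] x ∈ localStableSet P (S.lam⁻¹ ^ n * ε) := by
  obtain ⟨p, hp, hx⟩ := mem_localStableSet.1 h
  exact mem_localStableSet.2 ⟨_, P.iterate_mem hp n, iterate_mem_localStable hε hx n⟩

theorem iterate_mem_localStableSet' (hε : ε ≤ S.εX) (h : x ∈ localStableSet P ε) (n : ℕ) :
    S.φ^[n] x ∈ localStableSet P ε := by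
  obtain ⟨p, hp, hx⟩ := mem_localStableSet.1 h
  exact mem_localStableSet.2 ⟨_, P.iterate_mem hp n, iterate_mem_localStable' hε hx n⟩

theorem zpow_mem_localStableSet_of_le (hε : ε ≤ S.εX) {m n : ℤ} (hmn : m ≤ n)
    (h : (S.φ ^ m) x ∈ localStableSet P ε) : (S.φ ^ n) x ∈ localStableSet P ε := by
  obtain ⟨k, rfl⟩ := Int.le.dest hmn
  rw [add_comm, zpow_add_apply, zpow_natCast_apply]
  exact iterate_mem_localStableSet' hε h k

theorem exists_zpow_mem_localStableSet (hε : 0 < ε) (hx : x ∈ stableSet P) :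
    ∃ n : ℤ, (S.φ ^ n) x ∈ localStableSet P ε := by
  obtain ⟨p, hp, h⟩ := hx
  obtain ⟨n, hn⟩ := (h.eventually_mem_localStable hε).exists
  exact ⟨n, by rw [zpow_natCast_apply]; exact mem_localStableSet.2 ⟨_, P.iterate_mem hp n, hn⟩⟩

/-- A point whose whole backward orbit stays in `X^s(P, ε)` lies in `P`. -/
theorem mem_carrier_of_forall_zpow_mem (hε : ε ≤ S.εX)
    (h : ∀ n : ℕ, (S.φ ^ (-(n : ℤ))) x ∈ localStableSet P ε) : x ∈ P.carrier := by
  rw [← P.finite.isClosed.closure_eq, Metric.mem_closure_iff]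
  intro r hr
  obtain ⟨n, hn⟩ := ((tendsto_order.1 (S.tendsto_lam_inv_pow_mul ε)).2 r hr).exists
  have := iterate_mem_localStableSet hε (h n) n
  rw [← zpow_natCast_apply, ← zpow_add_apply, add_neg_cancel, zpow_zero] at this
  obtain ⟨p, hp, hx⟩ := mem_localStableSet.1 this
  exact ⟨p, hp, by rw [dist_comm]; exact hx.1.trans hn⟩

/-- The first time at which the orbit of `x` enters `X^s(P, ε)`. For `x ∈ X^s(P) ∖ P` it is
characterised by `entryTime_le_iff`; for other `x` its value is irrelevant. -/
noncomputable def entryTime (P : S.PeriodicSet) (ε : ℝ) (x : X) : ℤ :=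
  sInf {n : ℤ | (S.φ ^ n) x ∈ localStableSet P ε}

theorem entryTime_le_iff (hε : 0 < ε) (hε' : ε ≤ S.εX) (hx : x ∈ stableSet P)
    (hxP : x ∉ P.carrier) {n : ℤ} :
    entryTime P ε x ≤ n ↔ (S.φ ^ n) x ∈ localStableSet P ε := by
  set A := {n : ℤ | (S.φ ^ n) x ∈ localStableSet P ε} with hA
  have hne : A.Nonempty := exists_zpow_mem_localStableSet hε hx
  have hbdd : BddBelow A := by
    by_contra hb
    refine hxP (mem_carrier_of_forall_zpow_mem hε' fun n => ?_)
    obtain ⟨m, hm, hmn⟩ := not_bddBelow_iff.1 hb (-(n : ℤ))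
    exact zpow_mem_localStableSet_of_le hε' hmn.le hm
  exact ⟨fun h => zpow_mem_localStableSet_of_le hε' h (Int.csInf_mem hne hbdd),
    fun h => csInf_le hbdd h⟩

theorem entryTime_zpow (hε : 0 < ε) (hε' : ε ≤ S.εX) (hx : x ∈ stableSet P)
    (hxP : x ∉ P.carrier) (k : ℤ) :
    entryTime P ε ((S.φ ^ k) x) = entryTime P ε x - k := by
  refine eq_of_forall_ge_iff fun n => ?_
  rw [entryTime_le_iff hε hε' (zpow_mem_stableSet hx k) (by rwa [P.zpow_mem_iff]),
    ← zpow_add_apply, ← entryTime_le_iff hε hε' hx hxP, sub_le_iff_le_add]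

/-- The telescoping sum behind `ω_s`, for a function that is `1` far to the left and `0` far to
the right. -/
theorem tsum_sub_tsum_of_step {g : ℤ → ℝ} {τ : ℤ} (h0 : ∀ n, τ ≤ n → g n = 0)
    (h1 : ∀ n, n + 1 < τ → g n = 1) :
    ∑' n : ℕ, g n - ∑' n : ℕ, (1 - g (-((n : ℤ) + 1))) = τ - 1 + g (τ - 1) := by
  rcases le_or_gt 1 τ with h | h
  · obtain ⟨m, rfl⟩ := Int.le.dest h
    rw [tsum_eq_sum (s := Finset.range (m + 1))
        (fun n hn => h0 _ (by simp only [Finset.mem_range] at hn; omega)),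
      tsum_congr (g := fun _ => (0 : ℝ)) (fun n => by rw [h1 _ (by omega), sub_self]),
      Finset.sum_range_succ,
      Finset.sum_congr rfl (g := fun _ => (1 : ℝ)) (fun n hn => h1 _ (by
        simp only [Finset.mem_range] at hn; omega))]
    simp
  · obtain ⟨m, hm⟩ := Int.le.dest (Int.lt_add_one_iff.1 h : τ ≤ 0)
    obtain rfl : τ = -(m : ℤ) := by omega
    have e1 : ∑' n : ℕ, g n = 0 := by
      rw [tsum_congr (fun n : ℕ => h0 n (by omega)), tsum_zero]
    rw [e1, tsum_eq_sum (s := Finset.range (m + 1)) (fun n hn => by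
        simp only [Finset.mem_range] at hn
        rw [h1 _ (by omega), sub_self]),
      Finset.sum_range_succ,
      Finset.sum_congr rfl (g := fun _ => (1 : ℝ)) (fun n hn => by
        simp only [Finset.mem_range] at hn
        rw [h0 _ (by omega), sub_zero])]
    have e : -((m : ℤ) + 1) = -(m : ℤ) - 1 := by ring
    simp only [e, Finset.sum_const, Finset.card_range, nsmul_eq_mul, mul_one,
      Int.cast_neg, Int.cast_natCast]
    ring

theorem omegaS_eq (hε : 0 < ε) (hε' : ε ≤ S.εX) (hω : IsCutoff P ε ω₀) (hx : x ∈ stableSet P)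
    (hxP : x ∉ P.carrier) : S.omegaS ω₀ x =
      entryTime P ε x - 1 + ω₀ ((S.φ ^ (entryTime P ε x - 1)) x) := by
  rw [← tsum_sub_tsum_of_step (g := fun n => ω₀ ((S.φ ^ n) x)) (τ := entryTime P ε x)]
  · unfold omegaS
    congr 1
    · exact tsum_congr fun n => by rw [zpow_natCast_apply]
    · refine tsum_congr fun n => ?_
      rw [← Nat.cast_succ, zpow_neg_natCast_apply]
  · intro n hn
    exact hω.eq_zero _ (@subset_closure _ S.stableTopology _ _
      ((entryTime_le_iff hε hε' hx hxP).1 hn))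
  · intro n hn
    refine hω.eq_one _ ⟨zpow_mem_stableSet hx n, fun h => ?_⟩
    have h' : (S.φ ^ (n + 1)) x ∈ localStableSet P ε := by
      rw [add_comm, zpow_add_apply, zpow_one]; exact h
    exact absurd ((entryTime_le_iff hε hε' hx hxP).2 h') (not_le.2 hn)

theorem omegaS_mem_Icc (hε : 0 < ε) (hε' : ε ≤ S.εX) (hω : IsCutoff P ε ω₀)
    (hx : x ∈ stableSet P) (hxP : x ∉ P.carrier) :
    S.omegaS ω₀ x ∈ Set.Icc ((entryTime P ε x : ℝ) - 1) (entryTime P ε x) := by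
  rw [omegaS_eq hε hε' hω hx hxP]
  have := hω.mem_Icc _ (zpow_mem_stableSet hx (entryTime P ε x - 1))
  exact ⟨by linarith [this.1], by linarith [this.2]⟩

theorem omegaS_zpow (hε : 0 < ε) (hε' : ε ≤ S.εX) (hω : IsCutoff P ε ω₀) (hx : x ∈ stableSet P)
    (hxP : x ∉ P.carrier) (k : ℤ) : S.omegaS ω₀ ((S.φ ^ k) x) = S.omegaS ω₀ x - k := by
  rw [omegaS_eq hε hε' hω hx hxP, omegaS_eq hε hε' hω (zpow_mem_stableSet hx k)
    (by rwa [P.zpow_mem_iff]), entryTime_zpow hε hε' hx hxP, ← zpow_add_apply]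
  rw [show entryTime P ε x - k - 1 + k = entryTime P ε x - 1 by ring]
  push_cast
  ring

/-! ### Heteroclinic points -/

/-- Unstably equivalent periodic points are equal. -/
theorem eq_of_unstableEquiv_of_periodic (hx : x ∈ Function.periodicPts S.φ)
    (hy : y ∈ Function.periodicPts S.φ) (h : S.UnstableEquiv x y) : x = y := by
  obtain ⟨m, hm, hx⟩ := hx
  obtain ⟨n, hn, hy⟩ := hy
  have key : ∀ {k : ℕ} {z : X}, Function.IsPeriodicPt S.φ k z → S.φ.symm^[k] z = z := by
    intro k z hz
    have h1 : S.φ.symm^[k] (S.φ^[k] z) = z :=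
      (Function.LeftInverse.iterate S.φ.symm_apply_apply k) z
    rwa [hz.eq] at h1
  have hc : ∀ k : ℕ, S.φ.symm^[m * n * k] x = x ∧ S.φ.symm^[m * n * k] y = y := fun k =>
    ⟨key (by rw [mul_assoc]; exact hx.mul_const _),
      key (by rw [mul_comm m, mul_assoc]; exact hy.mul_const _)⟩
  have ht : Tendsto (fun k : ℕ => m * n * k) atTop atTop :=
    tendsto_id.const_mul_atTop' (Nat.mul_pos hm hn)
  have h2 := h.comp ht
  simp only [Function.comp_def, hc] at h2
  exact dist_eq_zero.1 (tendsto_nhds_unique tendsto_const_nhds h2)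

theorem notMem_carrier_of_mem_unstableSet (hPQ : Disjoint P.carrier Q.carrier)
    (hx : x ∈ unstableSet Q) : x ∉ P.carrier := by
  intro hxP
  obtain ⟨q, hq, h⟩ := hx
  obtain rfl := eq_of_unstableEquiv_of_periodic (Q.periodic hq) (P.periodic hxP) h
  exact Set.disjoint_left.1 hPQ hxP hq

theorem heteroclinic_notMem (hPQ : Disjoint P.carrier Q.carrier) (x : heteroclinic P Q) :
    (x : X) ∉ P.carrier := notMem_carrier_of_mem_unstableSet hPQ x.2.2

/-- Irreducibility gives periodic points that pass from any open set to any other one: the dense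
orbit visits both sets, and a nearby periodic point may be followed for a positive time. -/
theorem IsIrreducible.exists_iterate_mem (hS : S.IsIrreducible) {U V : Set X} (hU : IsOpen U)
    (hV : IsOpen V) (hU' : U.Nonempty) (hV' : V.Nonempty) :
    ∃ y ∈ U, ∃ n : ℕ, S.φ^[n] y ∈ V := by
  obtain ⟨hper, x, hx⟩ := hS
  obtain ⟨_, ⟨i, rfl⟩, hu⟩ := hx.exists_mem_open hU hU'
  obtain ⟨_, ⟨j, rfl⟩, hv⟩ := hx.exists_mem_open hV hV'
  have hW : IsOpen (U ∩ (S.φ ^ (j - i)) ⁻¹' V) :=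
    hU.inter (hV.preimage (S.φ ^ (j - i)).continuous)
  obtain ⟨y, ⟨m, hm, hy⟩, hyU, hyV⟩ := hper.exists_mem_open hW ⟨_, hu, by
    simpa only [Set.mem_preimage, ← zpow_add_apply, sub_add_cancel] using hv⟩
  have hyk : ∀ k : ℕ, (S.φ ^ ((m * k : ℕ) : ℤ)) y = y := fun k => by
    rw [zpow_natCast_apply]; exact hy.mul_const k
  refine ⟨y, hyU, (j - i + (m * (j - i).natAbs : ℕ)).toNat, ?_⟩
  rw [← zpow_natCast_apply, Int.toNat_of_nonneg, zpow_add_apply, hyk]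
  · exact hyV
  · have h1 : (j - i).natAbs ≤ m * (j - i).natAbs := Nat.le_mul_of_pos_left _ hm
    omega

theorem heteroclinic_nonempty (hS : S.IsIrreducible) (hP : P.carrier.Nonempty)
    (hQ : Q.carrier.Nonempty) : Nonempty (heteroclinic P Q) := by
  obtain ⟨p, hp⟩ := hP
  obtain ⟨q, hq⟩ := hQ
  obtain ⟨δ, hδ, hδε, hb⟩ := S.exists_dist_bracket_lt S.εX_pos
  obtain ⟨η, hη, hηδ, hb'⟩ := S.exists_dist_bracket_lt (half_pos hδ)
  obtain ⟨y, hy, n, hn⟩ := hS.exists_iterate_mem (Metric.isOpen_ball (x := q) (ε := η))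
    (Metric.isOpen_ball (x := p) (ε := δ / 2)) ⟨q, Metric.mem_ball_self hη⟩
    ⟨p, Metric.mem_ball_self (half_pos hδ)⟩
  rw [Metric.mem_ball] at hy hn
  have hw := hb' y q hy
  have hws := bracket_mem_localStable (hy.trans_le hηδ) hw.1
    ((half_le_self hδ.le).trans hδε)
  have hwu := bracket_mem_localUnstable (hy.trans_le hηδ) hw.2
    ((half_le_self hδ.le).trans hδε)
  set w := S.bracket y q
  have hpw : dist p (S.φ^[n] w) < δ := by
    have h1 := (iterate_mem_localStable' ((half_le_self hδ.le).trans hδε) hws n).1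
    have h2 := dist_triangle p (S.φ^[n] y) (S.φ^[n] w)
    rw [dist_comm p (S.φ^[n] y)] at h2
    linarith
  have hz := hb _ _ hpw
  have hw' : S.φ^[n] w ∈ unstableSet Q := by
    rw [← zpow_natCast_apply]
    refine zpow_mem_unstableSet ⟨q, hq, ?_⟩ _
    exact unstableEquiv_of_mem_localUnstable
      (localUnstable_mono ((half_le_self hδ.le).trans hδε) hwu)
  exact ⟨⟨S.bracket p (S.φ^[n] w),
    ⟨p, hp, stableEquiv_of_mem_localStable
      (bracket_mem_localStable (hpw.trans_le hδε) hz.1 le_rfl)⟩,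
    mem_unstableSet_of_unstableEquiv hw' (unstableEquiv_of_mem_localUnstable
      (bracket_mem_localUnstable (hpw.trans_le hδε) hz.2 le_rfl))⟩⟩

end SmaleSpace

namespace SmaleSpace

variable {X : Type*} [MetricSpace X] [CompactSpace X] {S : SmaleSpace X} {P Q : S.PeriodicSet}

/-! ### Counting heteroclinic points -/

/-- The points of a local unstable set that reach a given local stable set in time `n` have
different itineraries through a finite cover of `X` by balls, hence grow at most exponentially in
number. -/
theorem exists_card_le_pow (S : SmaleSpace X) : ∃ M : ℕ, ∀ (y p : X) (n : ℕ) (T : Finset X),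
    (∀ x ∈ T, x ∈ S.localUnstable y (S.εX / 2) ∧ S.φ^[n] x ∈ S.localStable p (S.εX / 2)) →
      T.card ≤ M ^ (n + 1) := by
  obtain ⟨t, -, ht, hcov⟩ := (isCompact_univ (X := X)).finite_cover_balls (half_pos S.εX_pos)
  have hc : ∀ x : X, ∃ c : ht.toFinset, dist x c < S.εX / 2 := fun x => by
    have := hcov (Set.mem_univ x)
    simp only [Set.mem_iUnion, Metric.mem_ball, exists_prop] at this
    obtain ⟨c, hc, hxc⟩ := this
    exact ⟨⟨c, ht.mem_toFinset.2 hc⟩, hxc⟩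
  choose c hc using hc
  refine ⟨ht.toFinset.card, fun y p n T hT => ?_⟩
  have hle : S.εX / 2 ≤ S.εX := half_le_self S.εX_pos.le
  have hinj : Set.InjOn (fun x (i : Fin (n + 1)) => c (S.φ^[(i : ℕ)] x)) T := by
    intro x hx x' hx' h
    have hd : ∀ i ≤ n, dist (S.φ^[i] x) (S.φ^[i] x') < S.εX := fun i hi => by
      have h1 := congrFun h ⟨i, Nat.lt_succ_of_le hi⟩
      simp only at h1
      have h2 := hc (S.φ^[i] x)
      have h3 := hc (S.φ^[i] x')
      rw [← h1, dist_comm] at h3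
      linarith [dist_triangle (S.φ^[i] x) (c (S.φ^[i] x)) (S.φ^[i] x')]
    obtain ⟨hu, hs⟩ := hT x hx
    obtain ⟨hu', hs'⟩ := hT x' hx'
    have hxu : x' ∈ S.localUnstable x S.εX :=
      localUnstable_trans (localUnstable_mono hle (localUnstable_symm hle hu))
        (localUnstable_mono hle hu') (hd 0 (Nat.zero_le _)) le_rfl
    have hxs : S.φ^[n] x' ∈ S.localStable (S.φ^[n] x) S.εX :=
      localStable_trans (localStable_mono hle (localStable_symm hle hs))
        (localStable_mono hle hs') (hd n le_rfl) le_rfl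
    exact S.φ.injective.iterate n
      (eq_of_mem_localStable_of_mem_localUnstable hxs (iterate_mem_localUnstable hxu hd))
  have := Finset.card_le_card_of_injOn _ (t := Finset.univ) (fun _ _ => Finset.mem_univ _) hinj
  simpa using this

/-! ### Points that become stably close at a given time -/

/-- At time `N` the orbits of `x` and `y` lie in a common local stable set. -/
def StableAt (S : SmaleSpace X) (N : ℕ) (x y : X) : Prop :=
  S.φ^[N] y ∈ S.localStable (S.φ^[N] x) (S.εX / 2)

variable {x y z : X} {M N : ℕ} {δ : ℝ}

theorem half_εX_le (S : SmaleSpace X) : S.εX / 2 ≤ S.εX := half_le_self S.εX_pos.le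

theorem StableAt.symm (h : S.StableAt N x y) : S.StableAt N y x :=
  localStable_symm S.half_εX_le h

theorem StableAt.mono (h : S.StableAt N x y) (hNM : N ≤ M) : S.StableAt M x y := by
  obtain ⟨k, rfl⟩ := Nat.exists_eq_add_of_le' hNM
  unfold StableAt at h ⊢
  rw [Function.iterate_add_apply, Function.iterate_add_apply]
  exact iterate_mem_localStable' S.half_εX_le h k

theorem StableAt.map (h : S.StableAt N x y) : S.StableAt N (S.φ x) (S.φ y) := by
  have := h.mono (Nat.le_succ N)
  unfold StableAt at this ⊢
  rwa [← Function.iterate_succ_apply, ← Function.iterate_succ_apply]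

theorem StableAt.map_symm (h : S.StableAt N x y) :
    S.StableAt (N + 1) (S.φ.symm x) (S.φ.symm y) := by
  unfold StableAt at h ⊢
  rwa [Function.iterate_succ_apply, Function.iterate_succ_apply, Homeomorph.apply_symm_apply,
    Homeomorph.apply_symm_apply]

theorem exists_lam_inv_pow_mul_le (S : SmaleSpace X) (hδ : 0 < δ) :
    ∃ k : ℕ, S.lam⁻¹ ^ k * S.εX ≤ δ :=
  ((tendsto_order.1 (S.tendsto_lam_inv_pow_mul S.εX)).2 δ hδ).exists.imp fun _ h => h.le

theorem exists_stableAt_trans (S : SmaleSpace X) : ∃ k : ℕ, ∀ (N : ℕ) (x y z : X),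
    S.StableAt N x y → S.StableAt N y z → S.StableAt (N + k) x z := by
  obtain ⟨k, hk⟩ := S.exists_lam_inv_pow_mul_le (half_pos S.εX_pos)
  refine ⟨k, fun N x y z h h' => ?_⟩
  have := localStable_subset S.half_εX_le S.half_εX_le h h' (add_halves _).le
  rw [add_halves] at this
  have := localStable_mono hk (iterate_mem_localStable le_rfl this k)
  rwa [← Function.iterate_add_apply, ← Function.iterate_add_apply, add_comm k] at this

theorem StableEquiv.exists_stableAt (h : S.StableEquiv x y) : ∃ N, S.StableAt N x y :=
  (h.eventually_mem_localStable (half_pos S.εX_pos)).exists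

theorem StableAt.stableEquiv (h : S.StableAt N x y) : S.StableEquiv x y := by
  have := stableEquiv_of_mem_localStable (localStable_mono S.half_εX_le h)
  unfold StableEquiv at this ⊢
  rw [← tendsto_add_atTop_iff_nat N]
  simpa only [Function.iterate_add_apply] using this

theorem StableAt.dist_iterate_lt (h : S.StableAt N x y) (k : ℕ) :
    dist (S.φ^[N + k] x) (S.φ^[N + k] y) < S.εX / 2 :=
  (h.mono (Nat.le_add_right N k)).1

/-- If `x` and `y` are stably close at time `N`, their entry times differ by a constant, up to the
effect of an entry before time `N`. -/
theorem exists_entryTime_le {ε : ℝ} (hε : 0 < ε) (hε' : ε ≤ S.εX / 2)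
    (P : S.PeriodicSet) : ∃ k : ℕ, ∀ (N : ℕ) (x y : X), S.StableAt N x y → x ∈ stableSet P →
      y ∈ stableSet P → x ∉ P.carrier → y ∉ P.carrier →
      entryTime P ε y ≤ max (entryTime P ε x) N + k := by
  have hεX := hε'.trans S.half_εX_le
  obtain ⟨k, hk⟩ := S.exists_lam_inv_pow_mul_le hε
  refine ⟨k, fun N x y h hx hy hxP hyP => ?_⟩
  obtain ⟨m, hm⟩ := Int.eq_ofNat_of_zero_le
    ((Int.natCast_nonneg N).trans (le_max_right (entryTime P ε x) N))
  have hNm : N ≤ m := by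
    have := le_max_right (entryTime P ε x) (N : ℤ)
    omega
  have h1 : (S.φ ^ (m : ℤ)) x ∈ localStableSet P ε :=
    (entryTime_le_iff hε hεX hx hxP).1 (hm ▸ le_max_left _ _)
  rw [hm, entryTime_le_iff hε hεX hy hyP, ← Nat.cast_add, zpow_natCast_apply, add_comm m,
    Function.iterate_add_apply]
  rw [zpow_natCast_apply] at h1
  obtain ⟨p, hp, hpx⟩ := mem_localStableSet.1 h1
  have h2 := localStable_subset (b := S.εX / 2) hεX S.half_εX_le hpx (h.mono hNm) (by linarith)
  have h3 := iterate_mem_localStable le_rfl (localStable_mono (by linarith) h2) k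
  exact mem_localStableSet.2 ⟨_, P.iterate_mem hp k, localStable_mono hk h3⟩

end SmaleSpace

namespace SmaleSpace

variable {X : Type*} [MetricSpace X] [CompactSpace X] {S : SmaleSpace X} {P Q : S.PeriodicSet}

/-! ### The topology of `X^u(Q)` -/

theorem nhds_unstableTopology_hasBasis (y : X) :
    (@nhds X S.unstableTopology y).HasBasis (fun δ : ℝ => 0 < δ ∧ δ ≤ S.εX)
      (fun δ => S.localUnstable y δ) := by
  let _ := S.unstableTopology
  have hopen : ∀ (y : X) (δ : ℝ), δ ≤ S.εX → IsOpen (S.localUnstable y δ) := by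
    intro y δ hδ z hz
    refine ⟨δ - dist y z, sub_pos.2 hz.1, (sub_le_self _ dist_nonneg).trans hδ, fun w hw => ?_⟩
    refine localUnstable_trans (localUnstable_mono hδ hz)
      (localUnstable_mono ((sub_le_self _ dist_nonneg).trans hδ) hw) ?_ hδ
    linarith [dist_triangle y z w, hw.1]
  refine ⟨fun t => ⟨fun ht => ?_, ?_⟩⟩
  · obtain ⟨U, hUt, hU, hy⟩ := mem_nhds_iff.1 ht
    obtain ⟨δ, h0, h1, h2⟩ := hU y hy
    exact ⟨δ, ⟨h0, h1⟩, h2.trans hUt⟩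
  · rintro ⟨δ, ⟨h0, h1⟩, h⟩
    exact mem_of_superset ((hopen y δ h1).mem_nhds (mem_localUnstable_self h0)) h

theorem UnstableSpace.nhds_hasBasis (y : UnstableSpace Q) :
    (𝓝 y).HasBasis (fun δ : ℝ => 0 < δ ∧ δ ≤ S.εX)
      (fun δ => {z : UnstableSpace Q | z.1 ∈ S.localUnstable y.1 δ}) := by
  let _ := S.unstableTopology
  have h : 𝓝 y = comap Subtype.val (@nhds X S.unstableTopology y.1) :=
    @nhds_induced _ _ S.unstableTopology _ _
  rw [h]
  exact (nhds_unstableTopology_hasBasis y.1).comap _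

theorem UnstableSpace.continuous_val :
    Continuous (fun y : UnstableSpace Q => (y.1 : X)) := by
  rw [continuous_iff_continuousAt]
  intro y
  refine (UnstableSpace.nhds_hasBasis y).tendsto_iff Metric.nhds_basis_ball |>.2 fun r hr => ?_
  refine ⟨min r S.εX, ⟨lt_min hr S.εX_pos, min_le_right _ _⟩, fun z hz => ?_⟩
  rw [Metric.mem_ball, dist_comm]
  exact hz.1.trans_le (min_le_left _ _)

instance : T2Space (UnstableSpace Q) :=
  T2Space.of_injective_continuous Subtype.val_injective UnstableSpace.continuous_val

theorem UnstableSpace.tendsto_nhds {ι : Type*} {l : Filter ι} {f : ι → UnstableSpace Q}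
    {y : UnstableSpace Q} : Tendsto f l (𝓝 y) ↔ Tendsto (fun i => (f i).1) l (𝓝 y.1) ∧
      ∀ᶠ i in l, (f i).1 ∈ S.localUnstable y.1 S.εX := by
  refine ⟨fun h => ⟨(UnstableSpace.continuous_val.tendsto y).comp h,
    h ((UnstableSpace.nhds_hasBasis y).mem_of_mem ⟨S.εX_pos, le_rfl⟩)⟩, fun ⟨h1, h2⟩ => ?_⟩
  refine (UnstableSpace.nhds_hasBasis y).tendsto_right_iff.2 fun δ hδ => ?_
  filter_upwards [h2, h1.eventually (Metric.ball_mem_nhds _ hδ.1)] with i hi hi'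
  exact ⟨by rw [dist_comm]; exact hi', hi.2⟩

theorem UnstableSpace.eventually_mem_localUnstable (y : UnstableSpace Q) {δ : ℝ} (hδ : 0 < δ) :
    ∀ᶠ z in 𝓝 y, z.1 ∈ S.localUnstable y.1 δ :=
  mem_of_superset ((UnstableSpace.nhds_hasBasis y).mem_of_mem
    ⟨lt_min hδ S.εX_pos, min_le_right _ _⟩) fun _ hz => localUnstable_mono (min_le_left _ _) hz

/-- The map `φ` on `X^u(Q)`. -/
def UnstableSpace.shift (y : UnstableSpace Q) : UnstableSpace Q :=
  ⟨S.φ y.1, map_mem_unstableSet Q y.2⟩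

/-- The map `φ⁻¹` on `X^u(Q)`. -/
def UnstableSpace.unshift (y : UnstableSpace Q) : UnstableSpace Q :=
  ⟨S.φ.symm y.1, by simpa [zpow_neg_one] using zpow_mem_unstableSet y.2 (-1)⟩

theorem UnstableSpace.continuous_shift : Continuous (UnstableSpace.shift (Q := Q)) := by
  rw [continuous_iff_continuousAt]
  intro y
  have h1 : Tendsto (fun z : UnstableSpace Q => S.φ z.1) (𝓝 y) (𝓝 (S.φ y.1)) :=
    (S.φ.continuous.comp UnstableSpace.continuous_val).tendsto y
  refine UnstableSpace.tendsto_nhds.2 ⟨h1, ?_⟩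
  filter_upwards [y.eventually_mem_localUnstable S.εX_pos,
    h1.eventually (Metric.ball_mem_nhds _ S.εX_pos)] with z hz hz'
  refine iterate_mem_localUnstable (n := 1) hz fun i hi => ?_
  interval_cases i
  · exact hz.1
  · rw [dist_comm]; exact hz'

theorem UnstableSpace.continuous_unshift : Continuous (UnstableSpace.unshift (Q := Q)) := by
  rw [continuous_iff_continuousAt]
  intro y
  refine UnstableSpace.tendsto_nhds.2
    ⟨(S.φ.symm.continuous.comp UnstableSpace.continuous_val).tendsto y, ?_⟩
  filter_upwards [y.eventually_mem_localUnstable S.εX_pos] with z hz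
  exact iterate_mem_localStable' (S := S.dual) le_rfl hz 1

instance : WeaklyLocallyCompactSpace (UnstableSpace Q) where
  exists_compact_mem_nhds x := by
    set A : Set X := {z | dist x.1 z ≤ S.εX / 4 ∧ S.bracket x.1 z = x.1} with hA
    have h0 := S.εX_pos
    have hAu : ∀ z ∈ A, z ∈ S.localUnstable x.1 (S.εX / 2) := fun z hz =>
      ⟨lt_of_le_of_lt hz.1 (by linarith), hz.2⟩
    have hAc : IsCompact A := by
      have hcl : IsClosed {z : X | dist x.1 z ≤ S.εX / 4} :=
        isClosed_le (by fun_prop) continuous_const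
      have hcont : ContinuousOn (fun z => S.bracket x.1 z) {z : X | dist x.1 z ≤ S.εX / 4} :=
        S.continuousOn_bracket.comp (f := fun z : X => (x.1, z)) (by fun_prop)
          (fun z (hz : dist x.1 z ≤ S.εX / 4) =>
            show dist x.1 z < S.εX from lt_of_le_of_lt hz (by linarith))
      exact (hcont.preimage_isClosed_of_isClosed hcl (isClosed_singleton (x := x.1))).isCompact
    have hmem : ∀ z ∈ A, z ∈ unstableSet Q := fun z hz =>
      mem_unstableSet_of_unstableEquiv x.2
        (unstableEquiv_of_mem_localUnstable (localUnstable_mono S.half_εX_le (hAu z hz)))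
    set j : A → UnstableSpace Q := fun z => ⟨z.1, hmem z.1 z.2⟩ with hj
    have hjc : Continuous j := by
      rw [continuous_iff_continuousAt]
      intro z
      have h1 : Tendsto (fun w : A => (w : X)) (𝓝 z) (𝓝 z) := continuous_subtype_val.tendsto z
      refine UnstableSpace.tendsto_nhds.2 ⟨h1, ?_⟩
      filter_upwards [h1.eventually (Metric.ball_mem_nhds _ S.εX_pos)] with w hw
      have hz := localUnstable_symm S.half_εX_le (hAu z z.2)
      exact localUnstable_trans (localUnstable_mono S.half_εX_le hz)
        (localUnstable_mono S.half_εX_le (hAu w w.2)) (by rw [dist_comm]; exact hw) le_rfl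
    have : CompactSpace A := isCompact_iff_compactSpace.1 hAc
    refine ⟨Set.range j, isCompact_range hjc, ?_⟩
    filter_upwards [x.eventually_mem_localUnstable (show 0 < S.εX / 4 by linarith)] with z hz
    exact ⟨⟨z.1, hz.1.le, hz.2⟩, rfl⟩

/-- On a compact subset of `X^u(Q)` the number of points of `X^s(P)` with entry time at most `n`
grows at most exponentially. -/
theorem exists_card_entryTime_le {ε : ℝ} (hε : 0 < ε) (hε' : ε ≤ S.εX / 2)
    (hPQ : Disjoint P.carrier Q.carrier) {K : Set (UnstableSpace Q)} (hK : IsCompact K) :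
    ∃ C M : ℕ, ∀ (n : ℕ) (T : Finset (UnstableSpace Q)),
      (∀ x ∈ T, x ∈ K ∧ x.1 ∈ stableSet P ∧ entryTime P ε x.1 ≤ n) → T.card ≤ C * M ^ n := by
  classical
  obtain ⟨M, hM⟩ := S.exists_card_le_pow
  obtain ⟨t, -, ht⟩ := hK.elim_nhds_subcover
    (fun y => {z : UnstableSpace Q | z.1 ∈ S.localUnstable y.1 (S.εX / 2)})
    (fun y _ => y.eventually_mem_localUnstable (half_pos S.εX_pos))
  refine ⟨(t ×ˢ P.finite.toFinset).card * M, M, fun n T hT => ?_⟩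
  have hsub : T ⊆ (t ×ˢ P.finite.toFinset).biUnion fun q => T.filter fun x =>
      x.1 ∈ S.localUnstable q.1.1 (S.εX / 2) ∧ S.φ^[n] x.1 ∈ S.localStable q.2 (S.εX / 2) := by
    intro x hx
    obtain ⟨hxK, hxP, hxn⟩ := hT x hx
    rw [entryTime_le_iff hε (hε'.trans S.half_εX_le) hxP
      (notMem_carrier_of_mem_unstableSet hPQ x.2), zpow_natCast_apply, mem_localStableSet] at hxn
    obtain ⟨p, hp, hxp⟩ := hxn
    have hxt := ht hxK
    simp only [Set.mem_iUnion, exists_prop] at hxt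
    obtain ⟨y, hy, hxy⟩ := hxt
    exact Finset.mem_biUnion.2 ⟨(y, p), Finset.mem_product.2 ⟨hy, P.finite.mem_toFinset.2 hp⟩,
      Finset.mem_filter.2 ⟨hx, hxy, localStable_mono hε' hxp⟩⟩
  refine (Finset.card_le_card hsub).trans ?_
  rw [mul_assoc, ← pow_succ']
  refine Finset.card_biUnion_le_card_mul _ _ _ fun q _ => ?_
  rw [← Finset.card_image_of_injective (f := fun x : UnstableSpace Q => (x.1 : X)) _
    fun _ _ h => Subtype.ext h]
  refine hM q.1.1 q.2 n _ fun x hx => ?_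
  obtain ⟨w, hw, rfl⟩ := Finset.mem_image.1 hx
  exact (Finset.mem_filter.1 hw).2

theorem finite_entryTime_le {ε : ℝ} (hε : 0 < ε) (hε' : ε ≤ S.εX / 2)
    (hPQ : Disjoint P.carrier Q.carrier) {K : Set (UnstableSpace Q)} (hK : IsCompact K) (n : ℤ) :
    {x : UnstableSpace Q | x ∈ K ∧ x.1 ∈ stableSet P ∧ entryTime P ε x.1 ≤ n}.Finite := by
  obtain ⟨C, M, h⟩ := exists_card_entryTime_le (P := P) hε hε' hPQ hK
  by_contra hinf
  obtain ⟨T, hT, hcard⟩ := Set.Infinite.exists_subset_card_eq hinf (C * M ^ n.toNat + 1)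
  have := h n.toNat T fun x hx => ⟨(hT hx).1, (hT hx).2.1,
    (hT hx).2.2.trans (Int.self_le_toNat n)⟩
  omega

theorem heteroclinic_countable (P Q : S.PeriodicSet) : Countable (heteroclinic P Q) := by
  obtain ⟨M, hM⟩ := S.exists_card_le_pow
  have hfin : ∀ (y p : X) (n : ℕ), {x | x ∈ S.localUnstable y (S.εX / 2) ∧
      S.φ^[n] x ∈ S.localStable p (S.εX / 2)}.Finite := by
    intro y p n
    by_contra hinf
    obtain ⟨T, hT, hcard⟩ := Set.Infinite.exists_subset_card_eq hinf (M ^ (n + 1) + 1)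
    have := hM y p n T fun x hx => hT hx
    omega
  have hall : (⋃ (n : ℕ) (m : ℕ), ⋃ q ∈ Q.carrier, ⋃ p ∈ P.carrier, S.φ^[n] ''
      {x | x ∈ S.localUnstable q (S.εX / 2) ∧
        S.φ^[m] x ∈ S.localStable p (S.εX / 2)}).Countable :=
    Set.countable_iUnion fun n => Set.countable_iUnion fun m =>
      Q.finite.countable.biUnion fun q _ => P.finite.countable.biUnion fun p _ =>
        ((hfin q p m).image _).countable
  refine Set.Countable.to_subtype (hall.mono fun x hx => ?_)
  obtain ⟨hxP, q, hq, hqx⟩ := hx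
  obtain ⟨n, hn⟩ := (hqx.eventually_mem_localUnstable (half_pos S.εX_pos)).exists
  rw [← zpow_neg_natCast_apply, ← zpow_neg_natCast_apply] at hn
  obtain ⟨p, hp, hpx⟩ := zpow_mem_stableSet hxP (-n)
  obtain ⟨m, hm⟩ := (hpx.eventually_mem_localStable (half_pos S.εX_pos)).exists
  simp only [Set.mem_iUnion]
  refine ⟨n, m, _, (Q.zpow_mem_iff (-n)).2 hq, _, P.iterate_mem hp m, _, ⟨hn, hm⟩, ?_⟩
  rw [← zpow_natCast_apply, ← zpow_add_apply, add_neg_cancel, zpow_zero]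
  rfl

end SmaleSpace

namespace SmaleSpace

variable {X : Type*} [MetricSpace X] [CompactSpace X] {S : SmaleSpace X} {P Q : S.PeriodicSet}
  {N : ℕ} {δ : ℝ}

/-! ### The topology of the groupoid of stable equivalence -/

/-- The range map of the groupoid. -/
def StableGroupoid.r (g : StableGroupoid Q) : UnstableSpace Q := ⟨g.1.1, g.2.2.1⟩

/-- The source map of the groupoid. -/
def StableGroupoid.s (g : StableGroupoid Q) : UnstableSpace Q := ⟨g.1.2, g.2.2.2⟩

theorem StableGroupoid.ext {g h : StableGroupoid Q} (hr : g.r = h.r) (hs : g.s = h.s) : g = h :=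
  Subtype.ext (Prod.ext (congrArg Subtype.val hr) (congrArg Subtype.val hs))

theorem StableGroupoid.exists_stableAt (g : StableGroupoid Q) :
    ∃ N, S.StableAt N g.r.1 g.s.1 :=
  StableEquiv.exists_stableAt g.2.1

/-- The element of the groupoid given by two points of `X^u(Q)` that become stably close. -/
def StableGroupoid.mk (x y : UnstableSpace Q) (h : S.StableAt N x.1 y.1) : StableGroupoid Q :=
  ⟨(x.1, y.1), h.stableEquiv, x.2, y.2⟩

theorem eventually_dist_iterate_lt {v w : X} {i j : ℕ} {η : ℝ}
    (h : dist (S.φ^[i] v) (S.φ^[j] w) < η) :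
    ∀ᶠ p : X × X in 𝓝 (v, w), dist (S.φ^[i] p.1) (S.φ^[j] p.2) < η := by
  have hc : Continuous fun p : X × X => dist (S.φ^[i] p.1) (S.φ^[j] p.2) :=
    ((S.φ.continuous.iterate i).comp continuous_fst).dist
      ((S.φ.continuous.iterate j).comp continuous_snd)
  exact (hc.tendsto (v, w)).eventually (gt_mem_nhds h)

theorem iterate_symm_iterate (S : SmaleSpace X) (n : ℕ) (x : X) :
    S.φ.symm^[n] (S.φ^[n] x) = x :=
  (Function.LeftInverse.iterate S.φ.symm_apply_apply n) x

theorem iterate_iterate_symm (S : SmaleSpace X) (n : ℕ) (x : X) :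
    S.φ^[n] (S.φ.symm^[n] x) = x :=
  (Function.RightInverse.iterate S.φ.apply_symm_apply n) x

theorem iterate_holonomy (v : X) (N : ℕ) (x : X) :
    S.φ^[N] (S.holonomy v N x) = S.bracket (S.φ^[N] x) (S.φ^[N] v) :=
  S.iterate_iterate_symm _ _

/-- Near a pair `(v, w)` that is stably close at time `N`, the pairs related by the holonomy map
are all the pairs that are stably close at time `N`. -/
theorem exists_eq_holonomy {v w : X} (h : S.StableAt N v w) : ∃ δ, 0 < δ ∧ δ ≤ S.εX ∧
    ∀ x ∈ S.localUnstable v δ, ∀ y ∈ S.localUnstable w δ, S.StableAt N x y →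
      x = S.holonomy v N y := by
  have hvv : ∀ i, dist (S.φ^[i] v) (S.φ^[i] v) < S.εX := fun i => by simpa using S.εX_pos
  have h1 : ∀ᶠ p : X × X in 𝓝 (v, v), ∀ i ∈ Finset.range (N + 1),
      dist (S.φ^[i] p.1) (S.φ^[i] p.2) < S.εX :=
    (eventually_all_finset _).2 fun i _ => eventually_dist_iterate_lt (hvv i)
  have h2 : ∀ᶠ p : X × X in 𝓝 (v, w), dist (S.φ^[N] p.1) (S.φ^[N] p.2) < S.εX :=
    eventually_dist_iterate_lt (h.1.trans_le S.half_εX_le)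
  obtain ⟨δ₁, hδ₁, h1⟩ := Metric.eventually_nhds_iff.1 h1
  obtain ⟨δ₂, hδ₂, h2⟩ := Metric.eventually_nhds_iff.1 h2
  refine ⟨min (min δ₁ δ₂) S.εX, lt_min (lt_min hδ₁ hδ₂) S.εX_pos, min_le_right _ _,
    fun x hx y hy hxy => ?_⟩
  have hd : ∀ i ≤ N, dist (S.φ^[i] v) (S.φ^[i] x) < S.εX := fun i hi =>
    h1 (y := (v, x)) (by
      rw [Prod.dist_eq, dist_self, max_eq_right dist_nonneg, dist_comm]
      exact hx.1.trans_le ((min_le_left _ _).trans (min_le_left _ _))) i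
      (Finset.mem_range.2 (Nat.lt_succ_of_le hi))
  have hd' : dist (S.φ^[N] v) (S.φ^[N] y) < S.εX :=
    h2 (y := (v, y)) (by
      rw [Prod.dist_eq, dist_self, max_eq_right dist_nonneg, dist_comm]
      exact hy.1.trans_le ((min_le_left _ _).trans (min_le_right _ _)))
  apply S.φ.injective.iterate N
  rw [iterate_holonomy]
  exact (bracket_eq (by rwa [dist_comm]) (localStable_mono S.half_εX_le hxy.symm)
    (iterate_mem_localUnstable (localUnstable_mono (min_le_right _ _) hx) hd)).symm

/-- The pairs that are stably close at time `N` form an open set, which the basic sets built from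
another time `N'` detect as well. -/
theorem exists_stableAt_of_eq_holonomy {v w : X} {N' : ℕ} (h : S.StableAt N v w)
    (h' : S.StableAt N' v w) : ∃ δ, 0 < δ ∧ ∀ x y, dist v x < δ → dist w y < δ →
      x = S.holonomy v N' y → S.StableAt N x y := by
  have h1 : ∀ᶠ p : X × X in 𝓝 (v, w), ∀ i ∈ Finset.range (N' + 1),
      dist (S.φ^[N + i] p.1) (S.φ^[N + i] p.2) < S.εX / 2 :=
    (eventually_all_finset _).2 fun i _ => eventually_dist_iterate_lt (h.dist_iterate_lt i)
  have h2 : ∀ᶠ p : X × X in 𝓝 (v, w), dist (S.φ^[N'] p.1) (S.φ^[N'] p.2) < S.εX :=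
    eventually_dist_iterate_lt (h'.1.trans_le S.half_εX_le)
  obtain ⟨δ, hδ, hp⟩ := Metric.eventually_nhds_iff.1 (h1.and h2)
  refine ⟨δ, hδ, fun x y hx hy hxy => ?_⟩
  obtain ⟨hd, hd1⟩ := hp (y := (x, y)) (by
    rw [Prod.dist_eq, max_lt_iff, dist_comm, dist_comm _ w]; exact ⟨hx, hy⟩)
  have hd2 := (hp (y := (v, y)) (by
    rw [Prod.dist_eq, max_lt_iff, dist_self, dist_comm _ w]; exact ⟨hδ, hy⟩)).2
  simp only at hd hd1 hd2
  have hN' : S.φ^[N'] y ∈ S.localStable (S.φ^[N'] x) S.εX := by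
    apply localStable_symm le_rfl
    have e : S.φ^[N'] x = S.bracket (S.φ^[N'] y) (S.φ^[N'] v) := by rw [hxy, iterate_holonomy]
    rw [dist_comm, e] at hd1
    rw [e]
    exact bracket_mem_localStable (by rwa [dist_comm]) hd1 le_rfl
  have hlt := hd 0 (by simp)
  simp only [add_zero] at hlt
  refine ⟨hlt, ?_⟩
  rcases le_total N' N with hle | hle
  · obtain ⟨k, rfl⟩ := Nat.exists_eq_add_of_le' hle
    rw [Function.iterate_add_apply, Function.iterate_add_apply]
    exact (iterate_mem_localStable' le_rfl hN' k).2
  · obtain ⟨k, rfl⟩ := Nat.exists_eq_add_of_le hle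
    exact (iterate_symm_mem_localStable hN' fun i hi =>
      (hd i (Finset.mem_range.2 (by omega))).trans_le S.half_εX_le).2

theorem nhds_groupoid_hasBasis (g : StableGroupoid Q) (hN : S.StableAt N g.r.1 g.s.1) :
    (𝓝 g).HasBasis (fun δ : ℝ => 0 < δ ∧ δ ≤ S.εX) (fun δ => {h : StableGroupoid Q |
      (h.r.1 ∈ S.localUnstable g.r.1 δ ∧ h.s.1 ∈ S.localUnstable g.s.1 δ) ∧
        S.StableAt N h.r.1 h.s.1}) := by
  have hopen : ∀ δ : ℝ, δ ≤ S.εX → IsOpen {h : StableGroupoid Q |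
      (h.r.1 ∈ S.localUnstable g.r.1 δ ∧ h.s.1 ∈ S.localUnstable g.s.1 δ) ∧
        S.StableAt N h.r.1 h.s.1} := by
    intro δ hδ k hk N' hN'
    obtain ⟨⟨hr, hs⟩, hkN⟩ := hk
    obtain ⟨η, hη, hη'⟩ := exists_stableAt_of_eq_holonomy hkN hN'
    set ρ := min (min (δ - dist g.r.1 k.r.1) (δ - dist g.s.1 k.s.1)) (min η (S.εX / 2)) with hρ
    have hρ1 : ρ ≤ δ - dist g.r.1 k.r.1 := (min_le_left _ _).trans (min_le_left _ _)
    have hρ2 : ρ ≤ δ - dist g.s.1 k.s.1 := (min_le_left _ _).trans (min_le_right _ _)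
    have hρ3 : ρ ≤ η := (min_le_right _ _).trans (min_le_left _ _)
    have hρ4 : ρ ≤ S.εX / 2 := (min_le_right _ _).trans (min_le_right _ _)
    refine ⟨ρ, lt_min (lt_min (sub_pos.2 hr.1) (sub_pos.2 hs.1))
      (lt_min hη (half_pos S.εX_pos)), hρ4, fun h hh => ?_⟩
    obtain ⟨h2, h1, h3⟩ := hh
    have hρ5 := hρ4.trans S.half_εX_le
    refine ⟨⟨localUnstable_trans (localUnstable_mono hδ hr) (localUnstable_mono hρ5 h1) ?_ hδ,
      localUnstable_trans (localUnstable_mono hδ hs) (localUnstable_mono hρ5 h2) ?_ hδ⟩,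
      hη' _ _ (h1.1.trans_le hρ3) (h2.1.trans_le hρ3) h3⟩
    · have e1 : dist k.r.1 h.r.1 < ρ := h1.1
      linarith [dist_triangle g.r.1 k.r.1 h.r.1]
    · have e2 : dist k.s.1 h.s.1 < ρ := h2.1
      linarith [dist_triangle g.s.1 k.s.1 h.s.1]
  refine ⟨fun t => ⟨fun ht => ?_, ?_⟩⟩
  · obtain ⟨U, hUt, hU, hg⟩ := mem_nhds_iff.1 ht
    obtain ⟨δ, h0, h1, h2⟩ := hU g hg N hN
    obtain ⟨η, hη, hηε, hη'⟩ := exists_eq_holonomy hN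
    refine ⟨min δ η, ⟨lt_min h0 hη, (min_le_right _ _).trans hηε⟩, fun k hk => hUt (h2 ?_)⟩
    obtain ⟨⟨hr, hs⟩, hkN⟩ := hk
    exact ⟨localUnstable_mono (min_le_left _ _) hs, localUnstable_mono (min_le_left _ _) hr,
      hη' _ (localUnstable_mono (min_le_right _ _) hr) _
        (localUnstable_mono (min_le_right _ _) hs) hkN⟩
  · rintro ⟨δ, ⟨h0, h1⟩, h⟩
    exact mem_of_superset ((hopen δ h1).mem_nhds
      ⟨⟨mem_localUnstable_self h0, mem_localUnstable_self h0⟩, hN⟩) h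

/-- The topology of the groupoid near `g` is the topology of `X^u(Q) × X^u(Q)` on the set of pairs
that are stably close at time `N`, for any `N` such that `g` is such a pair. -/
theorem nhds_groupoid (g : StableGroupoid Q) (hN : S.StableAt N g.r.1 g.s.1) :
    𝓝 g = comap (fun h : StableGroupoid Q => (h.r, h.s)) (𝓝 g.r ×ˢ 𝓝 g.s) ⊓
      𝓟 {h | S.StableAt N h.r.1 h.s.1} := by
  refine (nhds_groupoid_hasBasis g hN).eq_of_same_basis ?_
  refine (((g.r.nhds_hasBasis.prod_same_index g.s.nhds_hasBasis ?_).comap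
    (fun h : StableGroupoid Q => (h.r, h.s))).inf_principal _)
  intro i j hi hj
  exact ⟨min i j, ⟨lt_min hi.1 hj.1, (min_le_left _ _).trans hi.2⟩,
    fun _ hz => localUnstable_mono (min_le_left _ _) hz,
    fun _ hz => localUnstable_mono (min_le_right _ _) hz⟩

theorem tendsto_nhds_groupoid {ι : Type*} {l : Filter ι} {f : ι → StableGroupoid Q}
    {g : StableGroupoid Q} (hN : S.StableAt N g.r.1 g.s.1) :
    Tendsto f l (𝓝 g) ↔ (Tendsto (fun i => (f i).r) l (𝓝 g.r) ∧
      Tendsto (fun i => (f i).s) l (𝓝 g.s)) ∧ ∀ᶠ i in l, S.StableAt N (f i).r.1 (f i).s.1 := by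
  rw [nhds_groupoid g hN, tendsto_inf, tendsto_comap_iff, tendsto_principal, tendsto_prod_iff']
  rfl

theorem eventually_stableAt (g : StableGroupoid Q) (hN : S.StableAt N g.r.1 g.s.1) :
    ∀ᶠ h in 𝓝 g, S.StableAt N h.r.1 h.s.1 := ((tendsto_nhds_groupoid hN).1 tendsto_id).2

theorem StableGroupoid.continuous_r : Continuous (StableGroupoid.r (Q := Q)) :=
  continuous_iff_continuousAt.2 fun g =>
    ((tendsto_nhds_groupoid g.exists_stableAt.choose_spec).1 tendsto_id).1.1

theorem StableGroupoid.continuous_s : Continuous (StableGroupoid.s (Q := Q)) :=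
  continuous_iff_continuousAt.2 fun g =>
    ((tendsto_nhds_groupoid g.exists_stableAt.choose_spec).1 tendsto_id).1.2

instance : T2Space (StableGroupoid Q) :=
  T2Space.of_injective_continuous (f := fun g : StableGroupoid Q => (g.r, g.s))
    (fun _ _ h => StableGroupoid.ext (congrArg Prod.fst h) (congrArg Prod.snd h))
    (StableGroupoid.continuous_r.prodMk StableGroupoid.continuous_s)

/-- Inversion in the groupoid. -/
def StableGroupoid.inv (g : StableGroupoid Q) : StableGroupoid Q :=
  ⟨(g.1.2, g.1.1), g.2.1.symm, g.2.2.2, g.2.2.1⟩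

theorem StableGroupoid.continuous_inv : Continuous (StableGroupoid.inv (Q := Q)) := by
  refine continuous_iff_continuousAt.2 fun g => ?_
  obtain ⟨N, hN⟩ := g.exists_stableAt
  refine (tendsto_nhds_groupoid (g := g.inv) hN.symm).2
    ⟨⟨StableGroupoid.continuous_s.tendsto g, StableGroupoid.continuous_r.tendsto g⟩, ?_⟩
  filter_upwards [eventually_stableAt g hN] with h hh using hh.symm

/-- Inversion as a homeomorphism. -/
def invHomeomorph (Q : S.PeriodicSet) : StableGroupoid Q ≃ₜ StableGroupoid Q where
  toFun := StableGroupoid.inv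
  invFun := StableGroupoid.inv
  left_inv _ := rfl
  right_inv _ := rfl
  continuous_toFun := StableGroupoid.continuous_inv
  continuous_invFun := StableGroupoid.continuous_inv

/-- The map `φ × φ` as a homeomorphism of the groupoid. -/
def shiftHomeomorph (Q : S.PeriodicSet) : StableGroupoid Q ≃ₜ StableGroupoid Q where
  toFun := groupoidShift Q
  invFun g := ⟨(S.φ.symm g.1.1, S.φ.symm g.1.2), g.2.1.map_symm, g.r.unshift.2, g.s.unshift.2⟩
  left_inv g := Subtype.ext (Prod.ext (S.φ.symm_apply_apply _) (S.φ.symm_apply_apply _))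
  right_inv g := Subtype.ext (Prod.ext (S.φ.apply_symm_apply _) (S.φ.apply_symm_apply _))
  continuous_toFun := by
    refine continuous_iff_continuousAt.2 fun g => ?_
    obtain ⟨N, hN⟩ := g.exists_stableAt
    refine (tendsto_nhds_groupoid (g := groupoidShift Q g) hN.map).2
      ⟨⟨(UnstableSpace.continuous_shift.comp StableGroupoid.continuous_r).tendsto g,
        (UnstableSpace.continuous_shift.comp StableGroupoid.continuous_s).tendsto g⟩, ?_⟩
    filter_upwards [eventually_stableAt g hN] with h hh using hh.map
  continuous_invFun := by
    refine continuous_iff_continuousAt.2 fun g => ?_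
    obtain ⟨N, hN⟩ := g.exists_stableAt
    refine (tendsto_nhds_groupoid (N := N + 1) hN.map_symm).2
      ⟨⟨(UnstableSpace.continuous_unshift.comp StableGroupoid.continuous_r).tendsto g,
        (UnstableSpace.continuous_unshift.comp StableGroupoid.continuous_s).tendsto g⟩, ?_⟩
    filter_upwards [eventually_stableAt g hN] with h hh using hh.map_symm

/-- The groupoid is étale: through each `g` there is a local section `β` of pairs `(β z, z)`, which
contains all elements near `g`. -/
theorem exists_local_section (g : StableGroupoid Q) (hN : S.StableAt N g.r.1 g.s.1) :
    ∃ β : UnstableSpace Q → UnstableSpace Q, Tendsto β (𝓝 g.s) (𝓝 g.r) ∧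
      (∀ᶠ z in 𝓝 g.s, S.StableAt N (β z).1 z.1) ∧ ∀ᶠ h in 𝓝 g, h.r = β h.s := by
  have hNs : dist (S.φ^[N] g.s.1) (S.φ^[N] g.r.1) < S.εX / 2 := hN.symm.1
  have hlt := hNs.trans_le S.half_εX_le
  have hlim0 : Tendsto (fun z : UnstableSpace Q => S.φ^[N] z.1) (𝓝 g.s) (𝓝 (S.φ^[N] g.s.1)) :=
    ((S.φ.continuous.iterate N).comp UnstableSpace.continuous_val).tendsto _
  have hlim : Tendsto (fun z : UnstableSpace Q => S.bracket (S.φ^[N] z.1) (S.φ^[N] g.r.1))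
      (𝓝 g.s) (𝓝 (S.φ^[N] g.r.1)) := by
    have hop : IsOpen {p : X × X | dist p.1 p.2 < S.εX} :=
      isOpen_lt (by fun_prop) continuous_const
    have h1 := (S.continuousOn_bracket.continuousAt (hop.mem_nhds hlt)).tendsto.comp
      (hlim0.prodMk_nhds tendsto_const_nhds)
    have e : S.bracket (S.φ^[N] g.s.1) (S.φ^[N] g.r.1) = S.φ^[N] g.r.1 := hN.2
    simp only at h1
    rwa [e] at h1
  have hd1 : ∀ᶠ z in 𝓝 g.s, dist (S.φ^[N] z.1) (S.φ^[N] g.r.1) < S.εX :=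
    (hlim0.dist tendsto_const_nhds).eventually (gt_mem_nhds hlt)
  have hd2 : ∀ᶠ z in 𝓝 g.s,
      dist (S.φ^[N] z.1) (S.bracket (S.φ^[N] z.1) (S.φ^[N] g.r.1)) < S.εX / 2 :=
    (hlim0.dist hlim).eventually (gt_mem_nhds hNs)
  have hu : ∀ δ, 0 < δ → δ ≤ S.εX → ∀ᶠ z in 𝓝 g.s,
      S.holonomy g.r.1 N z.1 ∈ S.localUnstable g.r.1 δ := by
    intro δ hδ hδ'
    filter_upwards [hd1, hlim.eventually (Metric.ball_mem_nhds _ hδ)] with z hz1 hz2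
    have := bracket_mem_localUnstable hz1 (by rw [dist_comm]; exact hz2) hδ'
    have := iterate_mem_localStable' (S := S.dual) hδ' this N
    change S.φ.symm^[N] _ ∈ S.localUnstable (S.φ.symm^[N] (S.φ^[N] _)) δ at this
    rwa [iterate_symm_iterate] at this
  have hQ : ∀ᶠ z in 𝓝 g.s, S.holonomy g.r.1 N z.1 ∈ unstableSet Q := by
    filter_upwards [hu S.εX S.εX_pos le_rfl] with z hz
    exact mem_unstableSet_of_unstableEquiv g.r.2 (unstableEquiv_of_mem_localUnstable hz)
  have hβ : ∀ z : UnstableSpace Q, ∃ b : UnstableSpace Q,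
      S.holonomy g.r.1 N z.1 ∈ unstableSet Q → b.1 = S.holonomy g.r.1 N z.1 := fun z => by
    by_cases h : S.holonomy g.r.1 N z.1 ∈ unstableSet Q
    · exact ⟨⟨_, h⟩, fun _ => rfl⟩
    · exact ⟨g.r, fun h' => absurd h' h⟩
  choose β hβ using hβ
  refine ⟨β, (UnstableSpace.nhds_hasBasis g.r).tendsto_right_iff.2 fun δ hδ => ?_, ?_, ?_⟩
  · filter_upwards [hQ, hu δ hδ.1 hδ.2] with z hz hz'
    exact (hβ z hz).symm ▸ hz'
  · filter_upwards [hQ, hd1, hd2] with z hz hz1 hz2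
    rw [hβ z hz]
    refine StableAt.symm ?_
    unfold StableAt
    rw [iterate_holonomy]
    exact bracket_mem_localStable hz1 hz2 S.half_εX_le
  · obtain ⟨η, hη, hηε, hη'⟩ := exists_eq_holonomy hN
    filter_upwards [(nhds_groupoid_hasBasis g hN).mem_of_mem ⟨hη, hηε⟩] with h hh
    have e := hη' _ hh.1.1 _ hh.1.2 hh.2
    exact Subtype.ext (e.trans (hβ h.s (e ▸ h.r.2)).symm)

/-- A compact set of the groupoid is covered by finitely many sets on which both the range and the
source map are injective. -/
theorem exists_finite_coloring {K : Set (StableGroupoid Q)} (hK : IsCompact K) :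
    ∃ (t : Finset (StableGroupoid Q)) (c : StableGroupoid Q → StableGroupoid Q),
      (∀ g ∈ K, c g ∈ t) ∧ ∀ g ∈ K, ∀ h ∈ K, c g = c h → (g.r = h.r ∨ g.s = h.s) → g = h := by
  have hs : ∀ g : StableGroupoid Q, ∃ U ∈ 𝓝 g, ∀ h ∈ U, ∀ k ∈ U, h.s = k.s → h = k := by
    intro g
    obtain ⟨N, hN⟩ := g.exists_stableAt
    obtain ⟨β, -, -, h⟩ := exists_local_section g hN
    exact ⟨_, h, fun a ha b hb hab => StableGroupoid.ext (by
      rw [show a.r = β a.s from ha, hab]; exact (show b.r = β b.s from hb).symm) hab⟩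
  have hrs : ∀ g : StableGroupoid Q, ∃ U ∈ 𝓝 g, ∀ h ∈ U, ∀ k ∈ U,
      (h.r = k.r ∨ h.s = k.s) → h = k := by
    intro g
    obtain ⟨U, hU, h⟩ := hs g
    obtain ⟨V, hV, h'⟩ := hs g.inv
    refine ⟨U ∩ StableGroupoid.inv ⁻¹' V,
      inter_mem hU (StableGroupoid.continuous_inv.tendsto g hV), fun a ha b hb hab => ?_⟩
    rcases hab with hab | hab
    · exact congrArg StableGroupoid.inv (h' _ ha.2 _ hb.2 hab)
    · exact h _ ha.1 _ hb.1 hab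
  choose U hU hinj using hrs
  obtain ⟨t, -, ht⟩ := hK.elim_nhds_subcover U fun g _ => hU g
  have hc : ∀ g : StableGroupoid Q, ∃ k, g ∈ K → k ∈ t ∧ g ∈ U k := fun g => by
    by_cases hg : g ∈ K
    · have := ht hg
      simp only [Set.mem_iUnion, exists_prop] at this
      exact this.imp fun k hk _ => hk
    · exact ⟨g, fun h => absurd h hg⟩
  choose c hc using hc
  refine ⟨t, c, fun g hg => (hc g hg).1, fun g hg h hh hgh => ?_⟩
  exact hinj (c g) g (hc g hg).2 h (hgh ▸ (hc h hh).2)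

end SmaleSpace

namespace SmaleSpace

variable {X : Type*} [MetricSpace X] [CompactSpace X] {S : SmaleSpace X} {P Q : S.PeriodicSet}
  {N : ℕ} {f f' : StableGroupoid Q → ℂ}

/-! ### Compactly supported functions on the groupoid -/

theorem kernel_apply (f : StableGroupoid Q → ℂ) (g : StableGroupoid Q) :
    kernel f g.r.1 g.s.1 = f g := dif_pos g.2

theorem kernel_eq (f : StableGroupoid Q → ℂ) {x y : X} (h : S.StableEquiv x y)
    (hx : x ∈ unstableSet Q) (hy : y ∈ unstableSet Q) :
    kernel f x y = f ⟨(x, y), h, hx, hy⟩ := dif_pos ⟨h, hx, hy⟩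

theorem exists_of_kernel_ne_zero {x y : X} (h : kernel f x y ≠ 0) :
    ∃ g : StableGroupoid Q, g.r.1 = x ∧ g.s.1 = y ∧ f g = kernel f x y := by
  by_cases hxy : S.StableEquiv x y ∧ x ∈ unstableSet Q ∧ y ∈ unstableSet Q
  · exact ⟨⟨(x, y), hxy⟩, rfl, rfl, (kernel_apply f ⟨(x, y), hxy⟩).symm⟩
  · exact absurd (dif_neg hxy) h

/-- The matrix entries of a continuous function depend continuously on pairs of points that are
stably close at a fixed time. -/
theorem tendsto_kernel (hf : Continuous f) {ι : Type*} {l : Filter ι}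
    {x y : ι → UnstableSpace Q} {x₀ y₀ : UnstableSpace Q} (hx : Tendsto x l (𝓝 x₀))
    (hy : Tendsto y l (𝓝 y₀)) (h0 : S.StableAt N x₀.1 y₀.1)
    (h : ∀ᶠ i in l, S.StableAt N (x i).1 (y i).1) :
    Tendsto (fun i => kernel f (x i).1 (y i).1) l (𝓝 (kernel f x₀.1 y₀.1)) := by
  have hF : ∀ i, ∃ g : StableGroupoid Q, S.StableAt N (x i).1 (y i).1 → g.r = x i ∧ g.s = y i :=
    fun i => by
      by_cases hi : S.StableAt N (x i).1 (y i).1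
      · exact ⟨StableGroupoid.mk _ _ hi, fun _ => ⟨rfl, rfl⟩⟩
      · exact ⟨StableGroupoid.mk _ _ h0, fun h' => absurd h' hi⟩
  choose F hF using hF
  have hlim : Tendsto F l (𝓝 (StableGroupoid.mk x₀ y₀ h0)) := by
    refine (tendsto_nhds_groupoid (g := StableGroupoid.mk x₀ y₀ h0) h0).2 ⟨⟨?_, ?_⟩, ?_⟩
    · exact hx.congr' (h.mono fun i hi => (hF i hi).1.symm)
    · exact hy.congr' (h.mono fun i hi => (hF i hi).2.symm)
    · filter_upwards [h] with i hi
      rw [(hF i hi).1, (hF i hi).2]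
      exact hi
  have := (hf.tendsto _).comp hlim
  rw [← kernel_apply f (StableGroupoid.mk x₀ y₀ h0)] at this
  refine this.congr' ?_
  filter_upwards [h] with i hi
  rw [Function.comp_apply, ← kernel_apply f (F i), (hF i hi).1, (hF i hi).2]

/-- The convolution product of functions on the groupoid. The kernels vanish off the groupoid, and
the sum is finite if one of the functions has compact support. -/
noncomputable def convolve (f f' : StableGroupoid Q → ℂ) (g : StableGroupoid Q) : ℂ :=
  ∑' y : X, kernel f g.r.1 y * kernel f' y g.s.1

/-- A convolution is continuous: near `(x₀, z₀)` it is the finite sum of the terms in which `y`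
runs over the local sections through the points `(y, z₀)` of the support of `f'`. -/
theorem continuous_convolve (hf : Continuous f) (hf' : Continuous f')
    (hc : HasCompactSupport f') : Continuous (convolve f f') := by
  classical
  refine continuous_iff_continuousAt.2 fun g₀ => ?_
  obtain ⟨t, c, hct, hcinj⟩ := exists_finite_coloring hc.isCompact
  set F : Set (StableGroupoid Q) := {k | k ∈ tsupport f' ∧ k.s = g₀.s} with hFdef
  have hFfin : F.Finite :=
    Set.Finite.of_injOn (f := c) (t := t) (fun k hk => hct k hk.1)
      (fun k hk k' hk' h => hcinj k hk.1 k' hk'.1 h (Or.inr (hk.2.trans hk'.2.symm)))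
      t.finite_toSet
  obtain ⟨m, hm⟩ := S.exists_stableAt_trans
  choose N hN using fun k : StableGroupoid Q => k.exists_stableAt
  choose β hβlim hβst hβ using fun k : StableGroupoid Q => exists_local_section k (hN k)
  have hs : Tendsto StableGroupoid.s (𝓝 g₀) (𝓝 g₀.s) := StableGroupoid.continuous_s.tendsto g₀
  have hr : Tendsto StableGroupoid.r (𝓝 g₀) (𝓝 g₀.r) := StableGroupoid.continuous_r.tendsto g₀
  -- elements of the support with source near that of `g₀` lie on one of the sections
  have hcover : ∀ᶠ z in 𝓝 g₀.s, ∀ k ∈ tsupport f', k.s = z → ∃ k₀ ∈ F, k.r = β k₀ z := by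
    refine hc.isCompact.eventually_forall_of_forall_eventually fun k hk => ?_
    by_cases hks : k.s = g₀.s
    · have h1 : Tendsto (fun p : UnstableSpace Q × StableGroupoid Q => p.2) (𝓝 (g₀.s, k)) (𝓝 k) :=
        continuous_snd.tendsto _
      filter_upwards [h1.eventually (hβ k)] with p hp hpz
      exact ⟨k, ⟨hk, hks⟩, hpz ▸ hp⟩
    · have h1 : Tendsto (fun p : UnstableSpace Q × StableGroupoid Q => (p.2.s, p.1))
          (𝓝 (g₀.s, k)) (𝓝 (k.s, g₀.s)) :=
        ((StableGroupoid.continuous_s.comp continuous_snd).prodMk continuous_fst).tendsto _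
      filter_upwards [h1.eventually (isOpen_ne_fun continuous_fst continuous_snd |>.mem_nhds hks)]
        with p hp hpz
      exact absurd hpz hp
  have hinj : ∀ᶠ z in 𝓝 g₀.s, ∀ k ∈ F, ∀ k' ∈ F, β k z = β k' z → k = k' := by
    refine (eventually_all_finite hFfin).2 fun k hk => (eventually_all_finite hFfin).2
      fun k' hk' => ?_
    by_cases hkk : k = k'
    · exact Eventually.of_forall fun _ _ => hkk
    · have hne : k.r ≠ k'.r := fun h => hkk (StableGroupoid.ext h (hk.2.trans hk'.2.symm))
      have h1 : Tendsto (β k) (𝓝 g₀.s) (𝓝 k.r) := hk.2 ▸ hβlim k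
      have h2 : Tendsto (β k') (𝓝 g₀.s) (𝓝 k'.r) := hk'.2 ▸ hβlim k'
      filter_upwards [(h1.prodMk_nhds h2).eventually
        (isOpen_ne_fun continuous_fst continuous_snd |>.mem_nhds hne)] with z hz hz'
      exact absurd hz' hz
  have hsum : ∀ᶠ g in 𝓝 g₀, convolve f f' g = ∑ k ∈ hFfin.toFinset,
      kernel f g.r.1 (β k g.s).1 * kernel f' (β k g.s).1 g.s.1 := by
    filter_upwards [hs.eventually hcover, hs.eventually hinj] with g hg hg'
    unfold convolve
    rw [tsum_eq_sum (s := hFfin.toFinset.image fun k => (β k g.s).1), Finset.sum_image]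
    · intro k hk k' hk' h
      exact hg' k (hFfin.mem_toFinset.1 hk) k' (hFfin.mem_toFinset.1 hk') (Subtype.ext h)
    · intro y hy
      by_contra hne
      obtain ⟨k, hkr, hks, hk⟩ := exists_of_kernel_ne_zero (right_ne_zero_of_mul hne)
      have hkt : k ∈ tsupport f' := by
        refine subset_tsupport _ ?_
        rw [Function.mem_support, hk]
        exact right_ne_zero_of_mul hne
      obtain ⟨k₀, hk₀, e⟩ := hg k hkt (Subtype.ext hks)
      exact hy (Finset.mem_image.2 ⟨k₀, hFfin.mem_toFinset.2 hk₀, by rw [← e, hkr]⟩)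
  have hterm : ∀ k ∈ hFfin.toFinset, Tendsto (fun g : StableGroupoid Q =>
      kernel f g.r.1 (β k g.s).1 * kernel f' (β k g.s).1 g.s.1) (𝓝 g₀)
      (𝓝 (kernel f g₀.r.1 (β k g₀.s).1 * kernel f' (β k g₀.s).1 g₀.s.1)) := by
    intro k hk
    obtain ⟨-, hks⟩ := hFfin.mem_toFinset.1 hk
    have hk0 : β k g₀.s = k.r := by rw [← hks]; exact ((hβ k).self_of_nhds).symm
    have h1 : Tendsto (fun g : StableGroupoid Q => β k g.s) (𝓝 g₀) (𝓝 (β k g₀.s)) := by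
      rw [hk0]
      exact (hks ▸ hβlim k : Tendsto (β k) (𝓝 g₀.s) (𝓝 k.r)).comp hs
    have h2 : ∀ᶠ g : StableGroupoid Q in 𝓝 g₀, S.StableAt (N k) (β k g.s).1 g.s.1 :=
      hs.eventually (hks ▸ hβst k)
    have h3 : ∀ᶠ g : StableGroupoid Q in 𝓝 g₀,
        S.StableAt (max (N k) (N g₀) + m) g.r.1 (β k g.s).1 := by
      filter_upwards [h2, eventually_stableAt g₀ (hN g₀)] with g hg hg'
      exact hm _ _ _ _ (hg'.mono (le_max_right _ _)) (hg.mono (le_max_left _ _)).symm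
    exact (tendsto_kernel hf hr h1 h3.self_of_nhds h3).mul
      (tendsto_kernel hf' h1 hs h2.self_of_nhds h2)
  have := tendsto_finsetSum _ hterm
  rw [← hsum.self_of_nhds] at this
  exact this.congr' (hsum.mono fun g hg => hg.symm)

theorem hasCompactSupport_convolve (hc : HasCompactSupport f) (hc' : HasCompactSupport f') :
    HasCompactSupport (convolve f f') := by
  have hm : ∀ p : StableGroupoid Q × StableGroupoid Q, ∃ g : StableGroupoid Q,
      p.1.s = p.2.r → g.r = p.1.r ∧ g.s = p.2.s := fun p => by
    by_cases h : p.1.s = p.2.r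
    · refine ⟨⟨(p.1.1.1, p.2.1.2), p.1.2.1.trans ?_, p.1.2.2.1, p.2.2.2.2⟩, fun _ => ⟨rfl, rfl⟩⟩
      rw [show p.1.1.2 = p.2.1.1 from congrArg Subtype.val h]
      exact p.2.2.1
    · exact ⟨p.1, fun h' => absurd h' h⟩
  choose μ hμ using hm
  obtain ⟨m, hm⟩ := S.exists_stableAt_trans
  set E : Set (StableGroupoid Q × StableGroupoid Q) := {p | p.1.s = p.2.r} with hE
  have hcont : ContinuousOn μ E := by
    intro p hp
    obtain ⟨N₁, hN₁⟩ := p.1.exists_stableAt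
    obtain ⟨N₂, hN₂⟩ := p.2.exists_stableAt
    have h1 : Tendsto (fun q : StableGroupoid Q × StableGroupoid Q => q.1) (𝓝[E] p) (𝓝 p.1) :=
      (continuous_fst.tendsto p).mono_left nhdsWithin_le_nhds
    have h2 : Tendsto (fun q : StableGroupoid Q × StableGroupoid Q => q.2) (𝓝[E] p) (𝓝 p.2) :=
      (continuous_snd.tendsto p).mono_left nhdsWithin_le_nhds
    have hst : ∀ᶠ q in 𝓝[E] p, S.StableAt (max N₁ N₂ + m) (μ q).r.1 (μ q).s.1 := by
      filter_upwards [h1.eventually (eventually_stableAt _ hN₁),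
        h2.eventually (eventually_stableAt _ hN₂), self_mem_nhdsWithin] with q hq1 hq2 hq
      rw [(hμ q hq).1, (hμ q hq).2]
      have hq' : q.1.s = q.2.r := hq
      rw [hq'] at hq1
      exact hm _ _ _ _ (hq1.mono (le_max_left _ _)) (hq2.mono (le_max_right _ _))
    refine (tendsto_nhds_groupoid (hst.self_of_nhdsWithin hp)).2 ⟨⟨?_, ?_⟩, hst⟩
    · rw [(hμ p hp).1]
      refine ((StableGroupoid.continuous_r.tendsto _).comp h1).congr' ?_
      filter_upwards [self_mem_nhdsWithin] with q hq using (hμ q hq).1.symm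
    · rw [(hμ p hp).2]
      refine ((StableGroupoid.continuous_s.tendsto _).comp h2).congr' ?_
      filter_upwards [self_mem_nhdsWithin] with q hq using (hμ q hq).2.symm
  have hEcl : IsClosed E := isClosed_eq (StableGroupoid.continuous_s.comp continuous_fst)
    (StableGroupoid.continuous_r.comp continuous_snd)
  have hK : IsCompact ((tsupport f ×ˢ tsupport f') ∩ E) :=
    (hc.isCompact.prod hc'.isCompact).inter_right hEcl
  refine HasCompactSupport.intro (hK.image_of_continuousOn (hcont.mono Set.inter_subset_right))
    fun g hg => ?_
  unfold convolve
  rw [tsum_congr (g := fun _ => (0 : ℂ)), tsum_zero]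
  intro y
  by_contra hne
  obtain ⟨k, hkr, hks, hk⟩ := exists_of_kernel_ne_zero (left_ne_zero_of_mul hne)
  obtain ⟨k', hkr', hks', hk'⟩ := exists_of_kernel_ne_zero (right_ne_zero_of_mul hne)
  have hkE : (k, k') ∈ E := Subtype.ext (hks.trans hkr'.symm)
  refine hg ⟨(k, k'), ⟨⟨subset_tsupport _ ?_, subset_tsupport _ ?_⟩, hkE⟩, ?_⟩
  · rw [Function.mem_support, hk]; exact left_ne_zero_of_mul hne
  · rw [Function.mem_support, hk']; exact right_ne_zero_of_mul hne
  · exact StableGroupoid.ext ((hμ _ hkE).1.trans (Subtype.ext hkr))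
      ((hμ _ hkE).2.trans (Subtype.ext hks'))

/-- The convolution product on `C_c(G)`. -/
noncomputable def convolveCc (f f' : C_c(StableGroupoid Q, ℂ)) : C_c(StableGroupoid Q, ℂ) where
  toFun := convolve f f'
  continuous_toFun := continuous_convolve f.continuous f'.continuous f'.hasCompactSupport
  hasCompactSupport' := hasCompactSupport_convolve f.hasCompactSupport f'.hasCompactSupport

/-- The involution on `C_c(G)`. -/
noncomputable def involutionCc (f : C_c(StableGroupoid Q, ℂ)) : C_c(StableGroupoid Q, ℂ) where
  toFun g := star (f g.inv)
  continuous_toFun := by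
    have h1 := f.continuous
    have h2 := StableGroupoid.continuous_inv (Q := Q)
    exact (h1.comp h2).star
  hasCompactSupport' := by
    have h := (f.hasCompactSupport.comp_homeomorph (invHomeomorph Q)).comp_left (g := star)
      (star_zero ℂ)
    exact h

/-- The function `f ∘ (φ × φ)` on the groupoid. -/
noncomputable def pullbackCc (f : C_c(StableGroupoid Q, ℂ)) : C_c(StableGroupoid Q, ℂ) where
  toFun g := f (shiftHomeomorph Q g)
  continuous_toFun := f.continuous.comp (shiftHomeomorph Q).continuous
  hasCompactSupport' := f.hasCompactSupport.comp_homeomorph (shiftHomeomorph Q)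

/-- The function `α(f) = f ∘ (φ × φ)⁻¹` on the groupoid. -/
noncomputable def alphaCc (f : C_c(StableGroupoid Q, ℂ)) : C_c(StableGroupoid Q, ℂ) where
  toFun g := f ((shiftHomeomorph Q).symm g)
  continuous_toFun := f.continuous.comp (shiftHomeomorph Q).symm.continuous
  hasCompactSupport' := f.hasCompactSupport.comp_homeomorph (shiftHomeomorph Q).symm

open Classical in
/-- A function on `X^u(Q)` as a function on the groupoid, supported on the unit space. -/
noncomputable def diagonalCc (a : C_c(UnstableSpace Q, ℂ)) : C_c(StableGroupoid Q, ℂ) where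
  toFun g := if g.r = g.s then a g.r else 0
  continuous_toFun := by
    refine continuous_iff_continuousAt.2 fun g => ?_
    by_cases h : g.r = g.s
    · have h0 : S.StableAt 0 g.r.1 g.s.1 := by
        rw [h]; exact mem_localStable_self (half_pos S.εX_pos)
      have heq : ∀ᶠ k in 𝓝 g, k.r = k.s := by
        filter_upwards [(nhds_groupoid_hasBasis g h0).mem_of_mem
          ⟨half_pos S.εX_pos, S.half_εX_le⟩] with k hk
        obtain ⟨⟨hr, hs⟩, hst⟩ := hk
        rw [← h] at hs
        have hst' := localStable_mono S.half_εX_le hst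
        exact Subtype.ext (eq_of_mem_localStable_of_mem_localUnstable hst'
          (localUnstable_trans (localUnstable_mono S.half_εX_le
            (localUnstable_symm S.half_εX_le hr)) (localUnstable_mono S.half_εX_le hs)
            hst'.1 le_rfl))
      have hlim := (a.continuous.comp StableGroupoid.continuous_r).tendsto g
      unfold ContinuousAt
      simp only [if_pos h]
      exact hlim.congr' (heq.mono fun k hk => (if_pos hk).symm)
    · unfold ContinuousAt
      simp only [if_neg h]
      have hne : ∀ᶠ k : StableGroupoid Q in 𝓝 g, k.r ≠ k.s :=
        (isOpen_ne_fun StableGroupoid.continuous_r StableGroupoid.continuous_s).mem_nhds h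
      exact tendsto_const_nhds.congr' (hne.mono fun k hk => (if_neg hk).symm)
  hasCompactSupport' := by
    set e : UnstableSpace Q → StableGroupoid Q :=
      fun x => ⟨(x.1, x.1), StableEquiv.refl _, x.2, x.2⟩
    have he : Continuous e := by
      refine continuous_iff_continuousAt.2 fun x => ?_
      have h0 : ∀ y : UnstableSpace Q, S.StableAt 0 y.1 y.1 := fun y =>
        mem_localStable_self (half_pos S.εX_pos)
      exact (tendsto_nhds_groupoid (g := e x) (h0 x)).2
        ⟨⟨tendsto_id, tendsto_id⟩, Eventually.of_forall h0⟩
    refine HasCompactSupport.intro (a.hasCompactSupport.isCompact.image he) fun g hg => ?_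
    by_cases h : g.r = g.s
    · rw [if_pos h]
      by_contra hne
      exact hg ⟨g.r, subset_tsupport _ hne, StableGroupoid.ext rfl h⟩
    · exact if_neg h

/-- There are enough functions in `C_c(X^u(Q))` to see every point. -/
theorem exists_unstableSpace_apply_eq_one (x : UnstableSpace Q) :
    ∃ a : C_c(UnstableSpace Q, ℂ), a x = 1 := by
  obtain ⟨f, hf, -, hc, -⟩ := exists_continuous_one_zero_of_isCompact
    (isCompact_singleton (x := x)) (isClosed_empty) (Set.disjoint_empty _)
  refine ⟨⟨⟨fun y => (f y : ℂ), by fun_prop⟩,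
    hc.comp_left (g := fun r : ℝ => (r : ℂ)) (by simp)⟩, ?_⟩
  have : f x = 1 := hf rfl
  change ((f x : ℝ) : ℂ) = 1
  rw [this, Complex.ofReal_one]

end SmaleSpace

/-! ### Operators on `ℓ²` given by matrices -/

section Matrices

variable {ι : Type*}

open Classical in
/-- The basis vector `δ_x` of `ℓ²(ι)`. -/
noncomputable def basisVec (x : ι) : lp (fun _ : ι => ℂ) 2 := lp.single 2 x (1 : ℂ)

open Classical in
theorem basisVec_apply (x y : ι) : basisVec x y = if y = x then 1 else 0 := by
  rw [basisVec, lp.single_apply, Pi.single_apply]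

theorem basisVec_apply_self (x : ι) : basisVec x x = 1 := by simp [basisVec_apply]

theorem basisVec_apply_ne {x y : ι} (h : y ≠ x) : basisVec x y = 0 := by simp [basisVec_apply, h]

theorem norm_basisVec (x : ι) : ‖basisVec x‖ = 1 := by
  classical
  rw [basisVec, lp.norm_single (by norm_num), norm_one]

theorem hasSum_basisVec (ξ : lp (fun _ : ι => ℂ) 2) :
    HasSum (fun y => ξ y • basisVec y) ξ := by
  classical
  convert lp.hasSum_single (by norm_num) ξ using 2 with y
  rw [basisVec, ← lp.single_smul, smul_eq_mul, mul_one]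

theorem inner_basisVec (ξ : lp (fun _ : ι => ℂ) 2) (x : ι) : inner ℂ (basisVec x) ξ = ξ x := by
  classical
  rw [basisVec, lp.inner_single_left]
  simp

/-- The standard Hilbert basis of `ℓ²(ι)`. -/
noncomputable def stdHilbertBasis (ι : Type*) : HilbertBasis ι ℂ (lp (fun _ : ι => ℂ) 2) :=
  HilbertBasis.ofRepr (LinearIsometryEquiv.refl ℂ _)

theorem stdHilbertBasis_apply (x : ι) : stdHilbertBasis ι x = basisVec x := by
  classical
  exact (HilbertBasis.repr_symm_single (stdHilbertBasis ι) x).symm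

theorem separableSpace_lp [Countable ι] :
    TopologicalSpace.SeparableSpace (lp (fun _ : ι => ℂ) 2) := by
  have h1 : TopologicalSpace.IsSeparable (Set.range (stdHilbertBasis ι)) :=
    (Set.countable_range _).isSeparable
  have h2 := (h1.span (R := ℂ)).closure
  rw [← Submodule.topologicalClosure_coe, (stdHilbertBasis ι).dense_span, Submodule.top_coe] at h2
  exact TopologicalSpace.isSeparable_univ_iff.1 h2

variable {T T' : lp (fun _ : ι => ℂ) 2 →L[ℂ] lp (fun _ : ι => ℂ) 2} {k k' : ι → ι → ℂ}

/-- The bounded operator `T` has the matrix `k`. -/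
def HasMatrix (T : lp (fun _ : ι => ℂ) 2 →L[ℂ] lp (fun _ : ι => ℂ) 2) (k : ι → ι → ℂ) : Prop :=
  ∀ x y, T (basisVec y) x = k x y

theorem HasMatrix.hasSum (h : HasMatrix T k) (ξ : lp (fun _ : ι => ℂ) 2) (x : ι) :
    HasSum (fun y => k x y * ξ y) (T ξ x) := by
  have h1 := (hasSum_basisVec ξ).mapL ((lp.evalCLM ℂ (fun _ : ι => ℂ) 2 x).comp T)
  refine h1.congr_fun fun y => ?_
  rw [map_smul, smul_eq_mul, mul_comm, ← h x y]
  rfl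

theorem HasMatrix.of_hasSum
    (h : ∀ (ξ : lp (fun _ : ι => ℂ) 2) x, HasSum (fun y => k x y * ξ y) (T ξ x)) :
    HasMatrix T k := fun x y => by
  refine (h (basisVec y) x).unique ?_
  have := hasSum_single (f := fun z => k x z * basisVec y z) y fun z hz => by
    rw [basisVec_apply_ne hz, mul_zero]
  simpa [basisVec_apply_self] using this

theorem HasMatrix.unique (h : HasMatrix T k) (h' : HasMatrix T' k) : T = T' := by
  ext ξ x
  exact (h.hasSum ξ x).unique (h'.hasSum ξ x)

theorem HasMatrix.mul (h : HasMatrix T k) (h' : HasMatrix T' k') :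
    HasMatrix (T * T') fun x z => ∑' y, k x y * k' y z := fun x z => by
  rw [mul_apply_eq_comp, ← (h.hasSum _ x).tsum_eq]
  exact tsum_congr fun y => by rw [h']

theorem HasMatrix.star (h : HasMatrix T k) : HasMatrix (star T) fun x y => star (k y x) :=
  fun x y => by
    change _ = Star.star (k y x)
    rw [← h y x, ← inner_basisVec, ContinuousLinearMap.star_eq_adjoint,
      ContinuousLinearMap.adjoint_inner_right, ← inner_basisVec (T _), ← inner_conj_symm]
    rfl

theorem HasMatrix.sum {κ : Type*} {s : Finset κ}
    {T : κ → lp (fun _ : ι => ℂ) 2 →L[ℂ] lp (fun _ : ι => ℂ) 2} {k : κ → ι → ι → ℂ}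
    (h : ∀ i ∈ s, HasMatrix (T i) (k i)) :
    HasMatrix (∑ i ∈ s, T i) fun x y => ∑ i ∈ s, k i x y := fun x y => by
  rw [sum_apply, lp.coeFn_sum, Finset.sum_apply]
  exact Finset.sum_congr rfl fun i hi => h i hi x y

/-- A bounded matrix with at most one nonzero entry in each row and each column defines a bounded
operator. -/
theorem exists_hasMatrix_of_injective {C : ℝ} (hC : 0 ≤ C) (hk : ∀ x y, ‖k x y‖ ≤ C)
    (hrow : ∀ x y y', k x y ≠ 0 → k x y' ≠ 0 → y = y')
    (hcol : ∀ x x' y, k x y ≠ 0 → k x' y ≠ 0 → x = x') :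
    ∃ T, HasMatrix T k ∧ ‖T‖ ≤ C := by
  classical
  have hb : ∀ x, ∃ y, ∀ z, k x z ≠ 0 → z = y := fun x => by
    by_cases h : ∃ y, k x y ≠ 0
    · exact ⟨h.choose, fun z hz => hrow x _ _ hz h.choose_spec⟩
    · exact ⟨x, fun z hz => absurd ⟨z, hz⟩ h⟩
  choose b hb using hb
  have hp : 0 < (2 : ℝ≥0∞).toReal := by norm_num
  have hbound : ∀ (ξ : lp (fun _ : ι => ℂ) 2) (s : Finset ι),
      ∑ x ∈ s, ‖k x (b x) * ξ (b x)‖ ^ (2 : ℝ≥0∞).toReal ≤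
        (C * ‖ξ‖) ^ (2 : ℝ≥0∞).toReal := by
    intro ξ s
    have hinj : Set.InjOn b (s.filter fun x => k x (b x) ≠ 0) := by
      intro x hx x' hx' h
      have h1 := (Finset.mem_filter.1 hx).2
      have h2 := (Finset.mem_filter.1 hx').2
      rw [← h] at h2
      exact hcol _ _ _ h1 h2
    calc ∑ x ∈ s, ‖k x (b x) * ξ (b x)‖ ^ (2 : ℝ≥0∞).toReal
        = ∑ x ∈ s.filter fun x => k x (b x) ≠ 0, ‖k x (b x) * ξ (b x)‖ ^ (2 : ℝ≥0∞).toReal := by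
          refine (Finset.sum_filter_of_ne (p := fun x => k x (b x) ≠ 0) fun x _ hx h => hx ?_).symm
          rw [h, zero_mul, norm_zero, Real.zero_rpow hp.ne']
      _ ≤ ∑ x ∈ s.filter fun x => k x (b x) ≠ 0, C ^ (2 : ℝ≥0∞).toReal *
            ‖ξ (b x)‖ ^ (2 : ℝ≥0∞).toReal := by
          refine Finset.sum_le_sum fun x _ => ?_
          rw [← Real.mul_rpow hC (norm_nonneg _), norm_mul]
          exact Real.rpow_le_rpow (by positivity)
            (mul_le_mul_of_nonneg_right (hk _ _) (norm_nonneg _)) hp.le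
      _ = C ^ (2 : ℝ≥0∞).toReal * ∑ y ∈ (s.filter fun x => k x (b x) ≠ 0).image b,
            ‖ξ y‖ ^ (2 : ℝ≥0∞).toReal := by
          rw [Finset.sum_image hinj, Finset.mul_sum]
      _ ≤ C ^ (2 : ℝ≥0∞).toReal * ‖ξ‖ ^ (2 : ℝ≥0∞).toReal :=
          mul_le_mul_of_nonneg_left (lp.sum_rpow_le_norm_rpow hp ξ _) (by positivity)
      _ = (C * ‖ξ‖) ^ (2 : ℝ≥0∞).toReal := (Real.mul_rpow hC (norm_nonneg _)).symm
  let L : lp (fun _ : ι => ℂ) 2 →ₗ[ℂ] lp (fun _ : ι => ℂ) 2 :=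
    { toFun := fun ξ => ⟨fun x => k x (b x) * ξ (b x), memℓp_gen' (hbound ξ)⟩
      map_add' := fun ξ η => by ext x; exact mul_add _ _ _
      map_smul' := fun c ξ => by
        ext x
        exact mul_left_comm _ _ _ }
  have hL : ∀ ξ, ‖L ξ‖ ≤ C * ‖ξ‖ := fun ξ =>
    lp.norm_le_of_forall_sum_le hp (by positivity) (hbound ξ)
  refine ⟨L.mkContinuous C hL, fun x y => ?_, L.mkContinuous_norm_le hC _⟩
  change k x (b x) * basisVec y (b x) = k x y
  by_cases h : b x = y
  · rw [h, basisVec_apply_self, mul_one]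
  · rw [basisVec_apply_ne h, mul_zero]
    by_contra hne
    exact h (hb x y (Ne.symm hne)).symm

/-- A bounded matrix whose nonzero entries can be coloured with finitely many colours, such that no
colour occurs twice in a row or a column, defines a bounded operator. -/
theorem exists_hasMatrix {κ : Type*} (t : Finset κ) (c : ι → ι → κ) {C : ℝ} (hC : 0 ≤ C)
    (hk : ∀ x y, ‖k x y‖ ≤ C) (hct : ∀ x y, k x y ≠ 0 → c x y ∈ t)
    (hrow : ∀ x y y', k x y ≠ 0 → k x y' ≠ 0 → c x y = c x y' → y = y')
    (hcol : ∀ x x' y, k x y ≠ 0 → k x' y ≠ 0 → c x y = c x' y → x = x') :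
    ∃ T, HasMatrix T k := by
  classical
  have hi : ∀ i : κ, ∃ T, HasMatrix T fun x y => if c x y = i then k x y else 0 := fun i => by
    obtain ⟨T, hT, -⟩ := exists_hasMatrix_of_injective
      (k := fun x y => if c x y = i then k x y else 0) hC
      (fun x y => by split_ifs <;> simp [hk, hC])
      (fun x y y' h h' => by
        rw [ne_eq, ite_eq_right_iff, Classical.not_imp] at h h'
        exact hrow x y y' h.2 h'.2 (h.1.trans h'.1.symm))
      (fun x x' y h h' => by
        rw [ne_eq, ite_eq_right_iff, Classical.not_imp] at h h'
        exact hcol x x' y h.2 h'.2 (h.1.trans h'.1.symm))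
    exact ⟨T, hT⟩
  choose T hT using hi
  refine ⟨∑ i ∈ t, T i, fun x y => ?_⟩
  rw [HasMatrix.sum (fun i _ => hT i) x y]
  simp only [Finset.sum_ite_eq]
  split_ifs with h
  · rfl
  · by_contra hne
    exact h (hct x y (Ne.symm hne))

end Matrices

/-! ### Diagonal operators on `ℓ²` -/

section Diagonal

variable {ι : Type*} {T T' : lp (fun _ : ι => ℂ) 2 →L[ℂ] lp (fun _ : ι => ℂ) 2} {c c' : ι → ℂ}

/-- The bounded operator `T` is multiplication by the function `c`. -/
def IsDiag (T : lp (fun _ : ι => ℂ) 2 →L[ℂ] lp (fun _ : ι => ℂ) 2) (c : ι → ℂ) : Prop :=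
  ∀ ξ x, T ξ x = c x * ξ x

open Classical in
theorem IsDiag.hasMatrix (h : IsDiag T c) : HasMatrix T fun x y => if x = y then c x else 0 :=
  fun x y => by
    rw [h, basisVec_apply]
    simp

theorem IsDiag.unique (h : IsDiag T c) (h' : IsDiag T' c) : T = T' :=
  h.hasMatrix.unique h'.hasMatrix

theorem IsDiag.mul (h : IsDiag T c) (h' : IsDiag T' c') :
    IsDiag (T * T') fun x => c x * c' x := fun ξ x => by
  rw [mul_apply_eq_comp, h, h', mul_assoc]

theorem IsDiag.star (h : IsDiag T c) : IsDiag (star T) fun x => star (c x) := fun ξ x => by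
  classical
  refine (h.hasMatrix.star.hasSum ξ x).unique ?_
  have := hasSum_single (f := fun y => (Star.star (if y = x then c y else 0) : ℂ) * ξ y) x
    fun y hy => by simp [hy]
  simpa using this

theorem IsDiag.apply_basisVec (h : IsDiag T c) (x : ι) : T (basisVec x) = c x • basisVec x := by
  ext y
  rw [h]
  by_cases hy : y = x
  · rw [hy]; rfl
  · rw [basisVec_apply_ne hy, mul_zero]
    change 0 = c x * basisVec x y
    rw [basisVec_apply_ne hy, mul_zero]

theorem exists_isDiag {C : ℝ} (hc : ∀ x, ‖c x‖ ≤ C) :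
    ∃ T, IsDiag T c ∧ (0 ≤ C → ‖T‖ ≤ C) := by
  classical
  rcases isEmpty_or_nonempty ι with hι | ⟨⟨x₀⟩⟩
  · exact ⟨0, fun _ x => hι.elim x, fun h => by rwa [norm_zero]⟩
  have hC : 0 ≤ C := (norm_nonneg _).trans (hc x₀)
  obtain ⟨T, hT, hn⟩ := exists_hasMatrix_of_injective
    (k := fun x y => if x = y then c x else 0) hC
    (fun x y => by split_ifs <;> simp [hc, hC])
    (fun x y y' h h' => by
      rw [ne_eq, ite_eq_right_iff, Classical.not_imp] at h h'
      exact h.1.symm.trans h'.1)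
    (fun x x' y h h' => by
      rw [ne_eq, ite_eq_right_iff, Classical.not_imp] at h h'
      exact h.1.trans h'.1.symm)
  refine ⟨T, fun ξ x => (hT.hasSum ξ x).unique ?_, fun _ => hn⟩
  have := hasSum_single (f := fun y => (if x = y then c x else 0) * ξ y) x
    fun y hy => by simp [hy.symm]
  simpa using this

theorem isCompactOperator_of_isDiag_finite (h : IsDiag T c) (hc : {x | c x ≠ 0}.Finite) :
    IsCompactOperator T := by
  have e : T = ∑ x ∈ hc.toFinset, (ContinuousLinearMap.toSpanSingleton ℂ (c x • basisVec x)).comp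
      (lp.evalCLM ℂ (fun _ : ι => ℂ) 2 x) := by
    ext ξ y
    rw [h, sum_apply, lp.coeFn_sum, Finset.sum_apply, Finset.sum_eq_single y]
    · change _ = ξ y * (c y * basisVec y y)
      rw [basisVec_apply_self, mul_one, mul_comm]
    · intro x _ hx
      change ξ x * (c x * basisVec x y) = 0
      rw [basisVec_apply_ne hx.symm, mul_zero, mul_zero]
    · intro hy
      change ξ y * (c y * basisVec y y) = 0
      have : c y = 0 := by simpa using hy
      rw [this, zero_mul, mul_zero]
  rw [e]
  refine Submodule.sum_mem (compactOperator (RingHom.id ℂ) (lp (fun _ : ι => ℂ) 2)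
    (lp (fun _ : ι => ℂ) 2)) fun x _ => ?_
  have hx : IsCompactOperator (lp.evalCLM ℂ (fun _ : ι => ℂ) 2 x) :=
    isCompactOperator_of_locallyCompactSpace_dom (lp.evalCLM ℂ (fun _ : ι => ℂ) 2 x)
  exact hx.clm_comp (ContinuousLinearMap.toSpanSingleton ℂ (c x • basisVec x))

/-- A diagonal operator whose entries tend to zero is compact. -/
theorem isCompactOperator_of_isDiag (h : IsDiag T c)
    (hc : ∀ η : ℝ, 0 < η → {x | η ≤ ‖c x‖}.Finite) : IsCompactOperator T := by
  classical
  have hcl := isClosed_setOfPred_isCompactOperator (σ₁₂ := RingHom.id ℂ)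
    (M₁ := lp (fun _ : ι => ℂ) 2) (M₂ := lp (fun _ : ι => ℂ) 2)
  have hmem : T ∈ closure {f : lp (fun _ : ι => ℂ) 2 →L[ℂ] lp (fun _ : ι => ℂ) 2 |
      IsCompactOperator f} := by
    rw [Metric.mem_closure_iff]
    intro η hη
    obtain ⟨T₁, hT₁, hn⟩ := exists_isDiag (c := fun x => if η / 2 ≤ ‖c x‖ then 0 else c x)
      (C := η / 2) (fun x => by
        split_ifs with hx
        · rw [norm_zero]; exact (half_pos hη).le
        · exact (not_le.1 hx).le)
    refine ⟨T - T₁, isCompactOperator_of_isDiag_finite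
      (c := fun x => if η / 2 ≤ ‖c x‖ then c x else 0) (fun ξ x => ?_)
      ((hc _ (half_pos hη)).subset fun x hx => ?_), ?_⟩
    · change T ξ x - T₁ ξ x = _
      rw [h, hT₁]
      dsimp only
      split_ifs <;> simp
    · by_contra hx'
      exact hx (if_neg hx')
    · rw [dist_eq_norm, sub_sub_cancel]
      exact (hn (half_pos hη).le).trans_lt (half_lt_self hη)
  exact hcl.closure_subset hmem

theorem mem_diagOp_domain {w : ι → ℝ} {ξ : lp (fun _ : ι => ℂ) 2} :
    ξ ∈ (diagOp w).domain ↔ Memℓp (fun x => (w x : ℂ) * ξ x) 2 := Iff.rfl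

theorem diagOp_apply (w : ι → ℝ) (ξ : (diagOp w).domain) (x : ι) :
    diagOp w ξ x = w x * (ξ : lp (fun _ : ι => ℂ) 2) x := rfl

theorem mem_diagOp_domain_of_eq {w : ι → ℝ} {ξ η : lp (fun _ : ι => ℂ) 2}
    (h : ∀ x, (w x : ℂ) * ξ x = η x) : ξ ∈ (diagOp w).domain := by
  rw [mem_diagOp_domain, funext h]
  exact lp.memℓp η

theorem basisVec_mem_diagOp_domain (w : ι → ℝ) (x : ι) : basisVec x ∈ (diagOp w).domain := by
  refine mem_diagOp_domain_of_eq (η := (w x : ℂ) • basisVec x) fun y => ?_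
  change _ = (w x : ℂ) * basisVec x y
  by_cases hy : y = x
  · rw [hy]
  · rw [basisVec_apply_ne hy, mul_zero, mul_zero]

theorem diagOp_basisVec (w : ι → ℝ) (x : ι) :
    diagOp w ⟨basisVec x, basisVec_mem_diagOp_domain w x⟩ = (w x : ℂ) • basisVec x := by
  ext y
  change (w y : ℂ) * basisVec x y = (w x : ℂ) * basisVec x y
  by_cases hy : y = x
  · rw [hy]
  · rw [basisVec_apply_ne hy, mul_zero, mul_zero]

theorem dense_diagOp_domain (w : ι → ℝ) :
    Dense ((diagOp w).domain : Set (lp (fun _ : ι => ℂ) 2)) := by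
  have h := (stdHilbertBasis ι).dense_span
  rw [Submodule.dense_iff_topologicalClosure_eq_top, eq_top_iff, ← h]
  refine Submodule.topologicalClosure_mono (Submodule.span_le.2 ?_)
  rintro _ ⟨x, rfl⟩
  rw [stdHilbertBasis_apply]
  exact basisVec_mem_diagOp_domain w x

theorem isSelfAdjoint_diagOp (w : ι → ℝ) : IsSelfAdjoint (diagOp w) := by
  have hd := dense_diagOp_domain w
  rw [LinearPMap.isSelfAdjoint_def]
  have hle : diagOp w ≤ (diagOp w).adjoint := by
    refine LinearPMap.IsFormalAdjoint.le_adjoint hd fun ξ η => ?_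
    rw [lp.inner_eq_tsum, lp.inner_eq_tsum]
    refine tsum_congr fun x => ?_
    rw [diagOp_apply, diagOp_apply]
    simp only [RCLike.inner_apply, map_mul, Complex.conj_ofReal]
    ring
  refine le_antisymm ?_ hle
  have hdom : (diagOp w).adjoint.domain ≤ (diagOp w).domain := by
    intro η hη
    refine mem_diagOp_domain_of_eq (η := (diagOp w).adjoint ⟨η, hη⟩) fun x => ?_
    have h := LinearPMap.adjoint_isFormalAdjoint hd ⟨η, hη⟩
      ⟨basisVec x, basisVec_mem_diagOp_domain w x⟩
    rw [diagOp_basisVec, inner_smul_right] at h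
    have h2 := congrArg (starRingEnd ℂ) h
    rw [map_mul, inner_conj_symm, inner_conj_symm, inner_basisVec, inner_basisVec,
      Complex.conj_ofReal] at h2
    exact h2.symm
  refine ⟨hdom, fun η ζ h => ?_⟩
  have h1 := hle.2 (x := ⟨ζ, ζ.2⟩) (y := η) h.symm
  exact h1.symm

/-- The resolvent `(1 + D²)⁻¹` of a diagonal operator. -/
theorem isInvOneAddSq_diagOp {w : ι → ℝ} (h : IsDiag T fun x => ((1 + w x ^ 2)⁻¹ : ℝ)) :
    IsInvOneAddSq (diagOp w) T := by
  have hpos : ∀ x, 0 < 1 + w x ^ 2 := fun x => by positivity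
  obtain ⟨T₁, hT₁, -⟩ := exists_isDiag (c := fun x => ((w x * (1 + w x ^ 2)⁻¹ : ℝ) : ℂ)) (C := 1)
    fun x => by
      rw [Complex.norm_real, Real.norm_eq_abs, abs_mul, abs_of_pos (inv_pos.2 (hpos x)),
        ← div_eq_mul_inv, div_le_one (hpos x)]
      nlinarith [sq_abs (w x), sq_nonneg (|w x| - 1), abs_nonneg (w x)]
  obtain ⟨T₂, hT₂, -⟩ := exists_isDiag (c := fun x => ((w x ^ 2 * (1 + w x ^ 2)⁻¹ : ℝ) : ℂ))
    (C := 1) fun x => by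
      rw [Complex.norm_real, Real.norm_eq_abs, abs_of_nonneg (by positivity),
        ← div_eq_mul_inv, div_le_one (hpos x)]
      linarith
  refine ⟨fun ξ => ?_, fun ξ hξ => ?_⟩
  · have h1 : T ξ ∈ (diagOp w).domain := mem_diagOp_domain_of_eq (η := T₁ ξ) fun x => by
      rw [h, hT₁]; push_cast; ring
    have h2 : diagOp w ⟨T ξ, h1⟩ ∈ (diagOp w).domain :=
      mem_diagOp_domain_of_eq (η := T₂ ξ) fun x => by
        rw [diagOp_apply, hT₂]; simp only [h ξ x]; push_cast; ring
    refine ⟨h1, h2, ?_⟩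
    ext x
    change T ξ x + w x * (w x * T ξ x) = ξ x
    rw [h]
    have := hpos x
    have h3 : (1 + w x ^ 2 : ℝ) * (1 + w x ^ 2)⁻¹ = 1 := mul_inv_cancel₀ this.ne'
    have h4 : (1 + (w x : ℂ) ^ 2) * (((1 + w x ^ 2)⁻¹ : ℝ) : ℂ) = 1 := by exact_mod_cast h3
    linear_combination ξ x * h4
  · ext x
    rw [h]
    change _ * ((ξ : lp (fun _ : ι => ℂ) 2) x + w x * (w x * (ξ : lp (fun _ : ι => ℂ) 2) x)) = _
    have h3 : (1 + w x ^ 2 : ℝ) * (1 + w x ^ 2)⁻¹ = 1 := mul_inv_cancel₀ (hpos x).ne'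
    have h4 : (1 + (w x : ℂ) ^ 2) * (((1 + w x ^ 2)⁻¹ : ℝ) : ℂ) = 1 := by exact_mod_cast h3
    linear_combination (ξ : lp (fun _ : ι => ℂ) 2) x * h4

end Diagonal

/-! ### Functional calculus and bounded commutators -/

section Calculus

universe u

variable {H : Type u} [NormedAddCommGroup H] [InnerProductSpace ℂ H] [CompleteSpace H]

/-- The continuous functional calculus acts on an eigenvector through the eigenvalue. -/
theorem cfc_apply_of_eigenvector {R : H →L[ℂ] H} (hR : IsSelfAdjoint R) {v : H} {μ : ℝ}
    (hv : v ≠ 0) (hRv : R v = (μ : ℂ) • v) {g : ℝ → ℝ} (hg : Continuous g) :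
    cfc g R v = (g μ : ℂ) • v := by
  have halg : ∀ r : ℝ, algebraMap ℝ (H →L[ℂ] H) r v = (r : ℂ) • v := fun r => by
    rw [Algebra.algebraMap_eq_smul_one]
    change r • v = _
    exact RCLike.real_smul_eq_coe_smul (K := ℂ) r v
  have hμ : μ ∈ spectrum ℝ R := by
    rw [spectrum.mem_iff]
    rintro ⟨U, hU⟩
    refine hv ?_
    have h0 : (U : H →L[ℂ] H) v = 0 := by
      rw [hU, sub_apply, halg, hRv, sub_self]
    have h1 := congrArg (fun A : H →L[ℂ] H => A v) U.inv_mul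
    rw [mul_apply_eq_comp, h0, map_zero, one_apply_eq_self] at h1
    exact h1.symm
  have key : ∀ f : C(spectrum ℝ R, ℝ), cfcHom hR f v = (f ⟨μ, hμ⟩ : ℂ) • v := by
    intro f
    induction f using ContinuousMap.induction_on_of_compact with
    | const r =>
      have : ContinuousMap.const (spectrum ℝ R) r = algebraMap ℝ C(spectrum ℝ R, ℝ) r := rfl
      rw [this, AlgHomClass.commutes, halg]
      rfl
    | id => rw [cfcHom_id hR, hRv]; rfl
    | star_id => rw [map_star, cfcHom_id hR, hR.star_eq, hRv]; rfl
    | add f g hf hg =>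
      rw [map_add, add_apply, hf, hg, ContinuousMap.add_apply, Complex.ofReal_add, add_smul]
    | mul f g hf hg =>
      rw [map_mul, mul_apply_eq_comp, hg, map_smul, hf, smul_smul, ContinuousMap.mul_apply,
        Complex.ofReal_mul, mul_comm]
    | frequently f hf =>
      have hcl : IsClosed {f : C(spectrum ℝ R, ℝ) |
          cfcHom hR f v = (f ⟨μ, hμ⟩ : ℂ) • v} := by
        refine isClosed_eq ?_ ?_
        · exact (ContinuousLinearMap.apply ℂ H v).continuous.comp (cfcHom_continuous hR)
        · exact (Complex.continuous_ofReal.comp (continuous_eval_const _)).smul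
            continuous_const
      exact hcl.closure_subset (mem_closure_iff_frequently.2 hf)
  rw [cfc_apply g R hR hg.continuousOn, key]
  rfl

theorem continuous_heat {t : ℝ} (ht : 0 < t) :
    Continuous fun r : ℝ => if 0 < r then Real.exp (-t / r) else 0 := by
  refine continuous_iff_continuousAt.2 fun r => ?_
  rcases lt_trichotomy r 0 with hr | rfl | hr
  · refine (continuousAt_const (y := (0 : ℝ))).congr ?_
    filter_upwards [gt_mem_nhds hr] with s hs
    rw [if_neg (not_lt.2 hs.le)]
  · unfold ContinuousAt
    simp only [lt_irrefl, if_false]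
    refine (Tendsto.sup (x₁ := 𝓝[≤] (0 : ℝ)) (x₂ := 𝓝[>] 0) ?_ ?_).mono_left
      (nhdsLE_sup_nhdsGT (0 : ℝ)).ge
    · refine tendsto_const_nhds.congr' ?_
      filter_upwards [self_mem_nhdsWithin] with s hs
      rw [if_neg (not_lt.2 hs)]
    · have h1 : Tendsto (fun s : ℝ => -t / s) (𝓝[>] 0) atBot := by
        simp only [div_eq_mul_inv]
        exact (tendsto_inv_nhdsGT_zero).const_mul_atTop_of_neg (neg_lt_zero.2 ht)
      refine (Real.tendsto_exp_atBot.comp h1).congr' ?_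
      filter_upwards [self_mem_nhdsWithin] with s hs
      rw [if_pos (show (0 : ℝ) < s from hs), Function.comp_apply]
  · have : ContinuousAt (fun s : ℝ => Real.exp (-t / s)) r :=
      (continuousAt_const.div continuousAt_id hr.ne').rexp
    refine this.congr ?_
    filter_upwards [lt_mem_nhds hr] with s hs
    rw [if_pos hs]

theorem heatOp_apply_of_eigenvector {R : H →L[ℂ] H} (hR : IsSelfAdjoint R) {v : H} {μ : ℝ}
    (hv : v ≠ 0) (hRv : R v = (μ : ℂ) • v) (hμ : 0 < μ) {t : ℝ} (ht : 0 < t) :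
    heatOp R t v = (Real.exp (-t / μ) : ℂ) • v := by
  rw [heatOp, cfc_apply_of_eigenvector hR hv hRv (continuous_heat ht), if_pos hμ]

/-- To see that `T` is trace class it suffices to know a positive square root `A = B* B` of
`T* T`. -/
theorem isTraceClass_of_sq_eq {ι : Type u} (e : HilbertBasis ι ℂ H) {T A B : H →L[ℂ] H}
    (hAB : A = star B * B) (hAT : A * A = star T * T)
    (hsum : Summable fun i => (inner ℂ (e i) (A (e i))).re) : IsTraceClass T := by
  have hA0 : 0 ≤ A := hAB ▸ star_mul_self_nonneg B
  have habs : CFC.abs T = A := CFC.sqrt_unique hAT hA0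
  exact ⟨ι, e, by rwa [habs]⟩

end Calculus

section Commutators

variable {H : Type*} [NormedAddCommGroup H] [InnerProductSpace ℂ H]
  {D : H →ₗ.[ℂ] H} {a b : H →L[ℂ] H}

theorem HasBoundedCommutator.add (ha : HasBoundedCommutator D a) (hb : HasBoundedCommutator D b) :
    HasBoundedCommutator D (a + b) := by
  obtain ⟨ha, C, hC⟩ := ha
  obtain ⟨hb, C', hC'⟩ := hb
  refine ⟨fun ξ => D.domain.add_mem (ha ξ) (hb ξ), C + C', fun ξ => ?_⟩
  have e : D ⟨(a + b) ξ, D.domain.add_mem (ha ξ) (hb ξ)⟩ =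
      D ⟨a ξ, ha ξ⟩ + D ⟨b ξ, hb ξ⟩ := D.map_add ⟨a ξ, ha ξ⟩ ⟨b ξ, hb ξ⟩
  rw [e, add_apply, add_sub_add_comm, add_mul]
  exact (norm_add_le _ _).trans (add_le_add (hC ξ) (hC' ξ))

theorem HasBoundedCommutator.smul (z : ℂ) (ha : HasBoundedCommutator D a) :
    HasBoundedCommutator D (z • a) := by
  obtain ⟨ha, C, hC⟩ := ha
  refine ⟨fun ξ => D.domain.smul_mem z (ha ξ), ‖z‖ * C, fun ξ => ?_⟩
  have e : D ⟨(z • a) ξ, D.domain.smul_mem z (ha ξ)⟩ = z • D ⟨a ξ, ha ξ⟩ :=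
    D.map_smul z ⟨a ξ, ha ξ⟩
  rw [e, smul_apply, ← smul_sub, norm_smul, mul_assoc]
  exact mul_le_mul_of_nonneg_left (hC ξ) (norm_nonneg z)

theorem HasBoundedCommutator.zero : HasBoundedCommutator D (0 : H →L[ℂ] H) := by
  refine ⟨fun ξ => D.domain.zero_mem, 0, fun ξ => ?_⟩
  have e : D ⟨(0 : H →L[ℂ] H) ξ, D.domain.zero_mem⟩ = 0 := D.map_zero
  rw [e, zero_apply, sub_zero, norm_zero, zero_mul]

/-- The Leibniz rule `[D, a b] = [D, a] b + a [D, b]`. -/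
theorem HasBoundedCommutator.mul (ha : HasBoundedCommutator D a) (hb : HasBoundedCommutator D b) :
    HasBoundedCommutator D (a * b) := by
  obtain ⟨ha, C, hC⟩ := ha
  obtain ⟨hb, C', hC'⟩ := hb
  refine ⟨fun ξ => ha ⟨b ξ, hb ξ⟩, |C| * ‖b‖ + ‖a‖ * C', fun ξ => ?_⟩
  have e : D ⟨(a * b) ξ, ha ⟨b ξ, hb ξ⟩⟩ - (a * b) (D ξ) =
      (D ⟨a (b ξ), ha ⟨b ξ, hb ξ⟩⟩ - a (D ⟨b ξ, hb ξ⟩)) + a (D ⟨b ξ, hb ξ⟩ - b (D ξ)) := by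
    rw [map_sub, sub_add_sub_cancel]
    rfl
  rw [e, add_mul, mul_assoc, mul_assoc]
  refine (norm_add_le _ _).trans (add_le_add ((hC ⟨b ξ, hb ξ⟩).trans ?_) ?_)
  · exact mul_le_mul (le_abs_self C) (b.le_opNorm _) (norm_nonneg _) (abs_nonneg C)
  · exact (a.le_opNorm _).trans (mul_le_mul_of_nonneg_left (hC' ξ) (norm_nonneg a))

end Commutators

/-! ### Heat operators, trace class diagonal operators and permutation unitaries -/

section Diagonal

universe u

variable {ι : Type u} {T T' : lp (fun _ : ι => ℂ) 2 →L[ℂ] lp (fun _ : ι => ℂ) 2} {c c' : ι → ℂ}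

theorem IsDiag.heatOp {r : ι → ℝ} (h : IsDiag T fun x => (r x : ℂ)) (hr : ∀ x, 0 < r x) {t : ℝ}
    (ht : 0 < t) : IsDiag (heatOp T t) fun x => (Real.exp (-t / r x) : ℂ) := by
  classical
  have hT : IsSelfAdjoint T := by
    have h1 := h.star
    simp only [Complex.star_def, Complex.conj_ofReal] at h1
    exact h1.unique h
  have hm : HasMatrix (_root_.heatOp T t)
      fun x y => if x = y then (Real.exp (-t / r x) : ℂ) else 0 := by
    intro x y
    rw [heatOp_apply_of_eigenvector hT (v := basisVec y) (fun h0 => by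
      have := norm_basisVec y
      rw [h0, norm_zero] at this
      exact zero_ne_one this) (h.apply_basisVec y) (hr y) ht]
    change (Real.exp (-t / r y) : ℂ) * basisVec y x = _
    rw [basisVec_apply]
    by_cases hxy : x = y
    · rw [hxy]; simp
    · simp [hxy]
  intro ξ x
  refine (hm.hasSum ξ x).unique ?_
  have := hasSum_single (f := fun y => (if x = y then (Real.exp (-t / r x) : ℂ) else 0) * ξ y) x
    fun y hy => by simp [hy.symm]
  simpa using this

/-- A diagonal operator with summable entries is trace class. -/
theorem isTraceClass_of_isDiag (h : IsDiag T c) (hc : Summable fun x => ‖c x‖) :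
    IsTraceClass T := by
  have hbound : ∀ x, ‖((‖c x‖ : ℝ) : ℂ)‖ ≤ ∑' y, ‖c y‖ := fun x => by
    rw [Complex.norm_real, norm_norm]
    exact hc.le_tsum x fun y _ => norm_nonneg _
  obtain ⟨A, hA, -⟩ := exists_isDiag hbound
  obtain ⟨B, hB, -⟩ := exists_isDiag (c := fun x => ((√‖c x‖ : ℝ) : ℂ))
    (C := √(∑' y, ‖c y‖)) fun x => by
      rw [Complex.norm_real, Real.norm_of_nonneg (Real.sqrt_nonneg _)]
      exact Real.sqrt_le_sqrt (hc.le_tsum x fun y _ => norm_nonneg _)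
  have hAB : A = star B * B := by
    refine hA.unique ?_
    have := hB.star.mul hB
    simp only [Complex.star_def, Complex.conj_ofReal, ← Complex.ofReal_mul,
      Real.mul_self_sqrt (norm_nonneg _)] at this
    exact this
  refine isTraceClass_of_sq_eq (stdHilbertBasis ι) hAB ((hA.mul hA).unique ?_) ?_
  · have := h.star.mul h
    convert this using 2 with x
    rw [Complex.star_def, Complex.conj_mul', pow_two]
  · convert hc using 2 with x
    rw [stdHilbertBasis_apply, inner_basisVec, hA, basisVec_apply_self, mul_one,
      Complex.ofReal_re]

theorem permUnitary_mul (e f : ι ≃ ι) : permUnitary (e * f) = permUnitary e * permUnitary f := by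
  ext ξ x
  rfl

theorem permUnitary_one : permUnitary (1 : ι ≃ ι) = 1 := by
  ext ξ x
  rfl

theorem permUnitary_zpow (e : ι ≃ ι) (k : ℤ) : permUnitary e ^ k = permUnitary (e ^ k) :=
  (map_zpow (⟨⟨permUnitary, permUnitary_one⟩, permUnitary_mul⟩ : (ι ≃ ι) →* _) e k).symm

end Diagonal

namespace SmaleSpace

variable {X : Type*} [MetricSpace X] [CompactSpace X] {S : SmaleSpace X} {P Q : S.PeriodicSet}

/-! ### The function `ω_s` on heteroclinic points -/

/-- A heteroclinic point as a point of `X^u(Q)`. -/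
def toUnstable (x : heteroclinic P Q) : UnstableSpace Q := ⟨x.1, x.2.2⟩

theorem toUnstable_injective : Function.Injective (toUnstable (P := P) (Q := Q)) :=
  fun _ _ h => Subtype.ext (congrArg (fun y : UnstableSpace Q => y.1) h)

theorem heteroclinicPerm_zpow_apply (k : ℤ) (x : heteroclinic P Q) :
    ((heteroclinicPerm P Q ^ k) x : X) = (S.φ ^ k) x.1 := by
  induction k using Int.induction_on with
  | zero => rfl
  | succ i ih =>
    rw [add_comm, zpow_add_apply, zpow_one, zpow_add, zpow_one, Equiv.Perm.mul_apply, ← ih]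
    rfl
  | pred i ih =>
    rw [sub_eq_neg_add, zpow_add_apply, zpow_neg_one, zpow_add, zpow_neg_one,
      Equiv.Perm.mul_apply, ← ih]
    rfl

section Omega

variable {ε : ℝ} {ω₀ : X → ℝ}

theorem omegaS_perm_zpow (hε : 0 < ε) (hε' : ε ≤ S.εX / 2) (hPQ : Disjoint P.carrier Q.carrier)
    (hω : IsCutoff P ε ω₀) (k : ℤ) (x : heteroclinic P Q) :
    S.omegaS ω₀ ((heteroclinicPerm P Q ^ k) x : X) = S.omegaS ω₀ x - k := by
  rw [heteroclinicPerm_zpow_apply, omegaS_zpow hε (hε'.trans S.half_εX_le) hω x.2.1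
    (heteroclinic_notMem hPQ x)]

/-- On a compact subset of `X^u(Q)` the number of heteroclinic points with `ω_s ≤ n` grows at most
exponentially in `n`. -/
theorem exists_card_omegaS_le (hε : 0 < ε) (hε' : ε ≤ S.εX / 2)
    (hPQ : Disjoint P.carrier Q.carrier) (hω : IsCutoff P ε ω₀) {K : Set (UnstableSpace Q)}
    (hK : IsCompact K) : ∃ C M : ℕ, ∀ (n : ℕ) (T : Finset (heteroclinic P Q)),
      (∀ x ∈ T, toUnstable x ∈ K ∧ S.omegaS ω₀ x ≤ n) → T.card ≤ C * M ^ n := by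
  classical
  obtain ⟨C, M, h⟩ := exists_card_entryTime_le (P := P) hε hε' hPQ hK
  refine ⟨C * M, M, fun n T hT => ?_⟩
  rw [mul_assoc, ← pow_succ', ← Finset.card_image_of_injective T toUnstable_injective]
  refine h (n + 1) _ fun y hy => ?_
  obtain ⟨x, hx, rfl⟩ := Finset.mem_image.1 hy
  obtain ⟨hxK, hxn⟩ := hT x hx
  refine ⟨hxK, x.2.1, ?_⟩
  have h1 := (omegaS_mem_Icc hε (hε'.trans S.half_εX_le) hω x.2.1 (heteroclinic_notMem hPQ x)).1
  have h2 : (entryTime P ε x.1 : ℝ) ≤ ((n + 1 : ℕ) : ℤ) := by push_cast; linarith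
  exact_mod_cast h2

theorem finite_omegaS_le (hε : 0 < ε) (hε' : ε ≤ S.εX / 2) (hPQ : Disjoint P.carrier Q.carrier)
    (hω : IsCutoff P ε ω₀) {K : Set (UnstableSpace Q)} (hK : IsCompact K) (c : ℝ) :
    {x : heteroclinic P Q | toUnstable x ∈ K ∧ S.omegaS ω₀ x ≤ c}.Finite := by
  obtain ⟨C, M, h⟩ := exists_card_omegaS_le (P := P) hε hε' hPQ hω hK
  obtain ⟨n, hn⟩ := exists_nat_ge c
  by_contra hinf
  obtain ⟨T, hT, hcard⟩ := Set.Infinite.exists_subset_card_eq hinf (C * M ^ n + 1)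
  have := h n T fun x hx => ⟨(hT hx).1, (hT hx).2.trans hn⟩
  omega

theorem exists_le_entryTime (hε : 0 < ε) (hε' : ε ≤ S.εX / 2)
    (hPQ : Disjoint P.carrier Q.carrier) {K : Set (UnstableSpace Q)} (hK : IsCompact K) :
    ∃ L : ℕ, ∀ x : heteroclinic P Q, toUnstable x ∈ K → -(L : ℤ) ≤ entryTime P ε x.1 := by
  have hfin := finite_entryTime_le (P := P) hε hε' hPQ hK 0
  obtain ⟨b, hb⟩ := (hfin.image fun x => entryTime P ε x.1).bddBelow
  refine ⟨b.natAbs, fun x hx => ?_⟩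
  by_cases h0 : entryTime P ε x.1 ≤ 0
  · have h1 : b ≤ entryTime P ε x.1 := hb ⟨toUnstable x, ⟨hx, x.2.1, h0⟩, rfl⟩
    omega
  · omega

/-- On a compact subset of the groupoid the function `ω_s(x) - ω_s(y)` is bounded. -/
theorem exists_abs_omegaS_sub_le (hε : 0 < ε) (hε' : ε ≤ S.εX / 2)
    (hPQ : Disjoint P.carrier Q.carrier) (hω : IsCutoff P ε ω₀) {K : Set (StableGroupoid Q)}
    (hK : IsCompact K) : ∃ B : ℝ, 0 ≤ B ∧ ∀ (x y : heteroclinic P Q), ∀ g ∈ K,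
      g.r = toUnstable x → g.s = toUnstable y → |S.omegaS ω₀ x - S.omegaS ω₀ y| ≤ B := by
  have hN : ∃ N : ℕ, ∀ g ∈ K, S.StableAt N g.r.1 g.s.1 := by
    choose N hN using fun g : StableGroupoid Q => g.exists_stableAt
    obtain ⟨t, -, ht⟩ := hK.elim_nhds_subcover _ fun g _ => eventually_stableAt g (hN g)
    refine ⟨t.sup N, fun g hg => ?_⟩
    have := ht hg
    simp only [Set.mem_iUnion, exists_prop] at this
    obtain ⟨k, hk, hkg⟩ := this
    exact StableAt.mono hkg (Finset.le_sup hk)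
  obtain ⟨N, hN⟩ := hN
  obtain ⟨k, hk⟩ := exists_entryTime_le hε hε' P
  obtain ⟨L₁, hL₁⟩ := exists_le_entryTime (P := P) hε hε' hPQ
    (hK.image StableGroupoid.continuous_r)
  obtain ⟨L₂, hL₂⟩ := exists_le_entryTime (P := P) hε hε' hPQ
    (hK.image StableGroupoid.continuous_s)
  refine ⟨((N + L₁ + L₂ + k + 1 : ℕ) : ℝ), Nat.cast_nonneg _, fun x y g hg hgx hgy => ?_⟩
  have hst : S.StableAt N x.1 y.1 := by
    have := hN g hg
    rwa [hgx, hgy] at this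
  have hxP := heteroclinic_notMem hPQ x
  have hyP := heteroclinic_notMem hPQ y
  have h1 := hk N _ _ hst x.2.1 y.2.1 hxP hyP
  have h2 := hk N _ _ hst.symm y.2.1 x.2.1 hyP hxP
  have h3 := hL₁ x ⟨g, hg, hgx⟩
  have h4 := hL₂ y ⟨g, hg, hgy⟩
  have h5 : entryTime P ε y.1 ≤ entryTime P ε x.1 + (N + L₁ + L₂ + k : ℕ) := by
    push_cast; omega
  have h6 : entryTime P ε x.1 ≤ entryTime P ε y.1 + (N + L₁ + L₂ + k : ℕ) := by
    push_cast; omega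
  have h5' : (entryTime P ε y.1 : ℝ) ≤ entryTime P ε x.1 + (N + L₁ + L₂ + k : ℕ) := by
    exact_mod_cast h5
  have h6' : (entryTime P ε x.1 : ℝ) ≤ entryTime P ε y.1 + (N + L₁ + L₂ + k : ℕ) := by
    exact_mod_cast h6
  have hX := omegaS_mem_Icc hε (hε'.trans S.half_εX_le) hω x.2.1 hxP
  have hY := omegaS_mem_Icc hε (hε'.trans S.half_εX_le) hω y.2.1 hyP
  rw [Nat.cast_succ, abs_le]
  exact ⟨by linarith [hX.1, hX.2, hY.1, hY.2], by linarith [hX.1, hX.2, hY.1, hY.2]⟩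

end Omega

/-! ### The representation of `C_c(G)` on `ℓ²(X^h(P, Q))` -/

variable {f f' : C_c(StableGroupoid Q, ℂ)} {T T' : HilbertSp P Q →L[ℂ] HilbertSp P Q}

theorem represents_iff {f : StableGroupoid Q → ℂ} :
    Represents P f T ↔ HasMatrix T fun x y => kernel f x y :=
  ⟨fun h => HasMatrix.of_hasSum h, fun h => h.hasSum⟩

/-- Matrices dominated by the kernel of a compactly supported function define bounded operators. -/
theorem exists_hasMatrix_of_kernel (f : C_c(StableGroupoid Q, ℂ))
    {k : heteroclinic P Q → heteroclinic P Q → ℂ} {C : ℝ} (hC : 0 ≤ C) (hk : ∀ x y, ‖k x y‖ ≤ C)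
    (hkf : ∀ x y, k x y ≠ 0 → kernel f x y ≠ 0) : ∃ T, HasMatrix T k := by
  classical
  obtain ⟨t, c, hct, hcinj⟩ := exists_finite_coloring f.hasCompactSupport.isCompact
  have hg : ∀ x y : heteroclinic P Q, ∃ g : Option (StableGroupoid Q), kernel f x y ≠ 0 →
      ∃ g' ∈ tsupport f, g = some (c g') ∧ g'.r = toUnstable x ∧ g'.s = toUnstable y := by
    intro x y
    by_cases h : kernel f x y = 0
    · exact ⟨none, fun h' => absurd h h'⟩
    · obtain ⟨g, hr, hs, hfg⟩ := exists_of_kernel_ne_zero h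
      refine ⟨some (c g), fun h' => ⟨g, subset_tsupport _ ?_, rfl, Subtype.ext hr,
        Subtype.ext hs⟩⟩
      rw [Function.mem_support, hfg]
      exact h'
  choose col hcol using hg
  refine exists_hasMatrix (t.image some) col hC hk (fun x y h => ?_) (fun x y y' h h' e => ?_)
    (fun x x' y h h' e => ?_)
  · obtain ⟨g, hg, e, -⟩ := hcol x y (hkf x y h)
    rw [e]
    exact Finset.mem_image_of_mem _ (hct g hg)
  · obtain ⟨g, hg, e1, hr, hs⟩ := hcol x y (hkf x y h)
    obtain ⟨g', hg', e1', hr', hs'⟩ := hcol x y' (hkf x y' h')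
    rw [e1, e1'] at e
    have := hcinj g hg g' hg' (Option.some_injective _ e) (Or.inl (hr.trans hr'.symm))
    exact toUnstable_injective (by rw [← hs, this, hs'])
  · obtain ⟨g, hg, e1, hr, hs⟩ := hcol x y (hkf x y h)
    obtain ⟨g', hg', e1', hr', hs'⟩ := hcol x' y (hkf x' y h')
    rw [e1, e1'] at e
    have := hcinj g hg g' hg' (Option.some_injective _ e) (Or.inr (hs.trans hs'.symm))
    exact toUnstable_injective (by rw [← hr, this, hr'])

theorem exists_norm_kernel_le (f : C_c(StableGroupoid Q, ℂ)) :
    ∃ C : ℝ, 0 ≤ C ∧ ∀ x y : X, ‖kernel f x y‖ ≤ C := by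
  obtain ⟨C, hC⟩ := f.hasCompactSupport.exists_bound_of_continuous f.continuous
  refine ⟨|C|, abs_nonneg C, fun x y => ?_⟩
  by_cases h : kernel f x y = 0
  · rw [h, norm_zero]; exact abs_nonneg C
  · obtain ⟨g, -, -, hg⟩ := exists_of_kernel_ne_zero h
    rw [← hg]
    exact (hC g).trans (le_abs_self C)

theorem exists_represents (P : S.PeriodicSet) (f : C_c(StableGroupoid Q, ℂ)) :
    ∃ T, Represents P f T := by
  obtain ⟨C, hC, h⟩ := exists_norm_kernel_le f
  obtain ⟨T, hT⟩ := exists_hasMatrix_of_kernel (P := P) f hC (fun x y => h x y) fun _ _ h => h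
  exact ⟨T, represents_iff.2 hT⟩

theorem Represents.mul (h : Represents P f T) (h' : Represents P f' T') :
    Represents P (convolveCc f f') (T * T') := by
  rw [represents_iff] at h h' ⊢
  intro x z
  rw [h.mul h' x z]
  dsimp only
  by_cases hxz : S.StableEquiv x.1 z.1
  · have e : kernel (convolveCc f f') x z = ∑' y : X, kernel f x.1 y * kernel f' y z.1 :=
      kernel_eq _ hxz x.2.2 z.2.2
    rw [e]
    refine tsum_subtype_eq_of_support_subset (f := fun y : X => kernel f x.1 y * kernel f' y z.1)
      fun y hy => ?_
    obtain ⟨g, hr, hs, -⟩ := exists_of_kernel_ne_zero (left_ne_zero_of_mul hy)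
    have hgs : S.StableEquiv g.r.1 g.s.1 := g.2.1
    rw [hr, hs] at hgs
    exact ⟨mem_stableSet_of_stableEquiv x.2.1 hgs, hs ▸ g.s.2⟩
  · have e : kernel (convolveCc f f') x z = 0 := dif_neg fun h => hxz h.1
    rw [e, tsum_congr (g := fun _ => (0 : ℂ)), tsum_zero]
    intro y
    by_contra hne
    obtain ⟨g, hr, hs, -⟩ := exists_of_kernel_ne_zero (left_ne_zero_of_mul hne)
    obtain ⟨g', hr', hs', -⟩ := exists_of_kernel_ne_zero (right_ne_zero_of_mul hne)
    have h1 : S.StableEquiv g.r.1 g.s.1 := g.2.1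
    have h2 : S.StableEquiv g'.r.1 g'.s.1 := g'.2.1
    rw [hr, hs] at h1
    rw [hr', hs'] at h2
    exact hxz (h1.trans h2)

theorem kernel_involutionCc (f : C_c(StableGroupoid Q, ℂ)) (x y : X) :
    kernel (involutionCc f) x y = star (kernel f y x) := by
  by_cases h : S.StableEquiv x y ∧ x ∈ unstableSet Q ∧ y ∈ unstableSet Q
  · rw [kernel_eq _ h.1 h.2.1 h.2.2, kernel_eq _ h.1.symm h.2.2 h.2.1]
    rfl
  · have h' : ¬ (S.StableEquiv y x ∧ y ∈ unstableSet Q ∧ x ∈ unstableSet Q) :=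
      fun h' => h ⟨h'.1.symm, h'.2.2, h'.2.1⟩
    unfold kernel
    rw [dif_neg h, dif_neg h', star_zero]

theorem Represents.star (h : Represents P f T) : Represents P (involutionCc f) (star T) := by
  rw [represents_iff] at h ⊢
  intro x y
  rw [h.star x y]
  exact (kernel_involutionCc f x.1 y.1).symm

theorem kernel_map (f : C_c(StableGroupoid Q, ℂ)) (x y : X) :
    kernel (alphaCc f) (S.φ x) (S.φ y) = kernel f x y := by
  by_cases h : S.StableEquiv x y ∧ x ∈ unstableSet Q ∧ y ∈ unstableSet Q
  · rw [kernel_eq f h.1 h.2.1 h.2.2, kernel_eq _ h.1.map (map_mem_unstableSet Q h.2.1)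
      (map_mem_unstableSet Q h.2.2)]
    change f ((shiftHomeomorph Q).symm (shiftHomeomorph Q ⟨(x, y), h⟩)) = _
    exact congrArg f ((shiftHomeomorph Q).symm_apply_apply (⟨(x, y), h⟩ : StableGroupoid Q))
  · have h' : ¬ (S.StableEquiv (S.φ x) (S.φ y) ∧ S.φ x ∈ unstableSet Q ∧
        S.φ y ∈ unstableSet Q) := fun h' => h ⟨by simpa using h'.1.map_symm, by
          simpa [zpow_neg_one] using zpow_mem_unstableSet h'.2.1 (-1), by
          simpa [zpow_neg_one] using zpow_mem_unstableSet h'.2.2 (-1)⟩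
    unfold kernel
    rw [dif_neg h, dif_neg h']

theorem kernel_pullbackCc (f : C_c(StableGroupoid Q, ℂ)) (x y : X) :
    kernel (pullbackCc f) x y = kernel f (S.φ x) (S.φ y) := by
  have e : alphaCc (pullbackCc f) = f := by
    ext g
    exact congrArg f ((shiftHomeomorph Q).apply_symm_apply g)
  rw [← kernel_map, e]

theorem Represents.diagonalCc {a : C_c(UnstableSpace Q, ℂ)} (h : RepresentsUnitSpace P a T) :
    Represents P (diagonalCc a) T := by
  classical
  have h' : IsDiag T fun x : heteroclinic P Q => a (toUnstable x) := h
  rw [represents_iff]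
  intro x y
  rw [h'.hasMatrix x y]
  dsimp only
  by_cases hxy : x = y
  · subst hxy
    have e : kernel (SmaleSpace.diagonalCc a) x x = SmaleSpace.diagonalCc a
      ⟨(x.1, x.1), StableEquiv.refl _, x.2.2, x.2.2⟩ := kernel_eq _ (StableEquiv.refl _) x.2.2 x.2.2
    rw [e, if_pos rfl]
    exact (if_pos rfl).symm
  · rw [if_neg hxy]
    by_contra hne
    obtain ⟨g, hr, hs, hg⟩ := exists_of_kernel_ne_zero (Ne.symm hne)
    have h1 : SmaleSpace.diagonalCc a g = 0 := if_neg fun hrs => hxy (Subtype.ext (by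
      rw [← hr, ← hs, hrs]))
    rw [h1] at hg
    exact hne hg

theorem exists_representsUnitSpace (P : S.PeriodicSet) (a : C_c(UnstableSpace Q, ℂ)) :
    ∃ T, RepresentsUnitSpace P a T := by
  obtain ⟨C, hC⟩ := a.hasCompactSupport.exists_bound_of_continuous a.continuous
  obtain ⟨T, hT, -⟩ := exists_isDiag (c := fun x : heteroclinic P Q => a (toUnstable x))
    fun x => hC (toUnstable x)
  exact ⟨T, hT⟩

/-! ### The unitary `u` and covariance -/

theorem unitaryPow_apply (k : ℤ) (ξ : HilbertSp P Q) (x : heteroclinic P Q) :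
    unitaryPow P Q k ξ x = ξ ((heteroclinicPerm P Q ^ (-k)) x) := by
  change (canonicalUnitary P Q ^ k) ξ x = _
  rw [canonicalUnitary, permUnitary_zpow, zpow_neg]
  rfl

theorem unitaryPow_add (k l : ℤ) :
    unitaryPow P Q (k + l) = unitaryPow P Q k * unitaryPow P Q l := by
  ext ξ x
  rw [mul_apply_eq_comp, unitaryPow_apply, unitaryPow_apply, unitaryPow_apply,
    neg_add_rev, zpow_add, Equiv.Perm.mul_apply]

theorem unitaryPow_zero : unitaryPow P Q 0 = 1 := by
  ext ξ x
  rw [unitaryPow_apply, neg_zero, zpow_zero]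
  rfl

theorem unitaryPow_basisVec (k : ℤ) (y : heteroclinic P Q) :
    unitaryPow P Q k (basisVec y) = basisVec ((heteroclinicPerm P Q ^ k) y) := by
  classical
  ext x
  rw [unitaryPow_apply, basisVec_apply, basisVec_apply, zpow_neg, Equiv.Perm.inv_eq_iff_eq]

theorem star_unitaryPow (k : ℤ) : star (unitaryPow P Q k) = unitaryPow P Q (-k) := by
  have h : HasMatrix (unitaryPow P Q k) fun x y => basisVec ((heteroclinicPerm P Q ^ k) y) x :=
    fun x y => by rw [unitaryPow_basisVec]
  refine h.star.unique fun x y => ?_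
  dsimp only
  rw [unitaryPow_basisVec, zpow_neg]
  by_cases hxy : y = (heteroclinicPerm P Q ^ k) x
  · have e : (heteroclinicPerm P Q ^ k)⁻¹ y = x := (Equiv.Perm.eq_inv_iff_eq.2 hxy.symm).symm
    rw [e, hxy, basisVec_apply_self, basisVec_apply_self, star_one]
  · rw [basisVec_apply_ne hxy, basisVec_apply_ne (fun e => hxy (Equiv.Perm.eq_inv_iff_eq.1 e).symm),
      star_zero]

theorem Represents.alphaCc (h : Represents P f T) :
    Represents P (alphaCc f) (unitaryPow P Q 1 * T * unitaryPow P Q (-1)) := by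
  rw [represents_iff] at h ⊢
  intro x y
  rw [mul_apply_eq_comp, mul_apply_eq_comp, unitaryPow_basisVec, unitaryPow_apply, h]
  dsimp only
  rw [heteroclinicPerm_zpow_apply, heteroclinicPerm_zpow_apply, zpow_neg_one, ← kernel_map]
  simp

theorem Represents.pullbackCc (h : Represents P f T) :
    Represents P (pullbackCc f) (unitaryPow P Q (-1) * T * unitaryPow P Q 1) := by
  rw [represents_iff] at h ⊢
  intro x y
  rw [mul_apply_eq_comp, mul_apply_eq_comp, unitaryPow_basisVec, unitaryPow_apply, h]
  dsimp only
  rw [heteroclinicPerm_zpow_apply, heteroclinicPerm_zpow_apply, kernel_pullbackCc]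
  simp

theorem Represents.exists_conj (h : Represents P f T) (k : ℤ) :
    ∃ f' : C_c(StableGroupoid Q, ℂ),
      Represents P f' (unitaryPow P Q k * T * unitaryPow P Q (-k)) := by
  induction k using Int.induction_on with
  | zero => exact ⟨f, by simpa [unitaryPow_zero] using h⟩
  | succ i ih =>
    obtain ⟨f', hf'⟩ := ih
    refine ⟨SmaleSpace.alphaCc f', ?_⟩
    have := hf'.alphaCc
    rw [mul_assoc, mul_assoc, ← unitaryPow_add, ← mul_assoc, ← mul_assoc, ← unitaryPow_add] at this
    rwa [add_comm, neg_add_rev]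
  | pred i ih =>
    obtain ⟨f', hf'⟩ := ih
    refine ⟨SmaleSpace.pullbackCc f', ?_⟩
    have := hf'.pullbackCc
    rw [mul_assoc, mul_assoc, ← unitaryPow_add, ← mul_assoc, ← mul_assoc, ← unitaryPow_add] at this
    rwa [sub_eq_neg_add, neg_add_rev, neg_neg (1 : ℤ)]

end SmaleSpace

namespace SmaleSpace

variable {X : Type*} [MetricSpace X] [CompactSpace X] {S : SmaleSpace X} {P Q : S.PeriodicSet}

/-! ### The Ruelle algebra as the closure of the algebraic crossed product -/

/-- The operators `π(f) u^k` with `f ∈ C_c(G)` and `k ∈ ℤ`; they span the algebraic crossed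
product `C_c(G) ⋊ ℤ`, which is a dense `*`-subalgebra of the Ruelle algebra. -/
def crossedMonomials (P Q : S.PeriodicSet) : Set (HilbertSp P Q →L[ℂ] HilbertSp P Q) :=
  {T | ∃ (f : C_c(StableGroupoid Q, ℂ)) (A : HilbertSp P Q →L[ℂ] HilbertSp P Q) (k : ℤ),
    Represents P f A ∧ T = A * unitaryPow P Q k}

theorem mul_mem_crossedMonomials {a b : HilbertSp P Q →L[ℂ] HilbertSp P Q}
    (ha : a ∈ crossedMonomials P Q) (hb : b ∈ crossedMonomials P Q) :
    a * b ∈ crossedMonomials P Q := by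
  obtain ⟨f, A, k, hA, rfl⟩ := ha
  obtain ⟨f', B, l, hB, rfl⟩ := hb
  obtain ⟨f'', hf''⟩ := hB.exists_conj k
  refine ⟨_, _, k + l, hA.mul hf'', ?_⟩
  have e : unitaryPow P Q (-k) * unitaryPow P Q (k + l) = unitaryPow P Q l := by
    rw [← unitaryPow_add, neg_add_cancel_left]
  calc A * unitaryPow P Q k * (B * unitaryPow P Q l)
      = A * (unitaryPow P Q k * (B * (unitaryPow P Q (-k) * unitaryPow P Q (k + l)))) := by
        rw [e]; simp only [mul_assoc]
    _ = _ := by simp only [mul_assoc]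

theorem star_mem_crossedMonomials {a : HilbertSp P Q →L[ℂ] HilbertSp P Q}
    (ha : a ∈ crossedMonomials P Q) : star a ∈ crossedMonomials P Q := by
  obtain ⟨f, A, k, hA, rfl⟩ := ha
  obtain ⟨f', hf'⟩ := hA.star.exists_conj (-k)
  refine ⟨_, _, -k, hf', ?_⟩
  rw [star_mul, star_unitaryPow, mul_assoc, mul_assoc, ← unitaryPow_add, neg_neg, add_neg_cancel,
    unitaryPow_zero, mul_one]

theorem ruelleAlgebra_eq :
    ruelleAlgebra P Q = (Submodule.span ℂ (crossedMonomials P Q)).topologicalClosure := by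
  apply le_antisymm
  · refine Submodule.topologicalClosure_minimal _ (Submodule.span_le.2 ?_)
      (Submodule.isClosed_topologicalClosure _)
    rintro _ ⟨a, ha, k, rfl⟩
    -- right multiplication by `u^k` is continuous, so it suffices to treat `a = π(f)`
    have hcont : Continuous fun b : HilbertSp P Q →L[ℂ] HilbertSp P Q => b * unitaryPow P Q k :=
      continuous_mul_const _
    refine map_mem_closure (f := fun b => b * unitaryPow P Q k)
      (s := (Submodule.span ℂ {T | ∃ f : C_c(StableGroupoid Q, ℂ), Represents P f T} :
        Set (HilbertSp P Q →L[ℂ] HilbertSp P Q))) hcont ha fun b hb => ?_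
    change b * unitaryPow P Q k ∈ Submodule.span ℂ (crossedMonomials P Q)
    induction hb using Submodule.span_induction with
    | mem b hb =>
      obtain ⟨f, hf⟩ := hb
      exact Submodule.subset_span ⟨f, b, k, hf, rfl⟩
    | zero => rw [zero_mul]; exact Submodule.zero_mem _
    | add b c _ _ hb hc => rw [add_mul]; exact Submodule.add_mem _ hb hc
    | smul z b _ hb => rw [smul_mul_assoc]; exact Submodule.smul_mem _ z hb
  · refine Submodule.topologicalClosure_mono (Submodule.span_mono ?_)
    rintro _ ⟨f, A, k, hA, rfl⟩
    exact ⟨A, Submodule.le_topologicalClosure _ (Submodule.subset_span ⟨f, hA⟩), k, rfl⟩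

theorem mul_mem_ruelleAlgebra {a b : HilbertSp P Q →L[ℂ] HilbertSp P Q}
    (ha : a ∈ ruelleAlgebra P Q) (hb : b ∈ ruelleAlgebra P Q) : a * b ∈ ruelleAlgebra P Q := by
  rw [ruelleAlgebra_eq] at ha hb ⊢
  refine map_mem_closure₂ (continuous_mul (M := HilbertSp P Q →L[ℂ] HilbertSp P Q)) ha hb
    fun c hc d hd => ?_
  have h := Submodule.mul_mem_mul (R := ℂ) hc hd
  rw [Submodule.span_mul_span] at h
  refine Submodule.span_mono ?_ h
  rintro _ ⟨c, hc, d, hd, rfl⟩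
  exact mul_mem_crossedMonomials hc hd

theorem star_mem_ruelleAlgebra {a : HilbertSp P Q →L[ℂ] HilbertSp P Q}
    (ha : a ∈ ruelleAlgebra P Q) : star a ∈ ruelleAlgebra P Q := by
  rw [ruelleAlgebra_eq] at ha ⊢
  refine map_mem_closure (continuous_star (R := HilbertSp P Q →L[ℂ] HilbertSp P Q)) ha
    fun b hb => ?_
  induction hb using Submodule.span_induction with
  | mem b hb => exact Submodule.subset_span (star_mem_crossedMonomials hb)
  | zero => rw [star_zero]; exact Submodule.zero_mem _
  | add b c _ _ hb hc => rw [star_add]; exact Submodule.add_mem _ hb hc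
  | smul z b _ hb => rw [star_smul]; exact Submodule.smul_mem _ _ hb

theorem RepresentsUnitSpace.mem_ruelleAlgebra {a : C_c(UnstableSpace Q, ℂ)}
    {T : HilbertSp P Q →L[ℂ] HilbertSp P Q} (h : RepresentsUnitSpace P a T) :
    T ∈ ruelleAlgebra P Q := by
  rw [ruelleAlgebra_eq]
  refine Submodule.le_topologicalClosure _ (Submodule.subset_span ⟨_, T, 0,
    Represents.diagonalCc h, ?_⟩)
  rw [unitaryPow_zero, mul_one]

/-! ### Commutators with the Dirac operator -/

section Dirac

variable {ε : ℝ} {ω₀ : X → ℝ} {f : C_c(StableGroupoid Q, ℂ)}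
  {T : HilbertSp P Q →L[ℂ] HilbertSp P Q}

/-- `[D, u^k] = -k u^k` on the domain of `D`. -/
theorem exists_unitaryPow_mem_domain (hε : 0 < ε) (hε' : ε ≤ S.εX / 2)
    (hPQ : Disjoint P.carrier Q.carrier) (hω : IsCutoff P ε ω₀) (k : ℤ)
    (ξ : (diracOp P Q ω₀).domain) :
    ∃ h : unitaryPow P Q k ξ ∈ (diracOp P Q ω₀).domain,
      diracOp P Q ω₀ ⟨unitaryPow P Q k ξ, h⟩ - unitaryPow P Q k (diracOp P Q ω₀ ξ) =
        (-k : ℂ) • unitaryPow P Q k ξ := by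
  have key : ∀ x : heteroclinic P Q, (S.omegaS ω₀ x : ℂ) * unitaryPow P Q k ξ x =
      unitaryPow P Q k (diracOp P Q ω₀ ξ) x + (-k : ℂ) * unitaryPow P Q k ξ x := fun x => by
    rw [unitaryPow_apply, unitaryPow_apply]
    change _ = (S.omegaS ω₀ ((heteroclinicPerm P Q ^ (-k)) x : X) : ℂ) * _ + _
    rw [omegaS_perm_zpow hε hε' hPQ hω]
    push_cast
    ring
  refine ⟨mem_diagOp_domain_of_eq (η := unitaryPow P Q k (diracOp P Q ω₀ ξ) +
    (-k : ℂ) • unitaryPow P Q k ξ) key, ?_⟩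
  rw [sub_eq_iff_eq_add']
  ext x
  exact key x

theorem hasBoundedCommutator_unitaryPow (hε : 0 < ε) (hε' : ε ≤ S.εX / 2)
    (hPQ : Disjoint P.carrier Q.carrier) (hω : IsCutoff P ε ω₀) (k : ℤ) :
    HasBoundedCommutator (diracOp P Q ω₀) (unitaryPow P Q k) := by
  choose h h' using exists_unitaryPow_mem_domain hε hε' hPQ hω k
  refine ⟨h, ‖(-k : ℂ)‖ * ‖unitaryPow P Q k‖, fun ξ => ?_⟩
  rw [h', norm_smul, mul_assoc]
  exact mul_le_mul_of_nonneg_left ((unitaryPow P Q k).le_opNorm _) (norm_nonneg _)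

/-- `[D, π(f)]` has the matrix `(ω_s(x) - ω_s(y)) f(x, y)`, in which the first factor is bounded
on the support of `f`. -/
theorem Represents.hasBoundedCommutator (h : Represents P f T) (hε : 0 < ε) (hε' : ε ≤ S.εX / 2)
    (hPQ : Disjoint P.carrier Q.carrier) (hω : IsCutoff P ε ω₀) :
    HasBoundedCommutator (diracOp P Q ω₀) T := by
  obtain ⟨B, hB, hBω⟩ := exists_abs_omegaS_sub_le (P := P) hε hε' hPQ hω
    f.hasCompactSupport.isCompact
  obtain ⟨C, hC, hCf⟩ := exists_norm_kernel_le f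
  obtain ⟨A, hA⟩ := exists_hasMatrix_of_kernel (P := P) f
    (k := fun x y => ((S.omegaS ω₀ x - S.omegaS ω₀ y : ℝ) : ℂ) * kernel f x y)
    (mul_nonneg hB hC) (fun x y => by
      by_cases hxy : kernel f x.1 y.1 = 0
      · rw [hxy, mul_zero, norm_zero]; exact mul_nonneg hB hC
      · obtain ⟨g, hr, hs, hg⟩ := exists_of_kernel_ne_zero hxy
        rw [norm_mul, Complex.norm_real]
        refine mul_le_mul (hBω x y g (subset_tsupport _ ?_) (Subtype.ext hr) (Subtype.ext hs))
          (hCf _ _) (norm_nonneg _) hB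
        rw [Function.mem_support, hg]
        exact hxy)
    (fun x y hxy => right_ne_zero_of_mul hxy)
  have key : ∀ (ξ : (diracOp P Q ω₀).domain) (x : heteroclinic P Q),
      (S.omegaS ω₀ x : ℂ) * T ξ x = (T (diracOp P Q ω₀ ξ) + A ξ) x := fun ξ x => by
    have h1 := (h ξ x).mul_left (S.omegaS ω₀ x : ℂ)
    refine h1.unique (((h (diracOp P Q ω₀ ξ) x).add (hA.hasSum ξ x)).congr_fun fun y => ?_)
    change _ = kernel f x.1 y.1 * ((S.omegaS ω₀ y : ℂ) * (ξ : HilbertSp P Q) y) + _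
    push_cast
    ring
  refine ⟨fun ξ => mem_diagOp_domain_of_eq (key ξ), ‖A‖, fun ξ => ?_⟩
  have e : diracOp P Q ω₀ ⟨T ξ, mem_diagOp_domain_of_eq (key ξ)⟩ =
      T (diracOp P Q ω₀ ξ) + A ξ := by
    ext x
    exact key ξ x
  rw [e, add_sub_cancel_left]
  exact A.le_opNorm _

theorem hasBoundedCommutator_of_mem_span (hε : 0 < ε) (hε' : ε ≤ S.εX / 2)
    (hPQ : Disjoint P.carrier Q.carrier) (hω : IsCutoff P ε ω₀)
    (hT : T ∈ Submodule.span ℂ (crossedMonomials P Q)) :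
    HasBoundedCommutator (diracOp P Q ω₀) T := by
  induction hT using Submodule.span_induction with
  | mem b hb =>
    obtain ⟨f, A, k, hA, rfl⟩ := hb
    exact (hA.hasBoundedCommutator hε hε' hPQ hω).mul
      (hasBoundedCommutator_unitaryPow hε hε' hPQ hω k)
  | zero => exact HasBoundedCommutator.zero
  | add b c _ _ hb hc => exact hb.add hc
  | smul z b _ hb => exact hb.smul z

theorem not_bounded_diracOp [Nonempty (heteroclinic P Q)] (hε : 0 < ε) (hε' : ε ≤ S.εX / 2)
    (hPQ : Disjoint P.carrier Q.carrier) (hω : IsCutoff P ε ω₀) :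
    ¬ ∃ C : ℝ, ∀ ξ : (diracOp P Q ω₀).domain, ‖diracOp P Q ω₀ ξ‖ ≤ C * ‖(ξ : HilbertSp P Q)‖ := by
  rintro ⟨C, hC⟩
  obtain ⟨x⟩ := ‹Nonempty (heteroclinic P Q)›
  obtain ⟨n, hn⟩ := exists_nat_gt (C + S.omegaS ω₀ x)
  have h := hC ⟨basisVec ((heteroclinicPerm P Q ^ (n : ℤ)) x), basisVec_mem_diagOp_domain _ _⟩
  have e := diagOp_basisVec (fun x : heteroclinic P Q => S.omegaS ω₀ x)
    ((heteroclinicPerm P Q ^ (n : ℤ)) x)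
  unfold diracOp at h
  rw [e, norm_smul, norm_basisVec, Complex.norm_real, mul_one, mul_one,
    omegaS_perm_zpow hε hε' hPQ hω, Real.norm_eq_abs] at h
  have := neg_abs_le (S.omegaS ω₀ x - (n : ℤ))
  push_cast at this h
  linarith

/-! ### Compactness of the resolvent -/

theorem unitaryPow_mul_of_isDiag {c : heteroclinic P Q → ℂ}
    {R R' : HilbertSp P Q →L[ℂ] HilbertSp P Q} {k : ℤ} (h : IsDiag R c)
    (h' : IsDiag R' fun x => c ((heteroclinicPerm P Q ^ (-k)) x)) :
    unitaryPow P Q k * R = R' * unitaryPow P Q k := by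
  ext ξ x
  rw [mul_apply_eq_comp, mul_apply_eq_comp, h', unitaryPow_apply, unitaryPow_apply, h]

/-- `π(f)` times a diagonal operator only sees the diagonal entries over the source of the support
of `f`. -/
theorem Represents.isCompactOperator_mul (h : Represents P f T) {c : heteroclinic P Q → ℂ}
    {R : HilbertSp P Q →L[ℂ] HilbertSp P Q} (hR : IsDiag R c) {C : ℝ} (hC : ∀ x, ‖c x‖ ≤ C)
    (hc : ∀ K : Set (UnstableSpace Q), IsCompact K → ∀ η : ℝ, 0 < η →
      {x | toUnstable x ∈ K ∧ η ≤ ‖c x‖}.Finite) : IsCompactOperator (T * R) := by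
  classical
  set K := StableGroupoid.s '' tsupport f with hK
  have hKc : IsCompact K := f.hasCompactSupport.isCompact.image StableGroupoid.continuous_s
  obtain ⟨R', hR', -⟩ := exists_isDiag (c := fun x => if toUnstable x ∈ K then c x else 0) (C := C)
    fun x => by
      split_ifs
      · exact hC x
      · rw [norm_zero]; exact (norm_nonneg _).trans (hC x)
  have hcomp : IsCompactOperator R' := isCompactOperator_of_isDiag hR' fun η hη =>
    (hc K hKc η hη).subset fun x hx => by
      rw [Set.mem_ofPred_eq] at hx
      by_cases hxK : toUnstable x ∈ K
      · rw [if_pos hxK] at hx; exact ⟨hxK, hx⟩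
      · rw [if_neg hxK, norm_zero] at hx; exact absurd hη (not_lt.2 hx)
  have e : T * R = T * R' := by
    ext ξ x
    refine (h (R ξ) x).unique ((h (R' ξ) x).congr_fun fun y => ?_)
    rw [hR, hR']
    dsimp only
    by_cases hy : toUnstable y ∈ K
    · rw [if_pos hy]
    · by_cases hxy : kernel f x.1 y.1 = 0
      · rw [hxy, zero_mul, zero_mul]
      · obtain ⟨g, -, hs, hg⟩ := exists_of_kernel_ne_zero hxy
        refine absurd ⟨g, subset_tsupport _ ?_, Subtype.ext hs⟩ hy
        rw [Function.mem_support, hg]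
        exact hxy
  rw [e]
  exact hcomp.clm_comp T

theorem isCompactOperator_mul_of_mem_ruelleAlgebra (hε : 0 < ε) (hε' : ε ≤ S.εX / 2)
    (hPQ : Disjoint P.carrier Q.carrier) (hω : IsCutoff P ε ω₀)
    {R : HilbertSp P Q →L[ℂ] HilbertSp P Q}
    (hR : IsDiag R fun x => ((1 + S.omegaS ω₀ x ^ 2)⁻¹ : ℝ)) (hT : T ∈ ruelleAlgebra P Q) :
    IsCompactOperator (T * R) := by
  rw [ruelleAlgebra_eq] at hT
  have hcl := isClosed_setOfPred_isCompactOperator (σ₁₂ := RingHom.id ℂ)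
    (M₁ := HilbertSp P Q) (M₂ := HilbertSp P Q)
  have hcont : Continuous fun b : HilbertSp P Q →L[ℂ] HilbertSp P Q => b * R :=
    continuous_mul_const _
  refine hcl.closure_subset (map_mem_closure (f := fun b => b * R)
    (s := (Submodule.span ℂ (crossedMonomials P Q) : Set (HilbertSp P Q →L[ℂ] HilbertSp P Q)))
    hcont hT fun b hb => ?_)
  induction hb using Submodule.span_induction with
  | mem b hb =>
    obtain ⟨f, A, k, hA, rfl⟩ := hb
    have hle : ∀ x : heteroclinic P Q, ‖(((1 + S.omegaS ω₀
        ((heteroclinicPerm P Q ^ (-k)) x : X) ^ 2)⁻¹ : ℝ) : ℂ)‖ ≤ 1 := fun x => by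
      rw [Complex.norm_real, Real.norm_eq_abs, abs_of_pos (by positivity)]
      exact inv_le_one_of_one_le₀ (by nlinarith [sq_nonneg (S.omegaS ω₀
        ((heteroclinicPerm P Q ^ (-k)) x : X))])
    obtain ⟨R', hR', -⟩ := exists_isDiag hle
    -- moving `R` past `u^k` turns it into a diagonal operator that still decays on compact sets
    change IsCompactOperator (A * unitaryPow P Q k * R)
    rw [mul_assoc, unitaryPow_mul_of_isDiag hR hR', ← mul_assoc]
    refine (hA.isCompactOperator_mul hR' hle fun K hK η hη => ?_).comp_clm (unitaryPow P Q k)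
    refine (finite_omegaS_le (P := P) hε hε' hPQ hω hK (η⁻¹ + 1 - k)).subset fun x hx => ?_
    obtain ⟨hxK, hx⟩ := hx
    refine ⟨hxK, ?_⟩
    rw [Complex.norm_real, Real.norm_eq_abs, abs_of_pos (by positivity),
      omegaS_perm_zpow hε hε' hPQ hω, le_inv_comm₀ hη (by positivity)] at hx
    push_cast at hx
    nlinarith [sq_nonneg (S.omegaS ω₀ x + k - 1)]
  | zero =>
    change IsCompactOperator ((0 : HilbertSp P Q →L[ℂ] HilbertSp P Q) * R)
    rw [zero_mul]
    exact isCompactOperator_zero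
  | add b c _ _ hb hc =>
    change IsCompactOperator ((b + c) * R)
    rw [add_mul]
    exact IsCompactOperator.add hb hc
  | smul z b _ hb =>
    change IsCompactOperator ((z • b) * R)
    rw [smul_mul_assoc]
    exact IsCompactOperator.smul hb z

end Dirac

end SmaleSpace

/-! ### Exponential growth against Gaussian decay -/

/-- If the number of `x ∈ s` with `w x ≤ n` grows at most exponentially in `n`, then
`∑_{x ∈ s} exp (-t (1 + w(x)²))` converges for all `t > 0`. -/
theorem summable_exp_neg_one_add_sq {ι : Type*} {w : ι → ℝ} {s : Set ι} {C M : ℕ}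
    (h : ∀ (n : ℕ) (T : Finset ι), (∀ x ∈ T, x ∈ s ∧ w x ≤ n) → T.card ≤ C * M ^ n)
    {t : ℝ} (ht : 0 < t) : Summable (s.indicator fun x => Real.exp (-t * (1 + w x ^ 2))) := by
  classical
  rw [← summable_subtype_iff_indicator]
  set q : ℝ := 2 * (M + 1) with hq
  have hq0 : 0 < q := by positivity
  have hq1 : 1 ≤ q := by rw [hq]; linarith [(Nat.cast_nonneg M : (0 : ℝ) ≤ M)]
  set c : ℝ := Real.log q with hc
  have hc0 : 0 ≤ c := Real.log_nonneg hq1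
  set D : ℝ := Real.exp (c ^ 2 / (4 * t) + c) with hD
  have hD0 : 0 < D := Real.exp_pos _
  -- completing the square: `t w² ≥ c |w| - c² / (4 t)`
  have hbound : ∀ x, Real.exp (-t * (1 + w x ^ 2)) ≤ D * (q⁻¹) ^ ⌈w x⌉₊ := fun x => by
    have e : (q⁻¹) ^ ⌈w x⌉₊ = Real.exp (-c * ⌈w x⌉₊) := by
      rw [mul_comm, Real.exp_nat_mul, Real.exp_neg, hc, Real.exp_log hq0]
    rw [e, hD, ← Real.exp_add, Real.exp_le_exp]
    have h1 : (⌈w x⌉₊ : ℝ) ≤ |w x| + 1 :=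
      (Nat.cast_le.2 (Nat.ceil_mono (le_abs_self _))).trans
        (Nat.ceil_lt_add_one (abs_nonneg _)).le
    have h2 : c ^ 2 / (4 * t) - c * |w x| + t * |w x| ^ 2 = (c - 2 * t * |w x|) ^ 2 / (4 * t) := by
      field_simp
      ring
    have h3 : 0 ≤ (c - 2 * t * |w x|) ^ 2 / (4 * t) := by positivity
    rw [sq_abs] at h2
    nlinarith [mul_le_mul_of_nonneg_left h1 hc0]
  refine summable_of_sum_le (c := ∑' j : ℕ, C * D * (1 / 2 : ℝ) ^ j)
    (fun x => (Real.exp_pos _).le) fun u => ?_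
  have hterm : ∀ j : ℕ, ((u.filter fun x : s => ⌈w x⌉₊ = j).card : ℝ) * (D * (q⁻¹) ^ j) ≤
      C * D * (1 / 2 : ℝ) ^ j := fun j => by
    have h1 : ((u.filter fun x : s => ⌈w x⌉₊ = j).card : ℝ) ≤ C * M ^ j := by
      rw [← Finset.card_map (Function.Embedding.subtype (· ∈ s))]
      refine mod_cast h j _ fun x hx => ?_
      obtain ⟨y, hy, rfl⟩ := Finset.mem_map.1 hx
      refine ⟨y.2, (Nat.le_ceil _).trans ?_⟩
      exact_mod_cast (Finset.mem_filter.1 hy).2.le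
    have h2 : (M : ℝ) ^ j * (q⁻¹) ^ j ≤ (1 / 2 : ℝ) ^ j := by
      rw [← mul_pow]
      refine pow_le_pow_left₀ (by positivity) ?_ j
      rw [← div_eq_mul_inv, div_le_div_iff₀ hq0 two_pos, hq]
      linarith
    calc ((u.filter fun x : s => ⌈w x⌉₊ = j).card : ℝ) * (D * (q⁻¹) ^ j)
        ≤ C * M ^ j * (D * (q⁻¹) ^ j) := mul_le_mul_of_nonneg_right h1 (by positivity)
      _ = C * D * (M ^ j * (q⁻¹) ^ j) := by ring
      _ ≤ _ := mul_le_mul_of_nonneg_left h2 (by positivity)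
  calc ∑ x ∈ u, Real.exp (-t * (1 + w x ^ 2)) ≤ ∑ x ∈ u, D * (q⁻¹) ^ ⌈w x⌉₊ :=
        Finset.sum_le_sum fun x _ => hbound x
    _ = ∑ j ∈ u.image fun x : s => ⌈w x⌉₊,
          ((u.filter fun x : s => ⌈w x⌉₊ = j).card : ℝ) * (D * (q⁻¹) ^ j) := by
        rw [Finset.sum_comp (fun j => D * (q⁻¹) ^ j) fun x : s => ⌈w x⌉₊]
        simp only [nsmul_eq_mul]
    _ ≤ ∑ j ∈ u.image fun x : s => ⌈w x⌉₊, C * D * (1 / 2 : ℝ) ^ j :=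
        Finset.sum_le_sum fun j _ => hterm j
    _ ≤ _ := ((summable_geometric_two).mul_left _).sum_le_tsum _ fun j _ => by positivity

namespace SmaleSpace

variable {X : Type*} [MetricSpace X] [CompactSpace X] {S : SmaleSpace X} {P Q : S.PeriodicSet}
  {ε : ℝ} {ω₀ : X → ℝ}

/-! ### Absence of a unit -/

theorem Represents.apply_basisVec_eq_zero {f : C_c(StableGroupoid Q, ℂ)}
    {T : HilbertSp P Q →L[ℂ] HilbertSp P Q} (h : Represents P f T) {y : heteroclinic P Q}
    (hy : toUnstable y ∉ StableGroupoid.s '' tsupport f) : T (basisVec y) = 0 := by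
  ext x
  rw [represents_iff.1 h]
  by_contra hxy
  obtain ⟨g, -, hs, hg⟩ := exists_of_kernel_ne_zero hxy
  refine hy ⟨g, subset_tsupport _ ?_, Subtype.ext hs⟩
  rw [Function.mem_support, hg]
  exact hxy

/-- Forward orbits leave every compact subset of `X^u(Q)`, so each element of the algebraic crossed
product kills `δ_{φ^n(x)}` for large `n`. -/
theorem eventually_apply_basisVec_eq_zero (hε : 0 < ε) (hε' : ε ≤ S.εX / 2)
    (hPQ : Disjoint P.carrier Q.carrier) (hω : IsCutoff P ε ω₀) (x : heteroclinic P Q)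
    {T : HilbertSp P Q →L[ℂ] HilbertSp P Q}
    (hT : T ∈ Submodule.span ℂ (crossedMonomials P Q)) :
    ∀ᶠ n : ℕ in atTop, T (basisVec ((heteroclinicPerm P Q ^ (n : ℤ)) x)) = 0 := by
  induction hT using Submodule.span_induction with
  | mem b hb =>
    obtain ⟨f, A, k, hA, rfl⟩ := hb
    have hw := fun n : ℕ => omegaS_perm_zpow hε hε' hPQ hω (k + n) x
    have hinj : Function.Injective fun n : ℕ => (heteroclinicPerm P Q ^ (k + n : ℤ)) x := by
      intro m n hmn
      have h1 := hw m
      dsimp only at hmn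
      rw [hmn, hw n] at h1
      push_cast at h1
      exact_mod_cast (by linarith : (m : ℝ) = n)
    have hfin := (finite_omegaS_le (P := P) hε hε' hPQ hω
      (f.hasCompactSupport.isCompact.image StableGroupoid.continuous_s)
      (S.omegaS ω₀ x - k)).preimage hinj.injOn
    have := hfin.compl_mem_cofinite
    rw [Nat.cofinite_eq_atTop] at this
    filter_upwards [this] with n hn
    rw [mul_apply_eq_comp, unitaryPow_basisVec, ← Equiv.Perm.mul_apply, ← zpow_add]
    refine hA.apply_basisVec_eq_zero fun hK => hn ⟨hK, ?_⟩
    dsimp only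
    rw [hw n]
    push_cast
    linarith [(Nat.cast_nonneg n : (0 : ℝ) ≤ n)]
  | zero => exact Eventually.of_forall fun n => rfl
  | add b c _ _ hb hc =>
    filter_upwards [hb, hc] with n h1 h2
    rw [add_apply, h1, h2, add_zero]
  | smul z b _ hb =>
    filter_upwards [hb] with n h1
    rw [smul_apply, h1, smul_zero]

theorem isNonUnital_ruelleAlgebra [Nonempty (heteroclinic P Q)] (hε : 0 < ε) (hε' : ε ≤ S.εX / 2)
    (hPQ : Disjoint P.carrier Q.carrier) (hω : IsCutoff P ε ω₀) :
    IsNonUnital (ruelleAlgebra P Q) := by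
  rintro ⟨e, he, hunit⟩
  -- a unit fixes every `δ_x`, because `C_c(X^u(Q))` acts nondegenerately
  have he1 : e = 1 := by
    refine HasMatrix.unique (k := fun x y => basisVec y x) (fun x y => ?_) fun x y => rfl
    obtain ⟨a, ha⟩ := exists_unstableSpace_apply_eq_one (toUnstable y)
    obtain ⟨T, hT⟩ := exists_representsUnitSpace P a
    have h1 : T (basisVec y) = basisVec y := by
      rw [IsDiag.apply_basisVec (c := fun x : heteroclinic P Q => a (toUnstable x)) hT, ha,
        one_smul]
    have h2 := congrArg (fun b : HilbertSp P Q →L[ℂ] HilbertSp P Q => b (basisVec y))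
      (hunit T hT.mem_ruelleAlgebra).1
    dsimp only at h2 ⊢
    rw [mul_apply_eq_comp, h1] at h2
    rw [h2]
  rw [he1, ruelleAlgebra_eq] at he
  obtain ⟨b, hb, hlt⟩ := Metric.mem_closure_iff.1 he 1 one_pos
  obtain ⟨x⟩ := ‹Nonempty (heteroclinic P Q)›
  obtain ⟨n, hn⟩ := (eventually_apply_basisVec_eq_zero hε hε' hPQ hω x hb).exists
  have h := (1 - b).le_opNorm (basisVec ((heteroclinicPerm P Q ^ (n : ℤ)) x))
  rw [sub_apply, hn, sub_zero, norm_basisVec, mul_one, ← dist_eq_norm] at h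
  change ‖basisVec ((heteroclinicPerm P Q ^ (n : ℤ)) x)‖ ≤ _ at h
  rw [norm_basisVec] at h
  exact absurd h (not_le.2 hlt)

/-! ### The spectral triple -/

theorem exists_isDiag_resolvent (P Q : S.PeriodicSet) (ω₀ : X → ℝ) :
    ∃ R : HilbertSp P Q →L[ℂ] HilbertSp P Q,
      IsDiag R fun x => ((1 + S.omegaS ω₀ x ^ 2)⁻¹ : ℝ) := by
  obtain ⟨R, hR, -⟩ := exists_isDiag (C := 1)
    (c := fun x : heteroclinic P Q => (((1 + S.omegaS ω₀ x ^ 2)⁻¹ : ℝ) : ℂ)) fun x => by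
      rw [Complex.norm_real, Real.norm_eq_abs, abs_of_pos (by positivity)]
      exact inv_le_one_of_one_le₀ (by nlinarith [sq_nonneg (S.omegaS ω₀ x)])
  exact ⟨R, hR⟩

theorem isSpectralTriple_ruelleAlgebra [Nonempty (heteroclinic P Q)] (hε : 0 < ε)
    (hε' : ε ≤ S.εX / 2) (hPQ : Disjoint P.carrier Q.carrier) (hω : IsCutoff P ε ω₀) :
    IsSpectralTriple (ruelleAlgebra P Q) (diracOp P Q ω₀) where
  separable := by
    have := heteroclinic_countable P Q
    exact separableSpace_lp
  mul_mem _ ha _ hb := mul_mem_ruelleAlgebra ha hb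
  star_mem _ ha := star_mem_ruelleAlgebra ha
  selfAdjoint := isSelfAdjoint_diagOp _
  unbounded := not_bounded_diracOp hε hε' hPQ hω
  dense_commutator a ha := by
    rw [ruelleAlgebra_eq] at ha ⊢
    have h : (Submodule.span ℂ (crossedMonomials P Q) : Set (HilbertSp P Q →L[ℂ] HilbertSp P Q)) ⊆
        {b | b ∈ (Submodule.span ℂ (crossedMonomials P Q)).topologicalClosure ∧
          HasBoundedCommutator (diracOp P Q ω₀) b} := fun b hb =>
      ⟨Submodule.le_topologicalClosure _ hb, hasBoundedCommutator_of_mem_span hε hε' hPQ hω hb⟩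
    exact closure_mono h ha
  compact_resolvent := by
    obtain ⟨R, hR⟩ := exists_isDiag_resolvent P Q ω₀
    exact ⟨R, isInvOneAddSq_diagOp hR, fun a ha =>
      isCompactOperator_mul_of_mem_ruelleAlgebra hε hε' hPQ hω hR ha⟩

theorem isThetaSummableOn_unitSpaceOps (hε : 0 < ε)
    (hε' : ε ≤ S.εX / 2) (hPQ : Disjoint P.carrier Q.carrier) (hω : IsCutoff P ε ω₀) :
    IsThetaSummableOn (unitSpaceOps P Q) (diracOp P Q ω₀) := by
  obtain ⟨R, hR⟩ := exists_isDiag_resolvent P Q ω₀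
  refine ⟨R, isInvOneAddSq_diagOp hR, ?_⟩
  rintro T ⟨a, hT⟩ t ht
  have hT' : IsDiag T fun x : heteroclinic P Q => a (toUnstable x) := hT
  refine isTraceClass_of_isDiag (hT'.mul (hR.heatOp (fun x => by positivity) ht)) ?_
  obtain ⟨C, M, hCM⟩ := exists_card_omegaS_le (P := P) hε hε' hPQ hω a.hasCompactSupport.isCompact
  obtain ⟨B, hB⟩ := a.hasCompactSupport.exists_bound_of_continuous a.continuous
  have hsum := (summable_exp_neg_one_add_sq (w := fun x : heteroclinic P Q => S.omegaS ω₀ x)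
    (s := {x | toUnstable x ∈ tsupport a}) hCM ht).mul_left B
  refine hsum.of_nonneg_of_le (fun x => norm_nonneg _) fun x => ?_
  by_cases hx : toUnstable x ∈ tsupport a
  · rw [Set.indicator_of_mem (show x ∈ {x | toUnstable x ∈ tsupport a} from hx), norm_mul,
      Complex.norm_real, Real.norm_eq_abs, abs_of_pos (Real.exp_pos _), div_inv_eq_mul]
    exact mul_le_mul_of_nonneg_right (hB _) (Real.exp_pos _).le
  · rw [Set.indicator_of_notMem (show x ∉ {x | toUnstable x ∈ tsupport a} from hx),
      image_eq_zero_of_notMem_tsupport hx, zero_mul, norm_zero, mul_zero]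

end SmaleSpace

theorem theorem4p9 {X : Type*} [MetricSpace X] [CompactSpace X] (S : SmaleSpace X)
    (hS : S.IsIrreducible) (P Q : S.PeriodicSet)
    (hP : P.carrier.Nonempty) (hQ : Q.carrier.Nonempty) (hPQ : Disjoint P.carrier Q.carrier)
    (ε : ℝ) (hε : 0 < ε) (hε' : ε ≤ S.lam⁻¹ * S.εX / 2)
    (ω₀ : X → ℝ) (hω₀ : SmaleSpace.IsCutoff P ε ω₀) :
    -- every compactly supported continuous function on the groupoid acts as a bounded operator
    (∀ f : C_c(SmaleSpace.StableGroupoid Q, ℂ), ∃ T, SmaleSpace.Represents P f T) ∧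
    -- covariance: `u π(f) u⁻¹ = π(α(f))`, where `α(f)(φ x, φ y) = f(x, y)`
    (∀ f : C_c(SmaleSpace.StableGroupoid Q, ℂ), ∃ f' : C_c(SmaleSpace.StableGroupoid Q, ℂ),
      (∀ g, f' (SmaleSpace.groupoidShift Q g) = f g) ∧
      ∀ T, SmaleSpace.Represents P f T →
        SmaleSpace.Represents P f'
          (SmaleSpace.unitaryPow P Q 1 * T * SmaleSpace.unitaryPow P Q (-1))) ∧
    -- `[u, D] = u` on the domain of `D`
    (∀ ξ : (SmaleSpace.diracOp P Q ω₀).domain,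
      ∃ h : SmaleSpace.canonicalUnitary P Q ξ ∈ (SmaleSpace.diracOp P Q ω₀).domain,
        SmaleSpace.canonicalUnitary P Q (SmaleSpace.diracOp P Q ω₀ ξ) -
            SmaleSpace.diracOp P Q ω₀ ⟨SmaleSpace.canonicalUnitary P Q ξ, h⟩ =
          SmaleSpace.canonicalUnitary P Q ξ) ∧
    -- a spectral triple over the stable Ruelle algebra, which has no unit
    IsSpectralTriple (SmaleSpace.ruelleAlgebra P Q) (SmaleSpace.diracOp P Q ω₀) ∧
    IsNonUnital (SmaleSpace.ruelleAlgebra P Q) ∧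
    -- `C_c(X^u(Q))` acts by elements of the algebra, and the triple is `θ`-summable
    (∀ a : C_c(SmaleSpace.UnstableSpace Q, ℂ), ∃ T ∈ SmaleSpace.ruelleAlgebra P Q,
      SmaleSpace.RepresentsUnitSpace P a T) ∧
    IsThetaSummableOn (SmaleSpace.unitSpaceOps P Q) (SmaleSpace.diracOp P Q ω₀) := by
  have hε'' : ε ≤ S.εX / 2 := by
    refine hε'.trans ?_
    rw [mul_div_assoc]
    exact mul_le_of_le_one_left (half_pos S.εX_pos).le S.lam_inv_lt_one.le
  have := SmaleSpace.heteroclinic_nonempty hS hP hQ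
  refine ⟨SmaleSpace.exists_represents P, fun f => ⟨SmaleSpace.alphaCc f, fun g => ?_, fun T hT =>
    hT.alphaCc⟩, fun ξ => ?_, SmaleSpace.isSpectralTriple_ruelleAlgebra hε hε'' hPQ hω₀,
    SmaleSpace.isNonUnital_ruelleAlgebra hε hε'' hPQ hω₀, fun a => ?_,
    SmaleSpace.isThetaSummableOn_unitSpaceOps hε hε'' hPQ hω₀⟩
  · exact congrArg f ((SmaleSpace.shiftHomeomorph Q).symm_apply_apply g)
  · obtain ⟨h, h'⟩ := SmaleSpace.exists_unitaryPow_mem_domain hε hε'' hPQ hω₀ 1 ξ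
    have hu : ∀ η, SmaleSpace.unitaryPow P Q 1 η = SmaleSpace.canonicalUnitary P Q η := fun η => by
      change (SmaleSpace.canonicalUnitary P Q ^ (1 : ℤ)) η = _
      rw [zpow_one]
    simp only [hu] at h h'
    refine ⟨h, ?_⟩
    rw [← neg_sub, h', Int.cast_one, neg_smul, one_smul, neg_neg]
  · obtain ⟨T, hT⟩ := SmaleSpace.exists_representsUnitSpace P a
    exact ⟨T, hT.mem_ruelleAlgebra, hT⟩
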